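/- Let $\Omega=(0,L_x)\times(0,L_y)\times(0,L_z)$, $T,\varepsilon,\gamma>0$, and let $(\phi_e,p_e)$ be a classical solution on $\Omega\times(0,T)$ of the Cahn--Hilliard--Hele--Shaw system $$\partial_t\phi=\Delta\mu-\nabla\cdot(\phi\mathbf u),\quad \mathbf u=-\nabla p-\gamma\phi\nabla\mu,\quad \nabla\cdot\mathbf u=0,\quad \mu=\phi^3-\phi-\varepsilon^2\Delta\phi,$$ with $\partial_n\phi=\partial_n\mu=\partial_n p=0$ on $\partial\Omega\times(0,T]$, such that $\phi_e\in\mathcal R:=H^3(0,T;C^0(\overline\Omega))\cap H^2(0,T;C^4(\overline\Omega))\cap L^\infty(0,T;C^6(\overline\Omega))$. **Grid.** Let $N_x,N_y,N_z\ge1$ be integers with $h=L_x/N_x=L_y/N_y=L_z/N_z$. Cell-centred grid functions live on the cells with centres $((i-\frac12)h,(j-\frac12)h,(k-\frac12)h)$ (with one layer of ghost cells), vector fields on the faces. $\nabla_h$ is the centred difference from cells to faces, $\nabla_h\cdot$ the centred difference from faces to cells, $A_h$ the two-point average from cells to faces, and $\Delta_h=\nabla_h\cdot\nabla_h$. The discrete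 homogeneous Neumann condition says that each ghost value equals the value of the adjacent interior cell; the ghost values of $\Delta_h\psi$ are fixed in this way. $\|\psi\|_2^2=h^3\sum_{\text{cells}}\psi^2$, and for face fields $\|\mathbf f\|_2^2$ is the sum over the three directions and over all cells of $\frac12h^3$ times the sum of the squares of the corresponding component of $\mathbf f$ on the two opposite faces of the cell; $\|\psi\|_\infty=\max_{\text{cells}}|\psi|$. For face fields $\mathbf f$ with $\mathbf f\cdot\mathbf n=0$, the discrete Helmholtz projection is $\mathcal P_h\mathbf f=\mathbf f+\nabla_hq$, where $\Delta_hq=-\nabla_h\cdot\mathbf f$ and $q$ satisfies the discrete Neumann condition. **Scheme.** Let $M\ge1$, $s=T/M$, $t_m=ms$, let $\Phi^m$ be the grid function of the values of $\phi_e(\cdot,t_m)$ at the cell centres, with ghost values given by the Neumann condition, and write $\chi(\varphi,\psi)=\frac14(\varphi^2+\psi^2)(\varphi+\psi)$ and $\psi_*^{m+1/2}=\frac32\psi^m-\frac12\psi^{m-1}$. Let $\phi^0=\Phi^0$, $\phi^1=\Phi^1$, and for $1\le m\le M-1$ let $\phi^{m+1},\mu^{m+1/2},p^{m+1/2}$ satisfy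 the discrete Neumann conditions and, on all cells (and faces), $$\frac{\phi^{m+1}-\phi^m}{s}=\Delta_h\mu^{m+1/2}-\nabla_h\cdot\big(A_h\phi_*^{m+1/2}\mathbf u^{m+1/2}\big),\qquad \nabla_h\cdot\mathbf u^{m+1/2}=0,$$ $$\mu^{m+1/2}=\chi(\phi^{m+1},\phi^m)-\phi_*^{m+1/2}-\varepsilon^2\Delta_h\big(\tfrac34\phi^{m+1}+\tfrac14\phi^{m-1}\big),\qquad \mathbf u^{m+1/2}=-\nabla_hp^{m+1/2}-\gamma A_h\phi_*^{m+1/2}\nabla_h\mu^{m+1/2}.$$ **Errors.** Put $\tilde\phi^m=\Phi^m-\phi^m$, $M_0^m=\|\phi^m\|_\infty$, $$\Gamma^{m+1/2}=\chi(\Phi^{m+1},\Phi^m)-\Phi_*^{m+1/2}-\varepsilon^2\Delta_h\big(\tfrac34\Phi^{m+1}+\tfrac14\Phi^{m-1}\big),\qquad \mathbf U^{m+1/2}=-\mathcal P_h\big(\gamma A_h\Phi_*^{m+1/2}\nabla_h\Gamma^{m+1/2}\big),$$ and define the local truncation error $\tau^{m+1/2}$ by $$\frac{\Phi^{m+1}-\Phi^m}{s}=\Delta_h\Gamma^{m+1/2}-\nabla_h\cdot\big(A_h\Phi_*^{m+1/2}\mathbf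 U^{m+1/2}\big)+\tau^{m+1/2}.$$ **Theorem (error stability law).** There are constants $C_{28},C_{29},C_{30}>0$ that do not depend on $h$, $s$, $m$ or the numerical solution (but may depend on $\Omega,T,\varepsilon,\gamma$ and the exact solution) such that, for all such $h$ and $s$, every such numerical solution and every $1\le m\le M-1$, $$\begin{aligned} &\|\nabla_h\tilde\phi^{m+1}\|_2^2-\|\nabla_h\tilde\phi^m\|_2^2+\tfrac14\big(\|\nabla_h(\tilde\phi^{m+1}-\tilde\phi^m)\|_2^2-\|\nabla_h(\tilde\phi^m-\tilde\phi^{m-1})\|_2^2\big)+\tfrac{11}{64}\varepsilon^2s\|\nabla_h\Delta_h\tilde\phi^{m+1}\|_2^2\\ &\le\tfrac{\varepsilon^2s}{16}\|\nabla_h\Delta_h\tilde\phi^m\|_2^2+\tfrac{5\varepsilon^2s}{64}\|\nabla_h\Delta_h\tilde\phi^{m-1}\|_2^2+2s\|\tau^{m+1/2}\|_2^2+sC_{28}D_3^{m+1}h^4\\ &\quad+s\big(C_{29}D_1^{m+1}+C_{30}D_2^{m+1}\big)\big(\|\nabla_h\tilde\phi^{m+1}\|_2^2+\|\nabla_h\tilde\phi^m\|_2^2+\|\nabla_h\tilde\phi^{m-1}\|_2^2\big),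 \end{aligned}$$ where $$\begin{aligned} D_1^{m+1}&=\big((M_0^m)^{16/3}+(M_0^{m-1})^{16/3}\big)\big((M_0^{m+1})^{8/3}+(M_0^m)^{8/3}+1\big)+1,\\ D_2^{m+1}&=\big((M_0^m)^4+(M_0^{m-1})^4+1\big)\big((M_0^{m+1})^4+(M_0^m)^4+1\big),\\ D_3^{m+1}&=M_0^{m+1}+M_0^m+1. \end{aligned}$$ -/

import Mathlib

open MeasureTheory Set
open scoped ContDiff

noncomputable section

/-! ## The continuous problem on the closed box `[0,L 0] × [0,L 1] × [0,L 2]` -/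

/-- The closed box `closure Ω`, where `Ω = (0,L_x) × (0,L_y) × (0,L_z)`. -/
abbrev closedBox (L : Fin 3 → ℝ) : Set (Fin 3 → ℝ) := Set.Icc 0 L

/-- The open box `Ω`. -/
def openBox (L : Fin 3 → ℝ) : Set (Fin 3 → ℝ) := {x | ∀ d, 0 < x d ∧ x d < L d}

/-- The partial derivative `∂_d f` on the closed box (one-sided at the boundary). -/
def pd (L : Fin 3 → ℝ) (d : Fin 3) (f : (Fin 3 → ℝ) → ℝ) (x : Fin 3 → ℝ) : ℝ :=
  fderivWithin ℝ f (closedBox L) x (Pi.single d 1)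

/-- Iterated partial derivatives, indexed by words in the coordinate directions. -/
def iterPd (L : Fin 3 → ℝ) : List (Fin 3) → ((Fin 3 → ℝ) → ℝ) → ((Fin 3 → ℝ) → ℝ)
  | [], f => f
  | d :: w, f => pd L d (iterPd L w f)

/-- The Laplacian on the closed box. -/
def contLap (L : Fin 3 → ℝ) (f : (Fin 3 → ℝ) → ℝ) (x : Fin 3 → ℝ) : ℝ :=
  ∑ d, pd L d (pd L d f) x

/-- The chemical potential `μ = φ³ - φ - ε² Δφ`. -/
def chemPot (L : Fin 3 → ℝ) (ε : ℝ) (f : (Fin 3 → ℝ) → ℝ) (x : Fin 3 → ℝ) : ℝ :=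
  f x ^ 3 - f x - ε ^ 2 * contLap L f x

/-- The Darcy velocity `u = -∇p - γ φ ∇μ`, component `d`. -/
def darcyVel (L : Fin 3 → ℝ) (ε γ : ℝ) (f q : (Fin 3 → ℝ) → ℝ) (d : Fin 3)
    (x : Fin 3 → ℝ) : ℝ :=
  -pd L d q x - γ * f x * pd L d (chemPot L ε f) x

/-- `(φ, p)` is a classical solution on `Ω × (0,T)` of the Cahn-Hilliard-Hele-Shaw system
`∂ₜφ = Δμ - ∇·(φ u)`, `u = -∇p - γ φ ∇μ`, `∇·u = 0`, `μ = φ³ - φ - ε² Δφ`,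
with `∂ₙφ = ∂ₙμ = ∂ₙp = 0` on `∂Ω × (0,T]`. -/
structure IsExactSolution (L : Fin 3 → ℝ) (T ε γ : ℝ)
    (φ p : ℝ → (Fin 3 → ℝ) → ℝ) : Prop where
  smooth_phi : ∀ t ∈ Set.Icc 0 T, ContDiffOn ℝ 4 (φ t) (closedBox L)
  smooth_p : ∀ t ∈ Set.Ioc 0 T, ContDiffOn ℝ 2 (p t) (closedBox L)
  evolution : ∀ t ∈ Set.Ioo 0 T, ∀ x ∈ openBox L,
    HasDerivAt (fun r => φ r x)
      (contLap L (chemPot L ε (φ t)) x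
        - ∑ d, pd L d (fun y => φ t y * darcyVel L ε γ (φ t) (p t) d y) x) t
  divFree : ∀ t ∈ Set.Ioo 0 T, ∀ x ∈ openBox L,
    ∑ d, pd L d (darcyVel L ε γ (φ t) (p t) d) x = 0
  boundary : ∀ t ∈ Set.Ioc 0 T, ∀ d, ∀ x ∈ closedBox L, (x d = 0 ∨ x d = L d) →
    pd L d (φ t) x = 0 ∧ pd L d (chemPot L ε (φ t)) x = 0 ∧ pd L d (p t) x = 0

/-- `F ∈ H^m(0,T;X)`: `F` and its weak time derivatives up to order `m` are in the Bochner
space `L²(0,T;X)`. -/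
def MemTimeSobolev {X : Type*} [NormedAddCommGroup X] [NormedSpace ℝ X]
    (T : ℝ) (m : ℕ) (F : ℝ → X) : Prop :=
  MemLp F 2 (volume.restrict (Set.Ioo 0 T)) ∧
  ∀ k ≤ m, ∃ G : ℝ → X, MemLp G 2 (volume.restrict (Set.Ioo 0 T)) ∧
    ∀ ψ : ℝ → ℝ, ContDiff ℝ ∞ ψ → HasCompactSupport ψ → tsupport ψ ⊆ Set.Ioo 0 T →
      ∫ t in Set.Ioo 0 T, iteratedDeriv k ψ t • F t
        = (-1 : ℝ) ^ k • ∫ t in Set.Ioo 0 T, ψ t • G t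

/-- `φ ∈ H^m(0,T;C^r(closure Ω))`. As `C^r` is a closed subspace of a finite product of copies of
`C^0` through `f ↦ (∂^α f)_{|α| ≤ r}`, this says that every `∂^α φ`, `|α| ≤ r`, is in
`H^m(0,T;C^0)`. -/
def MemHmCr (L : Fin 3 → ℝ) (T : ℝ) (m r : ℕ) (φ : ℝ → (Fin 3 → ℝ) → ℝ) : Prop :=
  (∀ᵐ t ∂(volume.restrict (Set.Ioo 0 T)), ContDiffOn ℝ r (φ t) (closedBox L)) ∧
  ∀ w : List (Fin 3), w.length ≤ r → ∃ F : ℝ → C(closedBox L, ℝ),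
    (∀ᵐ t ∂(volume.restrict (Set.Ioo 0 T)), ∀ x, F t x = iterPd L w (φ t) x) ∧
    MemTimeSobolev T m F

/-- `φ ∈ L^∞(0,T;C^r(closure Ω))`. -/
def MemLinftyCr (L : Fin 3 → ℝ) (T : ℝ) (r : ℕ) (φ : ℝ → (Fin 3 → ℝ) → ℝ) : Prop :=
  (∀ᵐ t ∂(volume.restrict (Set.Ioo 0 T)), ContDiffOn ℝ r (φ t) (closedBox L)) ∧
  ∀ w : List (Fin 3), w.length ≤ r → ∃ F : ℝ → C(closedBox L, ℝ),
    (∀ᵐ t ∂(volume.restrict (Set.Ioo 0 T)), ∀ x, F t x = iterPd L w (φ t) x) ∧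
    MemLp F ⊤ (volume.restrict (Set.Ioo 0 T))

/-- The regularity class `H³(0,T;C⁰) ∩ H²(0,T;C⁴) ∩ L^∞(0,T;C⁶)`. Such a function has a unique
representative that is continuous on `[0,T] × closure Ω`; it is the one meant by `φ`. -/
structure RegularityClass (L : Fin 3 → ℝ) (T : ℝ) (φ : ℝ → (Fin 3 → ℝ) → ℝ) : Prop where
  cont : ContinuousOn (Function.uncurry φ) (Set.Icc 0 T ×ˢ closedBox L)
  memH3C0 : MemHmCr L T 3 0 φ
  memH2C4 : MemHmCr L T 2 4 φ
  memLinftyC6 : MemLinftyCr L T 6 φ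

/-! ## The staggered grid -/

/-- Cell-centred grid functions. `φ i` is the value at the cell centre `((i d - 1/2) h)_d`. Only the
cells `1 ≤ i d ≤ N d` and the ghost cells `i d = 0`, `i d = N d + 1` are ever relevant. -/
abbrev CellFun : Type := (Fin 3 → ℤ) → ℝ

/-- Face-centred vector fields. `f d i` is the `d`-th component at the face between the cells `i`
and `i + e_d`. -/
abbrev FaceFun : Type := Fin 3 → (Fin 3 → ℤ) → ℝ

/-- The unit step in direction `d`. -/
def eu (d : Fin 3) : Fin 3 → ℤ := Pi.single d 1

/-- The set of (interior) cells. -/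
def cells (N : Fin 3 → ℕ) : Finset (Fin 3 → ℤ) :=
  Fintype.piFinset fun d => Finset.Icc 1 (N d : ℤ)

/-- The nearest interior cell. A ghost cell adjacent to a boundary face is sent to the cell on the
other side of that face. -/
def nearCell (N : Fin 3 → ℕ) (i : Fin 3 → ℤ) : Fin 3 → ℤ := fun d => max 1 (min (i d) (N d))

/-- The discrete homogeneous Neumann condition `n · ∇_h φ = 0`. -/
def HomNeumann (N : Fin 3 → ℕ) (φ : CellFun) : Prop :=
  ∀ i ∈ cells N, ∀ d, (i d = 1 → φ (i - eu d) = φ i) ∧ (i d = N d → φ (i + eu d) = φ i)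

/-- The discrete condition `n · f = 0`. -/
def NoFlux (N : Fin 3 → ℕ) (f : FaceFun) : Prop :=
  ∀ i ∈ cells N, ∀ d, (i d = 1 → f d (i - eu d) = 0) ∧ (i d = N d → f d i = 0)

/-- `∇_h φ`. -/
def gradh (h : ℝ) (φ : CellFun) : FaceFun := fun d i => (φ (i + eu d) - φ i) / h

/-- `A_h φ`. -/
def avgh (φ : CellFun) : FaceFun := fun d i => (φ i + φ (i + eu d)) / 2

/-- `∇_h · f`. -/
def divh (h : ℝ) (f : FaceFun) : CellFun := fun i => ∑ d, (f d i - f d (i - eu d)) / h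

/-- `Δ_h φ = ∇_h · ∇_h φ` on the cells, with ghost values fixed by the homogeneous Neumann
condition. -/
def laph (N : Fin 3 → ℕ) (h : ℝ) (φ : CellFun) : CellFun :=
  fun i => divh h (gradh h φ) (nearCell N i)

/-- `(φ, ψ)` for cell-centred functions. -/
def cellInner (N : Fin 3 → ℕ) (h : ℝ) (φ ψ : CellFun) : ℝ := h ^ 3 * ∑ i ∈ cells N, φ i * ψ i

/-- `(f, g) = [f^x,g^x]_x + [f^y,g^y]_y + [f^z,g^z]_z` for face-centred vector fields. -/
def faceInner (N : Fin 3 → ℕ) (h : ℝ) (f g : FaceFun) : ℝ :=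
  ∑ d, 1 / 2 * h ^ 3 *
    ∑ i ∈ cells N, (f d i * g d i + f d (i - eu d) * g d (i - eu d))

/-- `‖φ‖₂` for cell-centred functions. -/
def cellNorm (N : Fin 3 → ℕ) (h : ℝ) (φ : CellFun) : ℝ := Real.sqrt (cellInner N h φ φ)

/-- `‖f‖₂` for face-centred vector fields. -/
def faceNorm (N : Fin 3 → ℕ) (h : ℝ) (f : FaceFun) : ℝ := Real.sqrt (faceInner N h f f)

/-- `‖φ‖_∞`, the maximum over the cells. -/
def supNorm (N : Fin 3 → ℕ) (φ : CellFun) : ℝ := ⨆ i : {i // i ∈ cells N}, |φ i|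

/-! ### The discrete Helmholtz projection -/

theorem mem_cells {N : Fin 3 → ℕ} {i : Fin 3 → ℤ} :
    i ∈ cells N ↔ ∀ d, 1 ≤ i d ∧ i d ≤ N d := by
  simp [cells]

/-- The discrete Poisson problem `Δ_h q = -∇_h · f`, `n · ∇_h q = 0`. -/
def IsHelmholtzPotential (N : Fin 3 → ℕ) (h : ℝ) (f : FaceFun) (q : CellFun) : Prop :=
  HomNeumann N q ∧ ∀ i ∈ cells N, laph N h q i = -divh h f i

theorem nearCell_mem {N : Fin 3 → ℕ} (hN : ∀ d, 0 < N d) (i : Fin 3 → ℤ) :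
    nearCell N i ∈ cells N := by
  rw [mem_cells]
  intro d
  have := hN d
  simp only [nearCell]
  omega

theorem nearCell_of_mem {N : Fin 3 → ℕ} {i : Fin 3 → ℤ} (hi : i ∈ cells N) :
    nearCell N i = i := by
  rw [mem_cells] at hi
  funext d
  have := hi d
  simp only [nearCell]
  omega

theorem sum_cells_sub {N : Fin 3 → ℕ} (g : CellFun) (d : Fin 3)
    (h0 : ∀ i ∈ cells N, i d = 1 → g (i - eu d) = 0)
    (h1 : ∀ i ∈ cells N, i d = N d → g i = 0) :
    ∑ i ∈ cells N, (g i - g (i - eu d)) = 0 := by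
  have e1 : ∑ i ∈ cells N, g i = ∑ i ∈ (cells N).filter (fun i => i d ≠ (N d : ℤ)), g i := by
    rw [Finset.sum_filter]
    refine Finset.sum_congr rfl fun i hi => ?_
    by_cases hd : i d = N d
    · simp [hd, h1 i hi hd]
    · simp [hd]
  have e2 : ∑ i ∈ cells N, g (i - eu d)
      = ∑ i ∈ (cells N).filter (fun i => i d ≠ 1), g (i - eu d) := by
    rw [Finset.sum_filter]
    refine Finset.sum_congr rfl fun i hi => ?_
    by_cases hd : i d = 1
    · simp [hd, h0 i hi hd]
    · simp [hd]
  rw [Finset.sum_sub_distrib, e1, e2, sub_eq_zero]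
  refine Finset.sum_bij' (fun i _ => i + eu d) (fun i _ => i - eu d) ?_ ?_ ?_ ?_ ?_
  · intro i hi
    simp only [Finset.mem_filter, mem_cells] at hi ⊢
    obtain ⟨hi, hd⟩ := hi
    refine ⟨fun e => ?_, ?_⟩
    · have := hi e
      by_cases he : e = d
      · subst he; simp [eu]; omega
      · simp [eu, he]; omega
    · have := hi d
      simp [eu]; omega
  · intro i hi
    simp only [Finset.mem_filter, mem_cells] at hi ⊢
    obtain ⟨hi, hd⟩ := hi
    refine ⟨fun e => ?_, ?_⟩
    · have := hi e
      by_cases he : e = d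
      · subst he; simp [eu]; omega
      · simp [eu, he]; omega
    · have := hi d
      simp [eu]; omega
  · intro i _; simp
  · intro i _; simp
  · intro i _; simp

/-- The discrete Poisson problem is solvable for every `f` with `n · f = 0`. -/
theorem exists_helmholtzPotential {N : Fin 3 → ℕ} (hN : ∀ d, 0 < N d) {h : ℝ} (hh : 0 < h)
    (f : FaceFun) (hf : NoFlux N f) : ∃ q, IsHelmholtzPotential N h f q := by
  let W := {i // i ∈ cells N} → ℝ
  let ext : W → CellFun := fun u i => u ⟨nearCell N i, nearCell_mem hN i⟩
  have hext : ∀ (u : W) (i) (hi : i ∈ cells N), ext u i = u ⟨i, hi⟩ := by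
    intro u i hi
    simp only [ext, nearCell_of_mem hi]
  have hneu : ∀ u : W, HomNeumann N (ext u) := by
    intro u i hi d
    have hi' := mem_cells.1 hi
    refine ⟨fun hd => ?_, fun hd => ?_⟩
    · have : nearCell N (i - eu d) = nearCell N i := by
        funext e
        have := hi' e
        by_cases he : e = d
        · subst he; simp [nearCell, eu]; omega
        · simp [nearCell, eu, he]
      simp only [ext, this]
    · have : nearCell N (i + eu d) = nearCell N i := by
        funext e
        have := hi' e
        by_cases he : e = d
        · subst he; simp [nearCell, eu]; omega
        · simp [nearCell, eu, he]
      simp only [ext, this]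
  have hdivsum : ∀ g : FaceFun, NoFlux N g → ∑ i ∈ cells N, divh h g i = 0 := by
    intro g hg
    simp only [divh]
    rw [Finset.sum_comm]
    refine Finset.sum_eq_zero fun d _ => ?_
    rw [← Finset.sum_div, sum_cells_sub (g d) d (fun i hi => (hg i hi d).1)
      (fun i hi => (hg i hi d).2), zero_div]
  have hflux : ∀ u : W, NoFlux N (gradh h (ext u)) := by
    intro u i hi d
    refine ⟨fun hd => ?_, fun hd => ?_⟩
    · have := (hneu u i hi d).1 hd
      simp [gradh, this]
    · have := (hneu u i hi d).2 hd
      simp [gradh, this]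
  let A : W →ₗ[ℝ] W :=
    { toFun := fun u i => divh h (gradh h (ext u)) i.1 + ∑ j, u j
      map_add' := by
        intro u v
        funext i
        change divh h (gradh h (ext (u + v))) i.1 + ∑ j, (u j + v j)
          = (divh h (gradh h (ext u)) i.1 + ∑ j, u j) + (divh h (gradh h (ext v)) i.1 + ∑ j, v j)
        have he : ∀ k, ext (u + v) k = ext u k + ext v k := fun _ => rfl
        simp only [divh, gradh, he, Fin.sum_univ_three, Finset.sum_add_distrib]
        ring
      map_smul' := by
        intro c u
        funext i
        change divh h (gradh h (ext (c • u))) i.1 + ∑ j, c * u j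
          = c * (divh h (gradh h (ext u)) i.1 + ∑ j, u j)
        have he : ∀ k, ext (c • u) k = c * ext u k := fun _ => rfl
        simp only [divh, gradh, he, Fin.sum_univ_three, ← Finset.mul_sum]
        ring }
  have hsum : ∀ u : W, ∑ i, A u i = Fintype.card {i // i ∈ cells N} * ∑ j, u j := by
    intro u
    have h1 : ∑ i : {i // i ∈ cells N}, divh h (gradh h (ext u)) i.1 = 0 := by
      rw [← hdivsum _ (hflux u)]
      exact Finset.sum_coe_sort (cells N) (fun i => divh h (gradh h (ext u)) i)
    change ∑ i : {i // i ∈ cells N}, (divh h (gradh h (ext u)) i.1 + ∑ j, u j) = _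
    rw [Finset.sum_add_distrib, h1]
    simp
  have hone : (fun _ => 1 : Fin 3 → ℤ) ∈ cells N := by
    rw [mem_cells]
    intro d
    have := hN d
    omega
  have hcard : (Fintype.card {i // i ∈ cells N} : ℝ) ≠ 0 := by
    have : Nonempty {i // i ∈ cells N} := ⟨⟨_, hone⟩⟩
    exact_mod_cast Fintype.card_ne_zero
  have hinj : Function.Injective A := by
    rw [← LinearMap.ker_eq_bot, LinearMap.ker_eq_bot']
    intro u hu
    have hs0 : ∑ j, u j = 0 := by
      have := hsum u
      have hz : ∑ i, (0 : W) i = 0 := Finset.sum_eq_zero fun _ _ => rfl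
      rw [hu, hz] at this
      exact (mul_eq_zero.1 this.symm).resolve_left hcard
    have hdiv : ∀ i ∈ cells N, divh h (gradh h (ext u)) i = 0 := by
      intro i hi
      have h2 : divh h (gradh h (ext u)) i + ∑ j, u j = 0 := congrFun hu ⟨i, hi⟩
      rw [hs0, add_zero] at h2
      exact h2
    have hen : ∑ d, ∑ i ∈ cells N, (gradh h (ext u) d i) ^ 2 = 0 := by
      have key : ∀ d, ∑ i ∈ cells N, (gradh h (ext u) d i) ^ 2
          = - ∑ i ∈ cells N, ext u i *
              ((gradh h (ext u) d i - gradh h (ext u) d (i - eu d)) / h) := by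
        intro d
        have ht := sum_cells_sub (N := N)
          (fun i => ext u (i + eu d) * gradh h (ext u) d i / h) d
          (fun i hi hd => by simp [((hflux u) i hi d).1 hd])
          (fun i hi hd => by simp [((hflux u) i hi d).2 hd])
        rw [eq_neg_iff_add_eq_zero, ← Finset.sum_add_distrib, ← ht]
        refine Finset.sum_congr rfl fun i _ => ?_
        simp only [gradh, sub_add_cancel]
        field_simp
        ring
      rw [Finset.sum_congr rfl fun d _ => key d, Finset.sum_neg_distrib, Finset.sum_comm,
        neg_eq_zero]
      refine Finset.sum_eq_zero fun i hi => ?_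
      rw [← Finset.mul_sum]
      have := hdiv i hi
      simp only [divh] at this
      rw [this, mul_zero]
    have hg : ∀ i ∈ cells N, ∀ d, ext u (i + eu d) = ext u i := by
      intro i hi d
      have h3 := (Finset.sum_eq_zero_iff_of_nonneg
        (fun d _ => Finset.sum_nonneg fun i _ => sq_nonneg _)).1 hen d (Finset.mem_univ d)
      have h4 := (Finset.sum_eq_zero_iff_of_nonneg (fun i _ => sq_nonneg _)).1 h3 i hi
      have h5 := pow_eq_zero_iff (two_ne_zero) |>.1 h4
      simp only [gradh, div_eq_zero_iff, hh.ne', or_false] at h5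
      linarith
    have hconst : ∀ n : ℕ, ∀ i ∈ cells N, (∑ d, i d) = n + 3 → ext u i = ext u fun _ => 1 := by
      intro n
      induction n with
      | zero =>
        intro i hi hn
        have hi' := mem_cells.1 hi
        congr 1
        funext d
        have h0 := hi' 0
        have h1 := hi' 1
        have h2 := hi' 2
        simp only [Fin.sum_univ_three] at hn
        fin_cases d <;> simp <;> omega
      | succ n ih =>
        intro i hi hn
        have hi' := mem_cells.1 hi
        obtain ⟨d, hd⟩ : ∃ d, 1 < i d := by
          by_contra hcon
          push Not at hcon
          have h0 := hcon 0
          have h1 := hcon 1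
          have h2 := hcon 2
          simp only [Fin.sum_univ_three] at hn
          omega
        have hmem : i - eu d ∈ cells N := by
          rw [mem_cells]
          intro e
          have := hi' e
          by_cases he : e = d
          · subst he; simp [eu]; omega
          · simp [eu, he]; omega
        rw [← ih (i - eu d) hmem, ← hg _ hmem d, sub_add_cancel]
        have : ∑ e, eu d e = 1 := by simp [eu]
        simp only [Pi.sub_apply, Finset.sum_sub_distrib, this]
        omega
    have hall : ∀ j : {i // i ∈ cells N}, u j = u ⟨_, hone⟩ := by
      intro j
      have hj := mem_cells.1 j.2
      have h0 := hj 0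
      have h1 := hj 1
      have h2 := hj 2
      have := hconst (∑ d, j.1 d - 3).toNat j.1 j.2 (by
        simp only [Fin.sum_univ_three]
        omega)
      rw [hext u _ j.2, hext u _ hone] at this
      exact this
    have hz : u ⟨_, hone⟩ = 0 := by
      rw [Finset.sum_congr rfl fun j _ => hall j] at hs0
      simp only [Finset.sum_const, nsmul_eq_mul, Finset.card_univ] at hs0
      exact (mul_eq_zero.1 hs0).resolve_left hcard
    funext j
    rw [hall j, hz]
    rfl
  obtain ⟨u, hu⟩ := (LinearMap.injective_iff_surjective.1 hinj) fun i => -divh h f i.1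
  have hs0 : ∑ j, u j = 0 := by
    have h1 := hsum u
    rw [hu, Finset.sum_neg_distrib,
      Finset.sum_coe_sort (cells N) (fun i => divh h f i), hdivsum f hf, neg_zero] at h1
    exact (mul_eq_zero.1 h1.symm).resolve_left hcard
  refine ⟨ext u, hneu u, fun i hi => ?_⟩
  have h2 : divh h (gradh h (ext u)) i + ∑ j, u j = -divh h f i := congrFun hu ⟨i, hi⟩
  rw [hs0, add_zero] at h2
  simp only [laph, nearCell_of_mem hi]
  exact h2

open Classical in
/-- A solution of the discrete Poisson problem above; it exists for `n · f = 0`, and then it is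
unique up to an additive constant. -/
def helmholtzPotential (N : Fin 3 → ℕ) (h : ℝ) (f : FaceFun) : CellFun :=
  if H : ∃ q, IsHelmholtzPotential N h f q then H.choose else 0

/-- The discrete Helmholtz projection `P_h f = f + ∇_h q` onto the discretely divergence-free
fields, where `Δ_h q = -∇_h · f` and `n · ∇_h q = 0`. -/
def helmholtzProj (N : Fin 3 → ℕ) (h : ℝ) (f : FaceFun) : FaceFun :=
  f + gradh h (helmholtzPotential N h f)

/-! ## The scheme -/

/-- `χ(φ, ψ) = (φ² + ψ²)(φ + ψ) / 4`. -/
def chi (φ ψ : CellFun) : CellFun := fun i => 1 / 4 * (φ i ^ 2 + ψ i ^ 2) * (φ i + ψ i)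

/-- `φ_*^{m+1/2} = (3/2) φ^m - (1/2) φ^{m-1}` (for `m ≥ 1`). -/
def extrap (φ : ℕ → CellFun) (m : ℕ) : CellFun := fun i => 3 / 2 * φ m i - 1 / 2 * φ (m - 1) i

/-- The discrete chemical potential at `t_{m+1/2}`,
`χ(φ^{m+1}, φ^m) - φ_*^{m+1/2} - ε² Δ_h((3/4) φ^{m+1} + (1/4) φ^{m-1})` (for `m ≥ 1`). -/
def discPot (N : Fin 3 → ℕ) (h ε : ℝ) (φ : ℕ → CellFun) (m : ℕ) : CellFun := fun i =>
  chi (φ (m + 1)) (φ m) i - extrap φ m i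
    - ε ^ 2 * laph N h (fun j => 3 / 4 * φ (m + 1) j + 1 / 4 * φ (m - 1) j) i

/-- The discrete velocity `u^{m+1/2} = -∇_h p^{m+1/2} - γ A_h φ_*^{m+1/2} ∇_h μ^{m+1/2}`. -/
def discVel (h γ : ℝ) (φ μ p : ℕ → CellFun) (m : ℕ) : FaceFun := fun d i =>
  -gradh h (p m) d i - γ * avgh (extrap φ m) d i * gradh h (μ m) d i

/-- `φ^0, …, φ^M` together with `μ^{m+1/2} = μ m` and `p^{m+1/2} = p m`, `1 ≤ m ≤ M - 1`, solve the
fully discrete scheme. -/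
structure IsSchemeSolution (N : Fin 3 → ℕ) (h s ε γ : ℝ) (M : ℕ)
    (φ μ p : ℕ → CellFun) : Prop where
  neumann_phi : ∀ m ≤ M, HomNeumann N (φ m)
  neumann_mu : ∀ m, 1 ≤ m → m + 1 ≤ M → HomNeumann N (μ m)
  neumann_p : ∀ m, 1 ≤ m → m + 1 ≤ M → HomNeumann N (p m)
  evolution : ∀ m, 1 ≤ m → m + 1 ≤ M → ∀ i ∈ cells N,
    (φ (m + 1) i - φ m i) / s
      = laph N h (μ m) i
        - divh h (fun d j => avgh (extrap φ m) d j * discVel h γ φ μ p m d j) i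
  potential : ∀ m, 1 ≤ m → m + 1 ≤ M → ∀ i ∈ cells N, μ m i = discPot N h ε φ m i
  divFree : ∀ m, 1 ≤ m → m + 1 ≤ M → ∀ i ∈ cells N, divh h (discVel h γ φ μ p m) i = 0

/-! ## The exact solution on the grid, truncation error, growth factors -/

/-- The grid projection `P_h v` of a function on the box: point values at the cell centres, with
ghost values fixed by the homogeneous Neumann condition. -/
def gridProj (N : Fin 3 → ℕ) (h : ℝ) (v : (Fin 3 → ℝ) → ℝ) : CellFun :=
  fun i => v (fun d => ((nearCell N i d : ℝ) - 1 / 2) * h)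

/-- The constructed velocity `U^{m+1/2} = -P_h(γ A_h Φ_*^{m+1/2} ∇_h Γ^{m+1/2})`, where
`Γ^{m+1/2} = discPot N h ε Φ m`. -/
def consVel (N : Fin 3 → ℕ) (h ε γ : ℝ) (Φ : ℕ → CellFun) (m : ℕ) : FaceFun :=
  -helmholtzProj N h
    (fun d i => γ * avgh (extrap Φ m) d i * gradh h (discPot N h ε Φ m) d i)

/-- The local truncation error `τ^{m+1/2}`, defined by
`(Φ^{m+1} - Φ^m)/s = Δ_h Γ^{m+1/2} - ∇_h·(A_h Φ_*^{m+1/2} U^{m+1/2}) + τ^{m+1/2}`. -/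
def truncErr (N : Fin 3 → ℕ) (h s ε γ : ℝ) (Φ : ℕ → CellFun) (m : ℕ) : CellFun := fun i =>
  (Φ (m + 1) i - Φ m i) / s
    - (laph N h (discPot N h ε Φ m) i
      - divh h (fun d j => avgh (extrap Φ m) d j * consVel N h ε γ Φ m d j) i)

/-- `D₁^{m+1}`, with `a = M₀^{m+1}`, `b = M₀^m`, `c = M₀^{m-1}`. -/
def growthOne (a b c : ℝ) : ℝ :=
  (b ^ (16 / 3 : ℝ) + c ^ (16 / 3 : ℝ)) * (a ^ (8 / 3 : ℝ) + b ^ (8 / 3 : ℝ) + 1) + 1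

/-- `D₂^{m+1}`, with `a = M₀^{m+1}`, `b = M₀^m`, `c = M₀^{m-1}`. -/
def growthTwo (a b c : ℝ) : ℝ := (b ^ 4 + c ^ 4 + 1) * (a ^ 4 + b ^ 4 + 1)

/-- `D₃^{m+1}`, with `a = M₀^{m+1}`, `b = M₀^m`. -/
def growthThree (a b : ℝ) : ℝ := a + b + 1

end

/-!
The error stability law is an energy estimate. Write `e^k = Φ^k - φ^k` and
`ê = (3/4) e^{m+1} + (1/4) e^{m-1}`. Subtracting the scheme from the definition of the truncation
error gives `(e^{m+1} - e^m) / s = Δ_h Z - ∇_h·J + τ`, where `Z = R - ε² Δ_h ê` is the error of the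
chemical potential, `R` its nonlinear part, and `J` the error of the convective flux. Testing with
`Δ_h ê` (`energy_le`) produces the differences on the left-hand side and the dissipation
`2 ε² |∇_h Δ_h ê|²`, most of which is kept (`energy_le_of_splitting`); `faceInner_average_ge` turns
it into dissipation at the level `m + 1`.

The flux error is `A_h e_* U + A_h φ_* w` with `w` the error of the velocity.

* The term with `w` has the highest order, but a good sign. Up to a gradient, `w` equals
  `-γ (A_h e_* ∇_h Γ + A_h φ_* ∇_h Z)`, and `w`, being discretely divergence free, is orthogonal to
  gradients. So pairing with `w` shows that the part of the term containing `∇_h Δ_h ê` is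
  `-2 |w|² / (γ ε²)`, and this absorbs what is left (`velocity_error_le`).
* In the term with `U`, the velocity is bounded in `L²` only, since a Helmholtz projection has no
  pointwise bound of its own. It is paired with the maximum of the error, which an anisotropic
  discrete Sobolev inequality bounds by a small multiple of `|∇_h Δ_h e|` plus lower-order norms
  (`HomNeumann.exists_sq_le`).

The nonlinear part `R` involves fourth powers of the maxima of `φ^{m+1}` and `φ^m` times the squared
gradients of the errors, and only second powers times the squared `L²` norms of the errors
(`faceInner_gradh_potErr_le`). The latter reduce to gradients by a discrete Poincaré inequality
(`HomNeumann.poincare`), at the price of the mean of the error. The scheme conserves mass and so does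
the exact solution, whence this mean is a quadrature error of the midpoint rule and of order `h²`
(`IsExactSolution.integral_eq`, `NeumannBound.abs_quadrature_le`). The resulting terms, `h⁴` times
powers of the maxima, are reduced to `growthTwo` times gradients plus a constant times `h⁴` by the
pointwise bound `h⁴ |e|² ≤ C (|∇_h e|² + h⁴)` (`HomNeumann.exists_le_of_mean`, `growth_le`).

What is needed of the exact solution is that its grid values, their gradients, and the gradients of
their discrete Laplacians are bounded uniformly in time and in the mesh
(`IsExactSolution.exists_gridBound`). The `L^∞(0,T;C⁶)` bounds hold at almost every time and extend
to all times by continuity; Taylor expansion with the Neumann condition carries them over to the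
grid. For the conservation of mass, the integral over the box is differentiated in time: this is
justified because `φ(·,x)` has an integrable weak second derivative, and therefore is Lipschitz
uniformly in `x` (`IsWeakSecondDeriv.abs_sub_le`).
-/

noncomputable section

/-! ### The mesh -/

theorem mesh_mul_eq {L : Fin 3 → ℝ} {N : Fin 3 → ℕ} {h : ℝ} (hN : ∀ d, 0 < N d)
    (hh : ∀ d, h = L d / N d) (d : Fin 3) : (N d : ℝ) * h = L d := by
  have : (N d : ℝ) ≠ 0 := by exact_mod_cast (hN d).ne'
  rw [hh d]; field_simp

theorem mesh_pos {L : Fin 3 → ℝ} (hL : ∀ d, 0 < L d) {N : Fin 3 → ℕ} {h : ℝ}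
    (hN : ∀ d, 0 < N d) (hh : ∀ d, h = L d / N d) : 0 < h := by
  have : (0 : ℝ) < N 0 := by exact_mod_cast hN 0
  rw [hh 0]; exact div_pos (hL 0) this

theorem mesh_le {L : Fin 3 → ℝ} (hL : ∀ d, 0 < L d) {N : Fin 3 → ℕ} {h : ℝ}
    (hN : ∀ d, 0 < N d) (hh : ∀ d, h = L d / N d) (d : Fin 3) : h ≤ L d := by
  have h1 : (1 : ℝ) ≤ N d := by exact_mod_cast hN d
  have h2 := mesh_pos hL hN hh
  rw [← mesh_mul_eq hN hh d]
  nlinarith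

theorem card_cells_mul_pow {L : Fin 3 → ℝ} {N : Fin 3 → ℕ} {h : ℝ}
    (hNd : ∀ d, (N d : ℝ) * h = L d) : ((cells N).card : ℝ) * h ^ 3 = L 0 * L 1 * L 2 := by
  rw [cells, Fintype.card_piFinset, Fin.prod_univ_three]
  simp only [Int.card_Icc, add_sub_cancel_right, Int.toNat_natCast, Nat.cast_mul, ← hNd]
  ring

/-! ### Summation by parts on the staggered grid -/

theorem add_eu_apply (i : Fin 3 → ℤ) (d e : Fin 3) :
    (i + eu d) e = i e + if e = d then 1 else 0 := by
  simp [eu, Pi.single_apply]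

theorem sub_eu_apply (i : Fin 3 → ℤ) (d e : Fin 3) :
    (i - eu d) e = i e - if e = d then 1 else 0 := by
  simp [eu, Pi.single_apply]

theorem add_eu_mem_cells {N : Fin 3 → ℕ} {i : Fin 3 → ℤ} (hi : i ∈ cells N) {d : Fin 3}
    (hd : i d ≠ N d) : i + eu d ∈ cells N := by
  rw [mem_cells] at hi ⊢
  intro e
  have h1 := hi e
  rw [add_eu_apply]
  split_ifs with h
  · subst h; omega
  · omega

theorem sub_eu_mem_cells {N : Fin 3 → ℕ} {i : Fin 3 → ℤ} (hi : i ∈ cells N) {d : Fin 3}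
    (hd : i d ≠ 1) : i - eu d ∈ cells N := by
  rw [mem_cells] at hi ⊢
  intro e
  have h1 := hi e
  rw [sub_eu_apply]
  split_ifs with h
  · subst h; omega
  · omega

theorem NoFlux.sum_mul_left {N : Fin 3 → ℕ} {f : FaceFun} (hf : NoFlux N f) (g : FaceFun)
    (d : Fin 3) :
    ∑ i ∈ cells N, f d (i - eu d) * g d (i - eu d) = ∑ i ∈ cells N, f d i * g d i := by
  have h := sum_cells_sub (N := N) (fun i => f d i * g d i) d
    (fun i hi hd => by simp [(hf i hi d).1 hd]) (fun i hi hd => by simp [(hf i hi d).2 hd])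
  rw [Finset.sum_sub_distrib] at h
  linarith

/-- Against a field without boundary flux, the face inner product counts every face once. -/
theorem NoFlux.faceInner_eq {N : Fin 3 → ℕ} {h : ℝ} {f : FaceFun} (hf : NoFlux N f)
    (g : FaceFun) : faceInner N h f g = h ^ 3 * ∑ d, ∑ i ∈ cells N, f d i * g d i := by
  unfold faceInner
  rw [Finset.mul_sum]
  refine Finset.sum_congr rfl fun d _ => ?_
  rw [Finset.sum_add_distrib, hf.sum_mul_left]
  ring

theorem faceInner_comm (N : Fin 3 → ℕ) (h : ℝ) (f g : FaceFun) :
    faceInner N h f g = faceInner N h g f := by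
  simp only [faceInner, mul_comm]

theorem faceInner_add_left (N : Fin 3 → ℕ) (h : ℝ) (f f' g : FaceFun) :
    faceInner N h (f + f') g = faceInner N h f g + faceInner N h f' g := by
  simp only [faceInner, ← Finset.sum_add_distrib, ← mul_add, Pi.add_apply]
  refine Finset.sum_congr rfl fun d _ => ?_
  congr 1
  refine Finset.sum_congr rfl fun i _ => ?_
  ring

theorem faceInner_smul_left (N : Fin 3 → ℕ) (h c : ℝ) (f g : FaceFun) :
    faceInner N h (c • f) g = c * faceInner N h f g := by
  simp only [faceInner, Finset.mul_sum, Pi.smul_apply, smul_eq_mul]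
  refine Finset.sum_congr rfl fun d _ => Finset.sum_congr rfl fun i _ => ?_
  ring

theorem faceInner_add_right (N : Fin 3 → ℕ) (h : ℝ) (f g g' : FaceFun) :
    faceInner N h f (g + g') = faceInner N h f g + faceInner N h f g' := by
  rw [faceInner_comm, faceInner_add_left, faceInner_comm N h g, faceInner_comm N h g']

theorem faceInner_smul_right (N : Fin 3 → ℕ) (h c : ℝ) (f g : FaceFun) :
    faceInner N h f (c • g) = c * faceInner N h f g := by
  rw [faceInner_comm, faceInner_smul_left, faceInner_comm]

theorem faceInner_sub_left (N : Fin 3 → ℕ) (h : ℝ) (f f' g : FaceFun) :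
    faceInner N h (f - f') g = faceInner N h f g - faceInner N h f' g := by
  rw [sub_eq_add_neg, faceInner_add_left, ← neg_one_smul ℝ f', faceInner_smul_left]; ring

theorem faceInner_sub_right (N : Fin 3 → ℕ) (h : ℝ) (f g g' : FaceFun) :
    faceInner N h f (g - g') = faceInner N h f g - faceInner N h f g' := by
  rw [faceInner_comm, faceInner_sub_left, faceInner_comm N h g, faceInner_comm N h g']

theorem faceInner_self_nonneg (N : Fin 3 → ℕ) {h : ℝ} (hh : 0 < h) (f : FaceFun) :
    0 ≤ faceInner N h f f := by
  unfold faceInner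
  refine Finset.sum_nonneg fun d _ => mul_nonneg (by positivity) ?_
  refine Finset.sum_nonneg fun i _ => ?_
  nlinarith [mul_self_nonneg (f d i), mul_self_nonneg (f d (i - eu d))]

theorem faceNorm_sq (N : Fin 3 → ℕ) {h : ℝ} (hh : 0 < h) (f : FaceFun) :
    faceNorm N h f ^ 2 = faceInner N h f f :=
  Real.sq_sqrt (faceInner_self_nonneg N hh f)

theorem cellInner_self_eq (N : Fin 3 → ℕ) (h : ℝ) (f : CellFun) :
    cellInner N h f f = h ^ 3 * ∑ i ∈ cells N, f i ^ 2 := by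
  simp only [cellInner, sq]

theorem cellInner_self_nonneg (N : Fin 3 → ℕ) {h : ℝ} (hh : 0 < h) (f : CellFun) :
    0 ≤ cellInner N h f f :=
  mul_nonneg (by positivity) (Finset.sum_nonneg fun i _ => mul_self_nonneg _)

theorem cellNorm_sq (N : Fin 3 → ℕ) {h : ℝ} (hh : 0 < h) (f : CellFun) :
    cellNorm N h f ^ 2 = cellInner N h f f :=
  Real.sq_sqrt (cellInner_self_nonneg N hh f)

/-- Young's inequality for the face inner product. -/
theorem two_faceInner_le (N : Fin 3 → ℕ) {h : ℝ} (hh : 0 < h) {δ : ℝ} (hδ : 0 < δ)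
    (f g : FaceFun) :
    2 * faceInner N h f g ≤ δ * faceInner N h g g + δ⁻¹ * faceInner N h f f := by
  have h0 := faceInner_self_nonneg N hh (f - δ • g)
  rw [faceInner_sub_left, faceInner_comm N h f, faceInner_sub_left, faceInner_smul_left,
    faceInner_comm N h (δ • g) (f - δ • g), faceInner_sub_left, faceInner_smul_left,
    faceInner_smul_right, faceInner_smul_right, faceInner_comm N h g f] at h0
  have h1 := mul_nonneg (inv_nonneg.2 hδ.le) h0
  have h2 : ∀ x y z : ℝ, δ⁻¹ * (x - δ * y - (δ * y - δ * (δ * z)))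
      = δ * z + δ⁻¹ * x - 2 * y := by
    intro x y z
    field_simp
    ring
  rw [h2] at h1
  linarith

/-- Young's inequality for the cell inner product. -/
theorem two_cellInner_le (N : Fin 3 → ℕ) {h : ℝ} (hh : 0 < h) {δ : ℝ} (hδ : 0 < δ)
    (f g : CellFun) :
    2 * cellInner N h f g ≤ δ * cellInner N h g g + δ⁻¹ * cellInner N h f f := by
  unfold cellInner
  have h2 : δ⁻¹ * δ = 1 := inv_mul_cancel₀ hδ.ne'
  have key : 2 * ∑ i ∈ cells N, f i * g i
      ≤ δ * ∑ i ∈ cells N, g i * g i + δ⁻¹ * ∑ i ∈ cells N, f i * f i := by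
    rw [Finset.mul_sum, Finset.mul_sum, Finset.mul_sum, ← Finset.sum_add_distrib]
    refine Finset.sum_le_sum fun i _ => ?_
    have := mul_nonneg (inv_nonneg.2 hδ.le) (mul_self_nonneg (f i - δ * g i))
    nlinarith [this, h2]
  nlinarith [mul_le_mul_of_nonneg_left key (pow_pos hh 3).le]

theorem faceInner_add_self_le (N : Fin 3 → ℕ) {h : ℝ} (hh : 0 < h) (f g : FaceFun) :
    faceInner N h (f + g) (f + g) ≤ 2 * faceInner N h f f + 2 * faceInner N h g g := by
  rw [faceInner_add_left, faceInner_add_right, faceInner_add_right, faceInner_comm N h g f]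
  have := two_faceInner_le N hh one_pos f g
  rw [inv_one] at this
  linarith

theorem faceInner_sub_self_le (N : Fin 3 → ℕ) {h : ℝ} (hh : 0 < h) (f g : FaceFun) :
    faceInner N h (f - g) (f - g) ≤ 2 * faceInner N h f f + 2 * faceInner N h g g := by
  have := faceInner_add_self_le N hh f ((-1 : ℝ) • g)
  rw [faceInner_smul_left, faceInner_smul_right] at this
  rw [sub_eq_add_neg, ← neg_one_smul ℝ g]
  linarith

/-- Only interior faces matter for a field without boundary flux. -/
theorem NoFlux.faceInner_self_le {N : Fin 3 → ℕ} {h : ℝ} (hh : 0 < h) {f : FaceFun}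
    (hf : NoFlux N f) {g : FaceFun} (hg : ∀ d, ∀ i ∈ cells N, 0 ≤ g d i)
    (hfg : ∀ d, ∀ i ∈ cells N, i + eu d ∈ cells N → f d i ^ 2 ≤ g d i) :
    faceInner N h f f ≤ h ^ 3 * ∑ d, ∑ i ∈ cells N, g d i := by
  rw [hf.faceInner_eq]
  refine mul_le_mul_of_nonneg_left ?_ (by positivity)
  refine Finset.sum_le_sum fun d _ => Finset.sum_le_sum fun i hi => ?_
  by_cases hd : i d = N d
  · rw [(hf i hi d).2 hd, zero_mul]; exact hg d i hi
  · rw [← sq]; exact hfg d i hi (add_eu_mem_cells hi hd)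

theorem HomNeumann.noFlux_gradh {N : Fin 3 → ℕ} (h : ℝ) {ψ : CellFun} (hψ : HomNeumann N ψ) :
    NoFlux N (gradh h ψ) := by
  intro i hi d
  refine ⟨fun hd => ?_, fun hd => ?_⟩
  · simp [gradh, (hψ i hi d).1 hd]
  · simp [gradh, (hψ i hi d).2 hd]

theorem NoFlux.mul_left {N : Fin 3 → ℕ} {f : FaceFun} (hf : NoFlux N f) (a : FaceFun) :
    NoFlux N (fun d i => a d i * f d i) := by
  intro i hi d
  exact ⟨fun hd => by simp [(hf i hi d).1 hd], fun hd => by simp [(hf i hi d).2 hd]⟩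

theorem NoFlux.add {N : Fin 3 → ℕ} {f g : FaceFun} (hf : NoFlux N f) (hg : NoFlux N g) :
    NoFlux N (f + g) := by
  intro i hi d
  exact ⟨fun hd => by simp [(hf i hi d).1 hd, (hg i hi d).1 hd],
    fun hd => by simp [(hf i hi d).2 hd, (hg i hi d).2 hd]⟩

theorem NoFlux.smul {N : Fin 3 → ℕ} {f : FaceFun} (hf : NoFlux N f) (c : ℝ) :
    NoFlux N (c • f) := hf.mul_left fun _ _ => c

theorem NoFlux.neg {N : Fin 3 → ℕ} {f : FaceFun} (hf : NoFlux N f) : NoFlux N (-f) := by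
  rw [← neg_one_smul ℝ f]; exact hf.smul _

theorem NoFlux.sub {N : Fin 3 → ℕ} {f g : FaceFun} (hf : NoFlux N f) (hg : NoFlux N g) :
    NoFlux N (f - g) := by
  rw [sub_eq_add_neg]; exact hf.add hg.neg

theorem HomNeumann.add {N : Fin 3 → ℕ} {f g : CellFun} (hf : HomNeumann N f)
    (hg : HomNeumann N g) : HomNeumann N (f + g) := by
  intro i hi d
  exact ⟨fun hd => by simp [(hf i hi d).1 hd, (hg i hi d).1 hd],
    fun hd => by simp [(hf i hi d).2 hd, (hg i hi d).2 hd]⟩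

theorem HomNeumann.smul {N : Fin 3 → ℕ} {f : CellFun} (hf : HomNeumann N f) (c : ℝ) :
    HomNeumann N (c • f) := by
  intro i hi d
  exact ⟨fun hd => by simp [(hf i hi d).1 hd], fun hd => by simp [(hf i hi d).2 hd]⟩

theorem HomNeumann.sub {N : Fin 3 → ℕ} {f g : CellFun} (hf : HomNeumann N f)
    (hg : HomNeumann N g) : HomNeumann N (f - g) := by
  intro i hi d
  exact ⟨fun hd => by simp [(hf i hi d).1 hd, (hg i hi d).1 hd],
    fun hd => by simp [(hf i hi d).2 hd, (hg i hi d).2 hd]⟩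

theorem HomNeumann.chi {N : Fin 3 → ℕ} {f g : CellFun} (hf : HomNeumann N f)
    (hg : HomNeumann N g) : HomNeumann N (chi f g) := by
  intro i hi d
  exact ⟨fun hd => by simp [_root_.chi, (hf i hi d).1 hd, (hg i hi d).1 hd],
    fun hd => by simp [_root_.chi, (hf i hi d).2 hd, (hg i hi d).2 hd]⟩

theorem HomNeumann.extrap {N : Fin 3 → ℕ} {φ : ℕ → CellFun} {m : ℕ} (h1 : HomNeumann N (φ m))
    (h0 : HomNeumann N (φ (m - 1))) : HomNeumann N (extrap φ m) := by
  intro i hi d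
  exact ⟨fun hd => by simp [_root_.extrap, (h1 i hi d).1 hd, (h0 i hi d).1 hd],
    fun hd => by simp [_root_.extrap, (h1 i hi d).2 hd, (h0 i hi d).2 hd]⟩

/-- The extension of a grid function by the value at the nearest interior cell. -/
theorem homNeumann_comp_nearCell (N : Fin 3 → ℕ) (ψ : CellFun) :
    HomNeumann N (fun i => ψ (nearCell N i)) := by
  intro i hi d
  have hi' := mem_cells.1 hi
  refine ⟨fun hd => congrArg ψ (funext fun e => ?_), fun hd => congrArg ψ (funext fun e => ?_)⟩
  · have := hi' e
    simp only [nearCell, sub_eu_apply]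
    split_ifs with he
    · subst he; omega
    · omega
  · have := hi' e
    simp only [nearCell, add_eu_apply]
    split_ifs with he
    · subst he; omega
    · omega

theorem homNeumann_laph (N : Fin 3 → ℕ) (h : ℝ) (ψ : CellFun) : HomNeumann N (laph N h ψ) :=
  homNeumann_comp_nearCell N (divh h (gradh h ψ))

theorem homNeumann_gridProj (N : Fin 3 → ℕ) (h : ℝ) (v : (Fin 3 → ℝ) → ℝ) :
    HomNeumann N (gridProj N h v) :=
  homNeumann_comp_nearCell N (fun i => v fun d => ((i d : ℝ) - 1 / 2) * h)

theorem laph_of_mem {N : Fin 3 → ℕ} {i : Fin 3 → ℤ} (hi : i ∈ cells N) (h : ℝ) (ψ : CellFun) :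
    laph N h ψ i = divh h (gradh h ψ) i := by
  simp only [laph, nearCell_of_mem hi]

theorem laph_add (N : Fin 3 → ℕ) (h : ℝ) (f g : CellFun) :
    laph N h (f + g) = laph N h f + laph N h g := by
  funext i
  simp only [laph, divh, gradh, Pi.add_apply, ← Finset.sum_add_distrib]
  exact Finset.sum_congr rfl fun d _ => by ring

theorem laph_smul (N : Fin 3 → ℕ) (h c : ℝ) (f : CellFun) :
    laph N h (c • f) = c • laph N h f := by
  funext i
  simp only [laph, divh, gradh, Pi.smul_apply, smul_eq_mul, Finset.mul_sum]
  exact Finset.sum_congr rfl fun d _ => by ring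

theorem gradh_add (h : ℝ) (f g : CellFun) : gradh h (f + g) = gradh h f + gradh h g := by
  funext d i
  simp only [gradh, Pi.add_apply]; ring

theorem gradh_smul (h c : ℝ) (f : CellFun) : gradh h (c • f) = c • gradh h f := by
  funext d i
  simp only [gradh, Pi.smul_apply, smul_eq_mul]; ring

theorem gradh_sub (h : ℝ) (f g : CellFun) : gradh h (f - g) = gradh h f - gradh h g := by
  funext d i
  simp only [gradh, Pi.sub_apply]; ring

/-- Summation by parts. -/
theorem NoFlux.faceInner_gradh {N : Fin 3 → ℕ} {h : ℝ} (hh : 0 < h) {f : FaceFun}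
    (hf : NoFlux N f) (ψ : CellFun) :
    faceInner N h f (gradh h ψ) = -cellInner N h (divh h f) ψ := by
  rw [hf.faceInner_eq, cellInner, ← mul_neg]
  congr 1
  simp only [divh, Finset.sum_mul]
  rw [Finset.sum_comm (s := cells N), ← Finset.sum_neg_distrib]
  refine Finset.sum_congr rfl fun d _ => ?_
  have ht := sum_cells_sub (N := N) (fun i => ψ (i + eu d) * f d i / h) d
    (fun i hi hd => by simp [(hf i hi d).1 hd]) (fun i hi hd => by simp [(hf i hi d).2 hd])
  rw [eq_neg_iff_add_eq_zero, ← Finset.sum_add_distrib, ← ht]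
  refine Finset.sum_congr rfl fun i _ => ?_
  simp only [gradh, sub_add_cancel]
  field_simp
  ring

theorem cellInner_congr {N : Fin 3 → ℕ} {h : ℝ} {f f' g g' : CellFun}
    (hf : ∀ i ∈ cells N, f i = f' i) (hg : ∀ i ∈ cells N, g i = g' i) :
    cellInner N h f g = cellInner N h f' g' := by
  unfold cellInner
  congr 1
  exact Finset.sum_congr rfl fun i hi => by rw [hf i hi, hg i hi]

theorem cellInner_comm (N : Fin 3 → ℕ) (h : ℝ) (f g : CellFun) :
    cellInner N h f g = cellInner N h g f := by
  simp only [cellInner, mul_comm]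

theorem HomNeumann.cellInner_laph {N : Fin 3 → ℕ} {h : ℝ} (hh : 0 < h) {ψ : CellFun}
    (hψ : HomNeumann N ψ) (η : CellFun) :
    cellInner N h (laph N h ψ) η = -faceInner N h (gradh h ψ) (gradh h η) := by
  rw [(hψ.noFlux_gradh h).faceInner_gradh hh, neg_neg]
  exact cellInner_congr (fun i hi => laph_of_mem hi h ψ) fun _ _ => rfl

theorem NoFlux.sum_divh {N : Fin 3 → ℕ} {h : ℝ} {f : FaceFun} (hf : NoFlux N f) :
    ∑ i ∈ cells N, divh h f i = 0 := by
  simp only [divh]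
  rw [Finset.sum_comm]
  refine Finset.sum_eq_zero fun d _ => ?_
  rw [← Finset.sum_div, sum_cells_sub (f d) d (fun i hi => (hf i hi d).1)
    (fun i hi => (hf i hi d).2), zero_div]

theorem divh_sub (h : ℝ) (f g : FaceFun) : divh h (f - g) = divh h f - divh h g := by
  funext i
  simp only [divh, Pi.sub_apply, ← Finset.sum_sub_distrib]
  exact Finset.sum_congr rfl fun d _ => by ring

theorem divh_add (h : ℝ) (f g : FaceFun) : divh h (f + g) = divh h f + divh h g := by
  funext i
  simp only [divh, Pi.add_apply, ← Finset.sum_add_distrib]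
  exact Finset.sum_congr rfl fun d _ => by ring

theorem divh_neg (h : ℝ) (f : FaceFun) : divh h (-f) = -divh h f := by
  funext i
  simp only [divh, Pi.neg_apply, ← Finset.sum_neg_distrib]
  exact Finset.sum_congr rfl fun d _ => by ring

/-- The gradient of a Neumann function on the faces of the cells depends only on the values on the
cells. -/
theorem HomNeumann.gradh_congr {N : Fin 3 → ℕ} (h : ℝ) {f g : CellFun} (hf : HomNeumann N f)
    (hg : HomNeumann N g) (hfg : ∀ i ∈ cells N, f i = g i) :
    ∀ i ∈ cells N, ∀ d, gradh h f d i = gradh h g d i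
      ∧ gradh h f d (i - eu d) = gradh h g d (i - eu d) := by
  intro i hi d
  constructor
  · by_cases hd : i d = N d
    · rw [(hf.noFlux_gradh h i hi d).2 hd, (hg.noFlux_gradh h i hi d).2 hd]
    · simp only [gradh, hfg i hi, hfg _ (add_eu_mem_cells hi hd)]
  · by_cases hd : i d = 1
    · rw [(hf.noFlux_gradh h i hi d).1 hd, (hg.noFlux_gradh h i hi d).1 hd]
    · simp only [gradh, sub_add_cancel, hfg i hi, hfg _ (sub_eu_mem_cells hi hd)]

theorem faceInner_congr {N : Fin 3 → ℕ} {h : ℝ} {f f' g g' : FaceFun}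
    (hf : ∀ i ∈ cells N, ∀ d, f d i = f' d i ∧ f d (i - eu d) = f' d (i - eu d))
    (hg : ∀ i ∈ cells N, ∀ d, g d i = g' d i ∧ g d (i - eu d) = g' d (i - eu d)) :
    faceInner N h f g = faceInner N h f' g' := by
  unfold faceInner
  refine Finset.sum_congr rfl fun d _ => ?_
  congr 1
  refine Finset.sum_congr rfl fun i hi => ?_
  rw [(hf i hi d).1, (hf i hi d).2, (hg i hi d).1, (hg i hi d).2]

/-! ### The discrete Helmholtz projection -/

/-- `P_h f = f + ∇_h q` with `q` a Neumann function, and `P_h f` is divergence free. -/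
theorem helmholtzProj_spec {N : Fin 3 → ℕ} (hN : ∀ d, 0 < N d) {h : ℝ} (hh : 0 < h)
    {f : FaceFun} (hf : NoFlux N f) :
    HomNeumann N (helmholtzPotential N h f) ∧
      (∀ i ∈ cells N, divh h (helmholtzProj N h f) i = 0) ∧ NoFlux N (helmholtzProj N h f) := by
  have H := exists_helmholtzPotential hN hh f hf
  have hq : IsHelmholtzPotential N h f (helmholtzPotential N h f) := by
    rw [helmholtzPotential, dif_pos H]
    exact H.choose_spec
  refine ⟨hq.1, fun i hi => ?_, hf.add (hq.1.noFlux_gradh h)⟩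
  have := hq.2 i hi
  rw [laph_of_mem hi] at this
  rw [helmholtzProj, divh_add, Pi.add_apply, this]
  ring

/-- A discretely divergence-free field without boundary flux is orthogonal to gradients. -/
theorem NoFlux.faceInner_gradh_eq_zero {N : Fin 3 → ℕ} {h : ℝ} (hh : 0 < h) {f : FaceFun}
    (hf : NoFlux N f) (hdiv : ∀ i ∈ cells N, divh h f i = 0) (ψ : CellFun) :
    faceInner N h f (gradh h ψ) = 0 := by
  rw [hf.faceInner_gradh hh, cellInner, Finset.sum_eq_zero fun i hi => by rw [hdiv i hi, zero_mul]]
  simp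

/-- The discrete Helmholtz projection is a contraction. -/
theorem faceInner_helmholtzProj_le {N : Fin 3 → ℕ} (hN : ∀ d, 0 < N d) {h : ℝ} (hh : 0 < h)
    {f : FaceFun} (hf : NoFlux N f) :
    faceInner N h (helmholtzProj N h f) (helmholtzProj N h f) ≤ faceInner N h f f := by
  obtain ⟨-, hd, hn⟩ := helmholtzProj_spec hN hh hf
  have h1 : faceInner N h (helmholtzProj N h f) (helmholtzProj N h f)
      = faceInner N h (helmholtzProj N h f) f := by
    conv_lhs => arg 4; rw [helmholtzProj]
    rw [faceInner_add_right, hn.faceInner_gradh_eq_zero hh hd, add_zero]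
  have h2 := two_faceInner_le N hh one_pos (helmholtzProj N h f) f
  rw [inv_one] at h2
  linarith

/-! ### One-dimensional difference operators on the grid -/

/-- The next cell in direction `d`; the last cell is its own successor. -/
def upCell (N : Fin 3 → ℕ) (d : Fin 3) (i : Fin 3 → ℤ) : Fin 3 → ℤ :=
  Function.update i d (min (i d + 1) (N d))

/-- The previous cell in direction `d`; the first cell is its own predecessor. -/
def downCell (d : Fin 3) (i : Fin 3 → ℤ) : Fin 3 → ℤ := Function.update i d (max (i d - 1) 1)

/-- The forward difference in direction `d`, with the Neumann condition built in: it reads values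
on the cells only, and vanishes on the last layer. -/
def dirDiff (N : Fin 3 → ℕ) (h : ℝ) (d : Fin 3) (ψ : CellFun) : CellFun :=
  fun i => (ψ (upCell N d i) - ψ i) / h

/-- The second difference in direction `d`, with the Neumann condition built in. -/
def dirLap (N : Fin 3 → ℕ) (h : ℝ) (d : Fin 3) (ψ : CellFun) : CellFun :=
  fun i => (ψ (upCell N d i) - 2 * ψ i + ψ (downCell d i)) / h ^ 2

/-- `h` times the sum over the grid line through `i` in direction `d`. -/
def lineSum (N : Fin 3 → ℕ) (h : ℝ) (d : Fin 3) (g : CellFun) : CellFun :=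
  fun i => h * ∑ k ∈ Finset.Icc 1 (N d : ℤ), g (Function.update i d k)

theorem update_mem_cells {N : Fin 3 → ℕ} {i : Fin 3 → ℤ} (hi : i ∈ cells N) {d : Fin 3} {k : ℤ}
    (hk : k ∈ Finset.Icc 1 (N d : ℤ)) : Function.update i d k ∈ cells N := by
  rw [mem_cells] at hi ⊢
  rw [Finset.mem_Icc] at hk
  intro e
  by_cases he : e = d
  · subst he; simpa using hk
  · rw [Function.update_of_ne he]; exact hi e

theorem upCell_mem {N : Fin 3 → ℕ} {i : Fin 3 → ℤ} (hi : i ∈ cells N) (d : Fin 3) :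
    upCell N d i ∈ cells N := by
  refine update_mem_cells hi (Finset.mem_Icc.2 ?_)
  have := mem_cells.1 hi d
  omega

theorem add_eu_eq_update (i : Fin 3 → ℤ) (d : Fin 3) :
    i + eu d = Function.update i d (i d + 1) := by
  funext e
  rw [add_eu_apply]
  by_cases he : e = d
  · subst he; simp
  · simp [he]

theorem sub_eu_eq_update (i : Fin 3 → ℤ) (d : Fin 3) :
    i - eu d = Function.update i d (i d - 1) := by
  funext e
  rw [sub_eu_apply]
  by_cases he : e = d
  · subst he; simp
  · simp [he]

theorem upCell_eq {N : Fin 3 → ℕ} {i : Fin 3 → ℤ} (hi : i ∈ cells N) {d : Fin 3}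
    (hd : i d ≠ N d) : upCell N d i = i + eu d := by
  rw [add_eu_eq_update, upCell]
  congr 1
  have := mem_cells.1 hi d
  omega

theorem upCell_last {N : Fin 3 → ℕ} {i : Fin 3 → ℤ} {d : Fin 3} (hd : i d = N d) :
    upCell N d i = i := by
  rw [upCell, hd, min_eq_right (by omega), ← hd, Function.update_eq_self]

theorem downCell_eq {N : Fin 3 → ℕ} {i : Fin 3 → ℤ} (hi : i ∈ cells N) {d : Fin 3}
    (hd : i d ≠ 1) : downCell d i = i - eu d := by
  rw [sub_eu_eq_update, downCell]
  congr 1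
  have := mem_cells.1 hi d
  omega

theorem downCell_first {i : Fin 3 → ℤ} {d : Fin 3} (hd : i d = 1) : downCell d i = i := by
  rw [downCell, hd, max_eq_right (by omega), ← hd, Function.update_eq_self]

theorem upCell_update {N : Fin 3 → ℕ} {d e : Fin 3} (hde : d ≠ e) (i : Fin 3 → ℤ) (k : ℤ) :
    upCell N d (Function.update i e k) = Function.update (upCell N d i) e k := by
  rw [upCell, upCell, Function.update_of_ne hde, Function.update_comm hde]

theorem upCell_comm {N : Fin 3 → ℕ} {d e : Fin 3} (hde : d ≠ e) (i : Fin 3 → ℤ) :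
    upCell N d (upCell N e i) = upCell N e (upCell N d i) := by
  conv_lhs => rw [upCell.eq_def N e i, upCell_update hde]
  conv_rhs => rw [upCell.eq_def N e]
  rw [upCell, Function.update_of_ne hde.symm]

theorem upCell_downCell_comm {N : Fin 3 → ℕ} {d e : Fin 3} (hde : d ≠ e) (i : Fin 3 → ℤ) :
    upCell N d (downCell e i) = downCell e (upCell N d i) := by
  conv_lhs => rw [downCell, upCell_update hde]
  conv_rhs => rw [downCell]
  rw [upCell, Function.update_of_ne hde.symm]

theorem dirDiff_dirLap_comm {N : Fin 3 → ℕ} (h : ℝ) {d e : Fin 3} (hde : d ≠ e) (ψ : CellFun) :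
    dirDiff N h d (dirLap N h e ψ) = dirLap N h e (dirDiff N h d ψ) := by
  funext i
  simp only [dirDiff, dirLap, upCell_comm hde, upCell_downCell_comm hde]
  ring

/-- Summation by parts in one direction. -/
theorem cellInner_dirDiff (N : Fin 3 → ℕ) {h : ℝ} (hh : 0 < h) (d : Fin 3) (ψ η : CellFun) :
    cellInner N h (dirDiff N h d ψ) (dirDiff N h d η) = -cellInner N h (dirLap N h d ψ) η := by
  have ht := sum_cells_sub (N := N)
    (fun i => if i d ≤ 0 then 0 else (ψ (upCell N d i) - ψ i) * η (upCell N d i)) d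
    (fun i hi hd => by
      have : (i - eu d) d ≤ 0 := by rw [sub_eu_apply]; simp; omega
      simp only [this, if_true])
    (fun i hi hd => by simp [upCell_last hd])
  have hs : ∑ i ∈ cells N, ((ψ (upCell N d i) - ψ i) * η (upCell N d i)
      - (ψ i - ψ (downCell d i)) * η i) = 0 := by
    rw [← ht]
    refine Finset.sum_congr rfl fun i hi => ?_
    have h1 := mem_cells.1 hi d
    have h2 : ¬ i d ≤ 0 := by omega
    simp only [h2, if_false]
    by_cases hd : i d = 1
    · have : (i - eu d) d ≤ 0 := by rw [sub_eu_apply]; simp; omega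
      simp only [this, if_true, downCell_first hd]
      ring
    · have h3 : ¬ (i - eu d) d ≤ 0 := by rw [sub_eu_apply]; simp; omega
      have hm := sub_eu_mem_cells hi hd
      have h4 : upCell N d (i - eu d) = i := by
        rw [upCell_eq hm (by rw [sub_eu_apply]; simp; omega), sub_add_cancel]
      simp only [h3, if_false, h4, downCell_eq hi hd]
  unfold cellInner
  rw [← mul_neg, ← Finset.sum_neg_distrib]
  congr 1
  rw [← sub_eq_zero, ← Finset.sum_sub_distrib]
  have : ∑ i ∈ cells N, ((ψ (upCell N d i) - ψ i) * η (upCell N d i)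
      - (ψ i - ψ (downCell d i)) * η i) / h ^ 2 = 0 := by
    rw [← Finset.sum_div, hs, zero_div]
  rw [← this]
  refine Finset.sum_congr rfl fun i _ => ?_
  simp only [dirDiff, dirLap]
  field_simp
  ring

theorem cellInner_dirLap_comm (N : Fin 3 → ℕ) {h : ℝ} (hh : 0 < h) (d : Fin 3) (ψ η : CellFun) :
    cellInner N h (dirLap N h d ψ) η = cellInner N h ψ (dirLap N h d η) := by
  have h1 := cellInner_dirDiff N hh d ψ η
  have h2 := cellInner_dirDiff N hh d η ψ
  rw [cellInner_comm N h (dirDiff N h d η), cellInner_comm N h (dirLap N h d η)] at h2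
  linarith

theorem HomNeumann.gradh_eq_dirDiff {N : Fin 3 → ℕ} (h : ℝ) {ψ : CellFun} (hψ : HomNeumann N ψ)
    {i : Fin 3 → ℤ} (hi : i ∈ cells N) (d : Fin 3) : gradh h ψ d i = dirDiff N h d ψ i := by
  by_cases hd : i d = N d
  · simp [gradh, dirDiff, upCell_last hd, (hψ i hi d).2 hd]
  · simp [gradh, dirDiff, upCell_eq hi hd]

theorem HomNeumann.laph_eq_sum_dirLap {N : Fin 3 → ℕ} {h : ℝ} {ψ : CellFun}
    (hψ : HomNeumann N ψ) {i : Fin 3 → ℤ} (hi : i ∈ cells N) :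
    laph N h ψ i = ∑ d, dirLap N h d ψ i := by
  rw [laph_of_mem hi, divh]
  refine Finset.sum_congr rfl fun d _ => ?_
  have h1 : ψ (upCell N d i) = ψ (i + eu d) := by
    by_cases hd : i d = N d
    · rw [upCell_last hd, (hψ i hi d).2 hd]
    · rw [upCell_eq hi hd]
  have h2 : ψ (downCell d i) = ψ (i - eu d) := by
    by_cases hd : i d = 1
    · rw [downCell_first hd, (hψ i hi d).1 hd]
    · rw [downCell_eq hi hd]
  simp only [gradh, dirLap, h1, h2, sub_add_cancel]
  by_cases hh : h = 0
  · simp [hh]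
  · field_simp
    ring

theorem HomNeumann.faceInner_gradh_self {N : Fin 3 → ℕ} (h : ℝ) {ψ : CellFun}
    (hψ : HomNeumann N ψ) :
    faceInner N h (gradh h ψ) (gradh h ψ)
      = ∑ d, cellInner N h (dirDiff N h d ψ) (dirDiff N h d ψ) := by
  rw [(hψ.noFlux_gradh h).faceInner_eq, Finset.mul_sum]
  refine Finset.sum_congr rfl fun d _ => ?_
  rw [cellInner]
  congr 1
  exact Finset.sum_congr rfl fun i hi => by rw [hψ.gradh_eq_dirDiff h hi d]

theorem cellInner_add_three_self (N : Fin 3 → ℕ) (h : ℝ) (a b c : CellFun) :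
    cellInner N h (a + b + c) (a + b + c)
      = cellInner N h a a + cellInner N h b b + cellInner N h c c
        + 2 * cellInner N h a b + 2 * cellInner N h a c + 2 * cellInner N h b c := by
  simp only [cellInner, Finset.mul_sum, ← Finset.sum_add_distrib, Pi.add_apply]
  exact Finset.sum_congr rfl fun i _ => by ring

/-- `(L_d ψ, L_e ψ) = ‖D_d D_e ψ‖²` for `d ≠ e`. -/
theorem cellInner_dirLap_dirLap (N : Fin 3 → ℕ) {h : ℝ} (hh : 0 < h) {d e : Fin 3} (hde : d ≠ e)
    (ψ : CellFun) :
    cellInner N h (dirLap N h d ψ) (dirLap N h e ψ)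
      = cellInner N h (dirDiff N h d (dirDiff N h e ψ)) (dirDiff N h d (dirDiff N h e ψ)) := by
  rw [cellInner_dirDiff N hh d, ← dirDiff_dirLap_comm h hde.symm, cellInner_dirDiff N hh e, neg_neg,
    cellInner_dirLap_comm N hh e]

/-- `(D_d L_d ψ, D_d L_e ψ) = ‖L_d D_e ψ‖²` for `d ≠ e`. -/
theorem cellInner_dirDiff_dirLap_same (N : Fin 3 → ℕ) {h : ℝ} (hh : 0 < h) {d e : Fin 3}
    (hde : d ≠ e) (ψ : CellFun) :
    cellInner N h (dirDiff N h d (dirLap N h d ψ)) (dirDiff N h d (dirLap N h e ψ))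
      = cellInner N h (dirLap N h d (dirDiff N h e ψ)) (dirLap N h d (dirDiff N h e ψ)) := by
  rw [cellInner_dirDiff N hh d, ← cellInner_dirLap_comm N hh e, ← cellInner_dirDiff N hh e,
    dirDiff_dirLap_comm h hde.symm, dirDiff_dirLap_comm h hde.symm, cellInner_dirLap_comm N hh d]

/-- The mixed second differences are bounded by the Laplacian. -/
theorem HomNeumann.mixed_le_laph {N : Fin 3 → ℕ} {h : ℝ} (hh : 0 < h) {ψ : CellFun}
    (hψ : HomNeumann N ψ) :
    cellInner N h (dirDiff N h 1 (dirDiff N h 0 ψ)) (dirDiff N h 1 (dirDiff N h 0 ψ))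
      + cellInner N h (dirDiff N h 2 (dirDiff N h 0 ψ)) (dirDiff N h 2 (dirDiff N h 0 ψ))
      + cellInner N h (dirDiff N h 2 (dirDiff N h 1 ψ)) (dirDiff N h 2 (dirDiff N h 1 ψ))
      ≤ cellInner N h (laph N h ψ) (laph N h ψ) := by
  have e1 : cellInner N h (laph N h ψ) (laph N h ψ)
      = cellInner N h (dirLap N h 0 ψ + dirLap N h 1 ψ + dirLap N h 2 ψ)
        (dirLap N h 0 ψ + dirLap N h 1 ψ + dirLap N h 2 ψ) :=
    cellInner_congr (fun i hi => by rw [hψ.laph_eq_sum_dirLap hi, Fin.sum_univ_three]; rfl)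
      (fun i hi => by rw [hψ.laph_eq_sum_dirLap hi, Fin.sum_univ_three]; rfl)
  rw [e1, cellInner_add_three_self, cellInner_comm N h (dirLap N h 0 ψ) (dirLap N h 1 ψ),
    cellInner_comm N h (dirLap N h 0 ψ) (dirLap N h 2 ψ),
    cellInner_comm N h (dirLap N h 1 ψ) (dirLap N h 2 ψ),
    cellInner_dirLap_dirLap N hh (by decide : (1 : Fin 3) ≠ 0),
    cellInner_dirLap_dirLap N hh (by decide : (2 : Fin 3) ≠ 0),
    cellInner_dirLap_dirLap N hh (by decide : (2 : Fin 3) ≠ 1)]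
  have p := fun f : CellFun => cellInner_self_nonneg N hh f
  linarith [p (dirLap N h 0 ψ), p (dirLap N h 1 ψ), p (dirLap N h 2 ψ),
    p (dirDiff N h 1 (dirDiff N h 0 ψ)), p (dirDiff N h 2 (dirDiff N h 0 ψ)),
    p (dirDiff N h 2 (dirDiff N h 1 ψ))]

/-- The mixed third difference is bounded by the gradient of the Laplacian. -/
theorem HomNeumann.mixed_le_gradh_laph {N : Fin 3 → ℕ} {h : ℝ} (hh : 0 < h) {ψ : CellFun}
    (hψ : HomNeumann N ψ) :
    cellInner N h (dirDiff N h 2 (dirDiff N h 1 (dirDiff N h 0 ψ)))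
        (dirDiff N h 2 (dirDiff N h 1 (dirDiff N h 0 ψ)))
      ≤ faceInner N h (gradh h (laph N h ψ)) (gradh h (laph N h ψ)) := by
  have p := fun f : CellFun => cellInner_self_nonneg N hh f
  rw [(homNeumann_laph N h ψ).faceInner_gradh_self h, Fin.sum_univ_three]
  have e1 : cellInner N h (dirDiff N h 0 (laph N h ψ)) (dirDiff N h 0 (laph N h ψ))
      = cellInner N h (dirDiff N h 0 (dirLap N h 0 ψ) + dirDiff N h 0 (dirLap N h 1 ψ)
          + dirDiff N h 0 (dirLap N h 2 ψ))
        (dirDiff N h 0 (dirLap N h 0 ψ) + dirDiff N h 0 (dirLap N h 1 ψ)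
          + dirDiff N h 0 (dirLap N h 2 ψ)) := by
    have key : ∀ i ∈ cells N, dirDiff N h 0 (laph N h ψ) i
        = (dirDiff N h 0 (dirLap N h 0 ψ) + dirDiff N h 0 (dirLap N h 1 ψ)
          + dirDiff N h 0 (dirLap N h 2 ψ)) i := by
      intro i hi
      simp only [dirDiff, Pi.add_apply, hψ.laph_eq_sum_dirLap hi,
        hψ.laph_eq_sum_dirLap (upCell_mem hi 0), Fin.sum_univ_three]
      ring
    exact cellInner_congr key key
  rw [cellInner_add_three_self, cellInner_dirDiff_dirLap_same N hh (by decide : (0 : Fin 3) ≠ 1),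
    cellInner_dirDiff_dirLap_same N hh (by decide : (0 : Fin 3) ≠ 2),
    dirDiff_dirLap_comm h (by decide : (0 : Fin 3) ≠ 1),
    dirDiff_dirLap_comm h (by decide : (0 : Fin 3) ≠ 2),
    cellInner_comm N h (dirLap N h 1 (dirDiff N h 0 ψ)) (dirLap N h 2 (dirDiff N h 0 ψ)),
    cellInner_dirLap_dirLap N hh (by decide : (2 : Fin 3) ≠ 1)] at e1
  linarith [p (dirDiff N h 0 (dirLap N h 0 ψ)), p (dirLap N h 1 (dirDiff N h 0 ψ)),
    p (dirLap N h 2 (dirDiff N h 0 ψ)), p (dirLap N h 0 (dirDiff N h 1 ψ)),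
    p (dirLap N h 0 (dirDiff N h 2 ψ)), p (dirDiff N h 1 (laph N h ψ)),
    p (dirDiff N h 2 (laph N h ψ)), p (dirDiff N h 2 (dirDiff N h 1 (dirDiff N h 0 ψ)))]

/-- Interpolation of the Laplacian between the gradient and the gradient of the Laplacian. -/
theorem HomNeumann.laph_interpolation {N : Fin 3 → ℕ} {h : ℝ} (hh : 0 < h) {ψ : CellFun}
    (hψ : HomNeumann N ψ) {δ : ℝ} (hδ : 0 < δ) :
    2 * cellInner N h (laph N h ψ) (laph N h ψ)
      ≤ δ * faceInner N h (gradh h (laph N h ψ)) (gradh h (laph N h ψ))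
        + δ⁻¹ * faceInner N h (gradh h ψ) (gradh h ψ) := by
  rw [hψ.cellInner_laph hh]
  have := two_faceInner_le N hh hδ ((-1 : ℝ) • gradh h ψ) (gradh h (laph N h ψ))
  simp only [faceInner_smul_left, faceInner_smul_right] at this
  linarith

/-! ### Discrete Sobolev and Poincaré inequalities -/

/-- Telescoping along `1, …, n`. -/
theorem abs_sub_le_sum_Icc (v : ℤ → ℝ) (n : ℕ) {k l : ℤ} (hk : k ∈ Finset.Icc 1 (n : ℤ))
    (hl : l ∈ Finset.Icc 1 (n : ℤ)) :
    |v k - v l| ≤ ∑ j ∈ Finset.Icc 1 (n : ℤ), |v (min (j + 1) n) - v j| := by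
  wlog hkl : l ≤ k generalizing k l
  · rw [abs_sub_comm]; exact this hl hk (by omega)
  rw [Finset.mem_Icc] at hk hl
  have h1 : ∀ k, l ≤ k → |v k - v l| ≤ ∑ j ∈ Finset.Ico l k, |v (j + 1) - v j| := by
    intro k hk
    induction k, hk using Int.leInduction with
    | base => simp
    | succ k hk ih =>
      have : Finset.Ico l (k + 1) = insert k (Finset.Ico l k) := by
        ext x; simp only [Finset.mem_Ico, Finset.mem_insert]; omega
      rw [this, Finset.sum_insert (by simp)]
      calc |v (k + 1) - v l| = |(v (k + 1) - v k) + (v k - v l)| := by ring_nf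
        _ ≤ _ := (abs_add_le _ _).trans (by linarith)
  refine (h1 k hkl).trans ?_
  calc ∑ j ∈ Finset.Ico l k, |v (j + 1) - v j|
      = ∑ j ∈ Finset.Ico l k, |v (min (j + 1) n) - v j| := by
        refine Finset.sum_congr rfl fun j hj => ?_
        rw [Finset.mem_Ico] at hj
        rw [min_eq_left (by omega)]
    _ ≤ _ := by
        refine Finset.sum_le_sum_of_subset_of_nonneg (fun j hj => ?_) fun _ _ _ => abs_nonneg _
        rw [Finset.mem_Ico] at hj
        rw [Finset.mem_Icc]; omega

theorem sum_Icc_succ_le (w : ℤ → ℝ) (hw : ∀ j, 0 ≤ w j) (n : ℕ) :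
    ∑ j ∈ Finset.Icc 1 (n : ℤ), w (min (j + 1) n) ≤ 2 * ∑ j ∈ Finset.Icc 1 (n : ℤ), w j := by
  rcases Nat.eq_zero_or_pos n with rfl | hn
  · simp
  have e : Finset.Icc 1 (n : ℤ) = insert (n : ℤ) (Finset.Ico 1 (n : ℤ)) := by
    ext x; simp only [Finset.mem_Icc, Finset.mem_insert, Finset.mem_Ico]; omega
  have h1 : ∑ j ∈ Finset.Ico 1 (n : ℤ), w (min (j + 1) n)
      ≤ ∑ j ∈ Finset.Icc 1 (n : ℤ), w j := by
    calc ∑ j ∈ Finset.Ico 1 (n : ℤ), w (min (j + 1) n)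
        = ∑ j ∈ (Finset.Ico 1 (n : ℤ)).image (· + 1), w j := by
          rw [Finset.sum_image (by intro a _ b _ hab; simpa using hab)]
          refine Finset.sum_congr rfl fun j hj => ?_
          rw [Finset.mem_Ico] at hj
          rw [min_eq_left (by omega)]
      _ ≤ _ := by
          refine Finset.sum_le_sum_of_subset_of_nonneg (fun j hj => ?_) fun _ _ _ => hw _
          rw [Finset.mem_image] at hj
          obtain ⟨x, hx, rfl⟩ := hj
          rw [Finset.mem_Ico] at hx
          rw [Finset.mem_Icc]; omega
  have h2 : w n ≤ ∑ j ∈ Finset.Icc 1 (n : ℤ), w j :=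
    Finset.single_le_sum (fun j _ => hw j) (by rw [Finset.mem_Icc]; omega)
  conv_lhs => rw [e]
  rw [Finset.sum_insert (by simp), min_eq_right (by omega)]
  linarith

theorem upCell_update_self (N : Fin 3 → ℕ) (d : Fin 3) (i : Fin 3 → ℤ) (j : ℤ) :
    upCell N d (Function.update i d j) = Function.update i d (min (j + 1) (N d)) := by
  simp [upCell]

/-- The one-dimensional Sobolev inequality on a grid line, with a free parameter. -/
theorem sq_le_lineSum {N : Fin 3 → ℕ} {h : ℝ} (hh : 0 < h) {i : Fin 3 → ℤ} (hi : i ∈ cells N)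
    {d : Fin 3} (f : CellFun) {η : ℝ} (hη : 0 < η) {K : ℝ} (hK : 1 / (N d * h) + 2 / η ≤ K) :
    f i ^ 2 ≤ K * lineSum N h d (fun j => f j ^ 2) i
      + η * lineSum N h d (fun j => dirDiff N h d f j ^ 2) i := by
  have hid := mem_cells.1 hi d
  set n := N d with hn
  have hn0 : (0 : ℝ) < n := by
    have : 0 < n := by omega
    exact_mod_cast this
  set u : ℤ → ℝ := fun j => f (Function.update i d j) with hu
  have hui : u (i d) = f i := by simp [hu]
  set A := ∑ j ∈ Finset.Icc 1 (n : ℤ), u j ^ 2 with hA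
  set D : ℤ → ℝ := fun j => (u (min (j + 1) n) - u j) / h with hD
  set B := ∑ j ∈ Finset.Icc 1 (n : ℤ), D j ^ 2 with hB
  have hA0 : 0 ≤ A := Finset.sum_nonneg fun _ _ => sq_nonneg _
  have key : ∀ l ∈ Finset.Icc 1 (n : ℤ), u (i d) ^ 2 - u l ^ 2 ≤ h * (η * B + 3 / (2 * η) * A) := by
    intro l hl
    refine (le_abs_self _).trans ((abs_sub_le_sum_Icc (fun j => u j ^ 2) n
      (Finset.mem_Icc.2 hid) hl).trans ?_)
    have h1 : ∀ j, |u (min (j + 1) n) ^ 2 - u j ^ 2|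
        ≤ h * (η * D j ^ 2 + 1 / (2 * η) * (u (min (j + 1) n) ^ 2 + u j ^ 2)) := by
      intro j
      have e1 : u (min (j + 1) n) = u j + h * D j := by
        simp only [hD]; field_simp; ring
      set x := u (min (j + 1) n) with hx
      have e2 : x ^ 2 - u j ^ 2 = h * (D j * (x + u j)) := by rw [e1]; ring
      rw [e2, abs_mul, abs_of_pos hh]
      refine mul_le_mul_of_nonneg_left ?_ hh.le
      have h3 : |D j * (x + u j)| ≤ η * D j ^ 2 + 1 / (4 * η) * (x + u j) ^ 2 := by
        have q1 := mul_nonneg (inv_nonneg.2 hη.le) (sq_nonneg (2 * η * D j - (x + u j)))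
        have q2 := mul_nonneg (inv_nonneg.2 hη.le) (sq_nonneg (2 * η * D j + (x + u j)))
        have r1 : η⁻¹ * (2 * η * D j - (x + u j)) ^ 2
            = 4 * (η * D j ^ 2 + 1 / (4 * η) * (x + u j) ^ 2 - D j * (x + u j)) := by
          field_simp; ring
        have r2 : η⁻¹ * (2 * η * D j + (x + u j)) ^ 2
            = 4 * (η * D j ^ 2 + 1 / (4 * η) * (x + u j) ^ 2 + D j * (x + u j)) := by
          field_simp; ring
        rw [abs_le]; constructor <;> linarith
      have h4 : 1 / (4 * η) * (x + u j) ^ 2 ≤ 1 / (2 * η) * (x ^ 2 + u j ^ 2) := by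
        have q1 := mul_nonneg (inv_nonneg.2 hη.le) (sq_nonneg (x - u j))
        have r1 : η⁻¹ * (x - u j) ^ 2
            = 4 * (1 / (2 * η) * (x ^ 2 + u j ^ 2) - 1 / (4 * η) * (x + u j) ^ 2) := by
          field_simp; ring
        linarith
      linarith
    refine (Finset.sum_le_sum fun j _ => h1 j).trans ?_
    rw [← Finset.mul_sum, Finset.sum_add_distrib, ← Finset.mul_sum, ← Finset.mul_sum,
      Finset.sum_add_distrib]
    refine mul_le_mul_of_nonneg_left ?_ hh.le
    have h2 := sum_Icc_succ_le (fun j => u j ^ 2) (fun _ => sq_nonneg _) n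
    have h3 : 1 / (2 * η) * (∑ j ∈ Finset.Icc 1 (n : ℤ), u (min (j + 1) n) ^ 2 + A)
        ≤ 1 / (2 * η) * (3 * A) :=
      mul_le_mul_of_nonneg_left (by linarith) (by positivity)
    have h4 : 1 / (2 * η) * (3 * A) = 3 / (2 * η) * A := by ring
    linarith
  have hsum := Finset.sum_le_sum key
  rw [Finset.sum_sub_distrib, Finset.sum_const, Finset.sum_const, Int.card_Icc] at hsum
  have hc : ((n : ℤ) + 1 - 1).toNat = n := by omega
  rw [hc, nsmul_eq_mul, nsmul_eq_mul, hui] at hsum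
  have e1 : lineSum N h d (fun j => f j ^ 2) i = h * A := rfl
  have e2 : lineSum N h d (fun j => dirDiff N h d f j ^ 2) i = h * B := by
    simp only [lineSum, hB, hD, hu, dirDiff, upCell_update_self, ← hn]
  rw [e1, e2]
  have h5 : f i ^ 2 ≤ 1 / n * A + h * (η * B + 3 / (2 * η) * A) := by
    have : (n : ℝ) * f i ^ 2 ≤ n * (1 / n * A + h * (η * B + 3 / (2 * η) * A)) := by
      rw [mul_add, ← mul_assoc, mul_one_div_cancel hn0.ne']
      linarith
    exact le_of_mul_le_mul_left this hn0
  have h6 : (1 / (n * h) + 2 / η) * (h * A) ≤ K * (h * A) :=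
    mul_le_mul_of_nonneg_right hK (by positivity)
  have h7 : (1 / (n * h) + 2 / η) * (h * A) = 1 / n * A + h * (3 / (2 * η) * A)
      + h * A / (2 * η) := by
    field_simp; ring
  have h8 : 0 ≤ h * A / (2 * η) := by positivity
  nlinarith

theorem lineSum_mono {N : Fin 3 → ℕ} {h : ℝ} (hh : 0 < h) {d : Fin 3} {F G : CellFun}
    (hFG : ∀ i ∈ cells N, F i ≤ G i) {i : Fin 3 → ℤ} (hi : i ∈ cells N) :
    lineSum N h d F i ≤ lineSum N h d G i :=
  mul_le_mul_of_nonneg_left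
    (Finset.sum_le_sum fun _ hk => hFG _ (update_mem_cells hi hk)) hh.le

theorem lineSum_comb (N : Fin 3 → ℕ) (h : ℝ) (d : Fin 3) (a b : ℝ) (F G : CellFun)
    (i : Fin 3 → ℤ) :
    lineSum N h d (fun j => a * F j + b * G j) i
      = a * lineSum N h d F i + b * lineSum N h d G i := by
  simp only [lineSum, Finset.sum_add_distrib, ← Finset.mul_sum]
  ring

/-- Summing along the three directions in turn is summing over all the cells. -/
theorem lineSum_lineSum_lineSum (N : Fin 3 → ℕ) (h : ℝ) (g : CellFun) (i : Fin 3 → ℤ) :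
    lineSum N h 0 (lineSum N h 1 (lineSum N h 2 g)) i = h ^ 3 * ∑ j ∈ cells N, g j := by
  simp only [lineSum, ← Finset.mul_sum]
  rw [← mul_assoc, ← mul_assoc, show h * h * h = h ^ 3 by ring]
  congr 1
  simp only [Finset.sum_sigma']
  refine Finset.sum_bij' (fun x _ => ![x.1, x.2.1, x.2.2]) (fun j _ => ⟨j 0, j 1, j 2⟩)
    ?_ ?_ ?_ ?_ ?_
  · rintro ⟨a, b, c⟩ hx
    simp only [Finset.mem_sigma, Finset.mem_Icc] at hx
    rw [mem_cells]
    intro d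
    fin_cases d <;> simp <;> omega
  · intro j hj
    rw [mem_cells] at hj
    simp only [Finset.mem_sigma, Finset.mem_Icc]
    exact ⟨hj 0, hj 1, hj 2⟩
  · rintro ⟨a, b, c⟩ _; rfl
  · intro j _
    funext d
    fin_cases d <;> rfl
  · rintro ⟨a, b, c⟩ _
    congr 1
    funext d
    fin_cases d <;> simp

theorem sum_cells_lineSum (N : Fin 3 → ℕ) (h : ℝ) (d : Fin 3) (g : CellFun) :
    ∑ i ∈ cells N, lineSum N h d g i = N d * h * ∑ i ∈ cells N, g i := by
  simp only [lineSum]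
  rw [← Finset.mul_sum]
  have : ∑ i ∈ cells N, ∑ k ∈ Finset.Icc 1 (N d : ℤ), g (Function.update i d k)
      = ∑ i ∈ cells N, ∑ _k ∈ Finset.Icc 1 (N d : ℤ), g i := by
    rw [← Finset.sum_product', ← Finset.sum_product']
    refine Finset.sum_bij' (fun x _ => (Function.update x.1 d x.2, x.1 d))
      (fun x _ => (Function.update x.1 d x.2, x.1 d)) ?_ ?_ ?_ ?_ ?_
    · rintro ⟨i, k⟩ hx
      rw [Finset.mem_product] at hx ⊢
      exact ⟨update_mem_cells hx.1 hx.2, Finset.mem_Icc.2 (mem_cells.1 hx.1 d)⟩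
    · rintro ⟨i, k⟩ hx
      rw [Finset.mem_product] at hx ⊢
      exact ⟨update_mem_cells hx.1 hx.2, Finset.mem_Icc.2 (mem_cells.1 hx.1 d)⟩
    · rintro ⟨i, k⟩ _; simp
    · rintro ⟨i, k⟩ _; simp
    · rintro ⟨i, k⟩ _; rfl
  rw [this]
  simp only [Finset.sum_const, Int.card_Icc, nsmul_eq_mul, ← Finset.mul_sum]
  have hc : ((N d : ℤ) + 1 - 1).toNat = N d := by omega
  rw [hc]
  ring

/-- The anisotropic Sobolev inequality: the one-dimensional one, iterated over the directions. -/
theorem sq_le_sum_mixed {N : Fin 3 → ℕ} {h : ℝ} (hh : 0 < h) {i : Fin 3 → ℤ} (hi : i ∈ cells N)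
    (f : CellFun) {η : ℝ} (hη : 0 < η) {K : ℝ} (hK : ∀ d, 1 / (N d * h) + 2 / η ≤ K) :
    f i ^ 2 ≤ K ^ 3 * cellInner N h f f
      + K ^ 2 * η * (cellInner N h (dirDiff N h 0 f) (dirDiff N h 0 f)
        + cellInner N h (dirDiff N h 1 f) (dirDiff N h 1 f)
        + cellInner N h (dirDiff N h 2 f) (dirDiff N h 2 f))
      + K * η ^ 2 * (cellInner N h (dirDiff N h 1 (dirDiff N h 0 f)) (dirDiff N h 1 (dirDiff N h 0 f))
        + cellInner N h (dirDiff N h 2 (dirDiff N h 0 f)) (dirDiff N h 2 (dirDiff N h 0 f))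
        + cellInner N h (dirDiff N h 2 (dirDiff N h 1 f)) (dirDiff N h 2 (dirDiff N h 1 f)))
      + η ^ 3 * cellInner N h (dirDiff N h 2 (dirDiff N h 1 (dirDiff N h 0 f)))
          (dirDiff N h 2 (dirDiff N h 1 (dirDiff N h 0 f))) := by
  have hK0 : 0 ≤ K := le_trans (by positivity) (hK 0)
  have b := fun (d : Fin 3) (g : CellFun) j (hj : j ∈ cells N) => sq_le_lineSum hh hj g hη (hK d)
  -- the bound by sums along the directions `1` and `2`
  have b12 : ∀ g : CellFun, ∀ j ∈ cells N, g j ^ 2 ≤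
      K * (K * lineSum N h 1 (lineSum N h 2 fun k => g k ^ 2) j
        + η * lineSum N h 1 (lineSum N h 2 fun k => dirDiff N h 2 g k ^ 2) j)
      + η * (K * lineSum N h 1 (lineSum N h 2 fun k => dirDiff N h 1 g k ^ 2) j
        + η * lineSum N h 1 (lineSum N h 2 fun k => dirDiff N h 2 (dirDiff N h 1 g) k ^ 2) j) := by
    intro g j hj
    refine (b 1 g j hj).trans (add_le_add (mul_le_mul_of_nonneg_left ?_ hK0)
      (mul_le_mul_of_nonneg_left ?_ hη.le))
    · rw [← lineSum_comb]; exact lineSum_mono hh (b 2 g) hj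
    · rw [← lineSum_comb]; exact lineSum_mono hh (b 2 (dirDiff N h 1 g)) hj
  have b012 : ∀ g : CellFun, lineSum N h 0 (fun k => g k ^ 2) i ≤
      K * (K * cellInner N h g g + η * cellInner N h (dirDiff N h 2 g) (dirDiff N h 2 g))
      + η * (K * cellInner N h (dirDiff N h 1 g) (dirDiff N h 1 g)
        + η * cellInner N h (dirDiff N h 2 (dirDiff N h 1 g)) (dirDiff N h 2 (dirDiff N h 1 g))) := by
    intro g
    refine (lineSum_mono hh (b12 g) hi).trans (le_of_eq ?_)
    rw [lineSum_comb, lineSum_comb, lineSum_comb]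
    simp only [lineSum_lineSum_lineSum, cellInner_self_eq]
  have h0 := b 0 f i hi
  have h1 := mul_le_mul_of_nonneg_left (b012 f) hK0
  have h2 := mul_le_mul_of_nonneg_left (b012 (dirDiff N h 0 f)) hη.le
  nlinarith

/-- The maximum is controlled by an arbitrarily small multiple of the top-order norm. In the
anisotropic inequality `η` is small; the mixed second differences are interpolated. -/
theorem HomNeumann.exists_sq_le {L : Fin 3 → ℝ} (hL : ∀ d, 0 < L d) {δ : ℝ} (hδ : 0 < δ) :
    ∃ C : ℝ, 0 ≤ C ∧ ∀ (N : Fin 3 → ℕ) (h : ℝ), (∀ d, 0 < N d) → (∀ d, h = L d / N d) →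
      ∀ ψ : CellFun, HomNeumann N ψ → ∀ i ∈ cells N,
        ψ i ^ 2 ≤ δ * faceInner N h (gradh h (laph N h ψ)) (gradh h (laph N h ψ))
          + C * (faceInner N h (gradh h ψ) (gradh h ψ) + cellInner N h ψ ψ) := by
  set η := min 1 (δ / 2) with hηdef
  have hη : 0 < η := lt_min one_pos (by linarith)
  have hη1 : η ≤ 1 := min_le_left _ _
  have hηδ : η ^ 3 ≤ δ / 2 := by
    have : η ≤ δ / 2 := min_le_right _ _
    calc η ^ 3 ≤ η := by nlinarith [sq_nonneg η, mul_nonneg hη.le (sub_nonneg.2 hη1)]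
      _ ≤ _ := this
  set K := 1 / L 0 + 1 / L 1 + 1 / L 2 + 2 / η with hKdef
  have l0 := one_div_pos.2 (hL 0)
  have l1 := one_div_pos.2 (hL 1)
  have l2 := one_div_pos.2 (hL 2)
  have hK0 : 0 < K := by positivity
  set θ := δ / (K * η ^ 2) with hθ
  have hθ0 : 0 < θ := by positivity
  refine ⟨K ^ 3 + K ^ 2 * η + K * η ^ 2 * θ⁻¹, by positivity, ?_⟩
  intro N h hN hh ψ hψ i hi
  have hNd := mesh_mul_eq hN hh
  have hh0 := mesh_pos hL hN hh
  have hKd : ∀ d, 1 / (N d * h) + 2 / η ≤ K := by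
    intro d
    rw [hNd d]
    fin_cases d <;> simp only [hKdef, Fin.zero_eta, Fin.mk_one, Fin.reduceFinMk] <;> linarith
  have h1 := sq_le_sum_mixed hh0 hi ψ hη hKd
  have h2 := hψ.mixed_le_laph hh0
  have h3 := hψ.mixed_le_gradh_laph hh0
  have h4 := hψ.laph_interpolation hh0 hθ0
  rw [hψ.faceInner_gradh_self h, Fin.sum_univ_three] at h4 ⊢
  set G := faceInner N h (gradh h (laph N h ψ)) (gradh h (laph N h ψ)) with hG
  set E := cellInner N h (dirDiff N h 0 ψ) (dirDiff N h 0 ψ)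
    + cellInner N h (dirDiff N h 1 ψ) (dirDiff N h 1 ψ)
    + cellInner N h (dirDiff N h 2 ψ) (dirDiff N h 2 ψ) with hE
  have p := fun f : CellFun => cellInner_self_nonneg N hh0 f
  have hE0 : 0 ≤ E := by linarith [p (dirDiff N h 0 ψ), p (dirDiff N h 1 ψ), p (dirDiff N h 2 ψ)]
  have hG0 : 0 ≤ G := faceInner_self_nonneg N hh0 _
  have hQ0 := p ψ
  have h5 := mul_le_mul_of_nonneg_left (h2.trans (by linarith :
    cellInner N h (laph N h ψ) (laph N h ψ) ≤ 1 / 2 * (θ * G + θ⁻¹ * E)))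
    (by positivity : 0 ≤ K * η ^ 2)
  have h6 := mul_le_mul_of_nonneg_left h3 (by positivity : 0 ≤ η ^ 3)
  have h7 := mul_le_mul_of_nonneg_right hηδ hG0
  have h8 : K * η ^ 2 * θ = δ := by rw [hθ]; field_simp
  have h9 : K * η ^ 2 * (1 / 2 * (θ * G + θ⁻¹ * E))
      = δ / 2 * G + 1 / 2 * (K * η ^ 2 * θ⁻¹ * E) := by
    rw [← h8]; ring
  have h10 : 0 ≤ K * η ^ 2 * θ⁻¹ * E := by positivity
  have h11 : 0 ≤ K ^ 3 * E := by positivity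
  have h12 : 0 ≤ K ^ 2 * η * cellInner N h ψ ψ := by positivity
  have h13 : 0 ≤ K * η ^ 2 * θ⁻¹ * cellInner N h ψ ψ := by positivity
  clear_value G E η K θ
  linarith

/-- Averaging along the grid lines in direction `d` is a contraction. -/
theorem cellInner_lineSum_self_le (N : Fin 3 → ℕ) {h : ℝ} (hh : 0 < h) (d : Fin 3) (g : CellFun) :
    cellInner N h (lineSum N h d g) (lineSum N h d g) ≤ (N d * h) ^ 2 * cellInner N h g g := by
  rw [cellInner_self_eq, cellInner_self_eq]
  have h1 : ∀ i ∈ cells N, lineSum N h d g i ^ 2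
      ≤ N d * h * lineSum N h d (fun j => g j ^ 2) i := by
    intro i _
    have := sq_sum_le_card_mul_sum_sq (s := Finset.Icc 1 (N d : ℤ))
      (f := fun k => g (Function.update i d k))
    rw [Int.card_Icc, show ((N d : ℤ) + 1 - 1).toNat = N d by omega] at this
    simp only [lineSum, mul_pow]
    nlinarith [mul_le_mul_of_nonneg_left this (sq_nonneg h)]
  have h2 := Finset.sum_le_sum h1
  rw [← Finset.mul_sum, sum_cells_lineSum] at h2
  nlinarith [mul_le_mul_of_nonneg_left h2 (pow_pos hh 3).le]

/-- The one-dimensional Poincaré inequality, on all grid lines in direction `d`. -/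
theorem cellInner_sub_lineSum_le {N : Fin 3 → ℕ} (hN : ∀ d, 0 < N d) {h : ℝ} (hh : 0 < h)
    (d : Fin 3) (g : CellFun) :
    cellInner N h (g - (N d * h)⁻¹ • lineSum N h d g) (g - (N d * h)⁻¹ • lineSum N h d g)
      ≤ (N d * h) ^ 2 * cellInner N h (dirDiff N h d g) (dirDiff N h d g) := by
  rw [cellInner_self_eq, cellInner_self_eq]
  have hn : (0 : ℝ) < N d := by exact_mod_cast hN d
  have hcard : (Finset.Icc 1 (N d : ℤ)).card = N d := by
    rw [Int.card_Icc]; omega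
  have h1 : ∀ i ∈ cells N, (g - (N d * h)⁻¹ • lineSum N h d g) i ^ 2
      ≤ N d * h * lineSum N h d (fun j => dirDiff N h d g j ^ 2) i := by
    intro i hi
    set B := lineSum N h d (fun j => dirDiff N h d g j ^ 2) i with hB
    have hterm : ∀ k ∈ Finset.Icc 1 (N d : ℤ),
        (g i - g (Function.update i d k)) ^ 2 ≤ N d * h * B := by
      intro k hk
      have t := abs_sub_le_sum_Icc (fun j => g (Function.update i d j)) (N d)
        (Finset.mem_Icc.2 (mem_cells.1 hi d)) hk
      simp only [Function.update_eq_self] at t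
      have t2 := pow_le_pow_left₀ (abs_nonneg _) t 2
      rw [sq_abs] at t2
      refine t2.trans (sq_sum_le_card_mul_sum_sq.trans (le_of_eq ?_))
      rw [hcard, hB, lineSum]
      simp only [sq_abs, dirDiff, upCell_update_self, div_pow, ← Finset.sum_div]
      field_simp
    have e1 : (g - (N d * h)⁻¹ • lineSum N h d g) i
        = (N d : ℝ)⁻¹ * ∑ k ∈ Finset.Icc 1 (N d : ℤ), (g i - g (Function.update i d k)) := by
      rw [Finset.sum_sub_distrib, Finset.sum_const, hcard, nsmul_eq_mul]
      simp only [Pi.sub_apply, Pi.smul_apply, smul_eq_mul, lineSum]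
      field_simp
    rw [e1, mul_pow]
    have s1 := (sq_sum_le_card_mul_sum_sq (s := Finset.Icc 1 (N d : ℤ))
      (f := fun k => g i - g (Function.update i d k))).trans
      (mul_le_mul_of_nonneg_left (Finset.sum_le_sum hterm) (Nat.cast_nonneg _))
    rw [Finset.sum_const, hcard, nsmul_eq_mul] at s1
    calc (N d : ℝ)⁻¹ ^ 2 * (∑ k ∈ Finset.Icc 1 (N d : ℤ), (g i - g (Function.update i d k))) ^ 2
        ≤ (N d : ℝ)⁻¹ ^ 2 * (N d * (N d * (N d * h * B))) :=
          mul_le_mul_of_nonneg_left s1 (by positivity)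
      _ = N d * h * B := by field_simp
  have h2 := Finset.sum_le_sum h1
  rw [← Finset.mul_sum, sum_cells_lineSum] at h2
  nlinarith [mul_le_mul_of_nonneg_left h2 (pow_pos hh 3).le]

theorem dirDiff_lineSum {N : Fin 3 → ℕ} (h : ℝ) {d e : Fin 3} (hde : d ≠ e) (g : CellFun) :
    dirDiff N h d (lineSum N h e g) = lineSum N h e (dirDiff N h d g) := by
  funext i
  simp only [dirDiff, lineSum, upCell_update hde, ← Finset.sum_div, Finset.sum_sub_distrib]
  ring

theorem dirDiff_smul (N : Fin 3 → ℕ) (h : ℝ) (d : Fin 3) (c : ℝ) (g : CellFun) :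
    dirDiff N h d (c • g) = c • dirDiff N h d g := by
  funext i
  simp only [dirDiff, Pi.smul_apply, smul_eq_mul]
  ring

theorem cellInner_smul_self (N : Fin 3 → ℕ) (h c : ℝ) (g : CellFun) :
    cellInner N h (c • g) (c • g) = c ^ 2 * cellInner N h g g := by
  simp only [cellInner, Pi.smul_apply, smul_eq_mul, Finset.mul_sum]
  exact Finset.sum_congr rfl fun i _ => by ring

theorem cellInner_add_three_self_le (N : Fin 3 → ℕ) {h : ℝ} (hh : 0 < h) (a b c : CellFun) :
    cellInner N h (a + b + c) (a + b + c)
      ≤ 3 * (cellInner N h a a + cellInner N h b b + cellInner N h c c) := by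
  rw [cellInner_add_three_self]
  have h1 := two_cellInner_le N hh one_pos a b
  have h2 := two_cellInner_le N hh one_pos a c
  have h3 := two_cellInner_le N hh one_pos b c
  rw [inv_one] at h1 h2 h3
  linarith

/-- The discrete Poincaré inequality; `c` is the mean of `ψ`. -/
theorem HomNeumann.poincare {L : Fin 3 → ℝ} (hL : ∀ d, 0 < L d) {N : Fin 3 → ℕ} {h : ℝ}
    (hN : ∀ d, 0 < N d) (hh : ∀ d, h = L d / N d) {ψ : CellFun} (hψ : HomNeumann N ψ) {c : ℝ}
    (hc : L 0 * L 1 * L 2 * c = h ^ 3 * ∑ i ∈ cells N, ψ i) :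
    cellInner N h (fun i => ψ i - c) (fun i => ψ i - c)
      ≤ 3 * (L 0 ^ 2 + L 1 ^ 2 + L 2 ^ 2) * faceInner N h (gradh h ψ) (gradh h ψ) := by
  have hNd := mesh_mul_eq hN hh
  have hh0 := mesh_pos hL hN hh
  -- successive averages along the directions `2`, `1`, `0`
  set P : Fin 3 → CellFun → CellFun := fun d g => (N d * h)⁻¹ • lineSum N h d g with hP
  have hcon : ∀ d g, cellInner N h (P d g) (P d g) ≤ cellInner N h g g := by
    intro d g
    have h1 := cellInner_lineSum_self_le N hh0 d g
    simp only [hP, cellInner_smul_self]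
    rw [hNd d] at h1 ⊢
    have h2 := mul_le_mul_of_nonneg_left h1 (sq_nonneg (L d)⁻¹)
    have h3 : (L d)⁻¹ ^ 2 * (L d ^ 2 * cellInner N h g g) = cellInner N h g g := by
      have := (hL d).ne'
      field_simp
    linarith
  have hsub : ∀ d g, cellInner N h (g - P d g) (g - P d g)
      ≤ L d ^ 2 * cellInner N h (dirDiff N h d g) (dirDiff N h d g) := by
    intro d g
    have := cellInner_sub_lineSum_le hN hh0 d g
    rw [hNd d] at this
    simpa only [hP, hNd d] using this
  have hcomm : ∀ d e g, d ≠ e → dirDiff N h d (P e g) = P e (dirDiff N h d g) := by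
    intro d e g hde
    simp only [hP, dirDiff_smul, dirDiff_lineSum h hde]
  have hconst : ∀ i, P 0 (P 1 (P 2 ψ)) i = c := by
    intro i
    have h1 := lineSum_lineSum_lineSum N h ψ i
    have h2 : P 0 (P 1 (P 2 ψ)) i = (L 0)⁻¹ * ((L 1)⁻¹ * ((L 2)⁻¹ *
        lineSum N h 0 (lineSum N h 1 (lineSum N h 2 ψ)) i)) := by
      simp only [hP, hNd]
      simp only [lineSum, Pi.smul_apply, smul_eq_mul, ← Finset.mul_sum]
      ring
    rw [h2, h1, ← hc]
    have := (hL 0).ne'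
    have := (hL 1).ne'
    have := (hL 2).ne'
    field_simp
  have e : (fun i => ψ i - c)
      = (ψ - P 2 ψ) + (P 2 ψ - P 1 (P 2 ψ)) + (P 1 (P 2 ψ) - P 0 (P 1 (P 2 ψ))) := by
    funext i
    simp only [Pi.add_apply, Pi.sub_apply, hconst]
    ring
  rw [e]
  refine (cellInner_add_three_self_le N hh0 _ _ _).trans ?_
  rw [hψ.faceInner_gradh_self h, Fin.sum_univ_three]
  have c0 : cellInner N h (dirDiff N h 0 (P 1 (P 2 ψ))) (dirDiff N h 0 (P 1 (P 2 ψ)))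
      ≤ cellInner N h (dirDiff N h 0 ψ) (dirDiff N h 0 ψ) := by
    rw [hcomm 0 1 _ (by decide), hcomm 0 2 _ (by decide)]
    exact (hcon 1 _).trans (hcon 2 _)
  have c1 : cellInner N h (dirDiff N h 1 (P 2 ψ)) (dirDiff N h 1 (P 2 ψ))
      ≤ cellInner N h (dirDiff N h 1 ψ) (dirDiff N h 1 ψ) := by
    rw [hcomm 1 2 _ (by decide)]
    exact hcon 2 _
  have i1 := hsub 2 ψ
  have i2 := (hsub 1 (P 2 ψ)).trans (mul_le_mul_of_nonneg_left
    c1 (sq_nonneg (L 1)))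
  have i3 := (hsub 0 (P 1 (P 2 ψ))).trans (mul_le_mul_of_nonneg_left
    c0 (sq_nonneg (L 0)))
  have p := fun d => cellInner_self_nonneg N hh0 (dirDiff N h d ψ)
  have q := fun d e => mul_nonneg (sq_nonneg (L d)) (p e)
  linarith [q 0 1, q 0 2, q 1 0, q 1 2, q 2 0, q 2 1]

/-! ### Taylor expansion along coordinate lines -/

theorem uniqueDiffOn_closedBox {L : Fin 3 → ℝ} (hL : ∀ d, 0 < L d) :
    UniqueDiffOn ℝ (closedBox L) := by
  rw [closedBox, ← Set.pi_univ_Icc]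
  exact UniqueDiffOn.univ_pi fun d => uniqueDiffOn_Icc (hL d)

theorem contDiffOn_pd {L : Fin 3 → ℝ} (hL : ∀ d, 0 < L d) (d : Fin 3) {n : ℕ}
    {f : (Fin 3 → ℝ) → ℝ} (hf : ContDiffOn ℝ (n + 1 : ℕ) f (closedBox L)) :
    ContDiffOn ℝ n (pd L d f) (closedBox L) :=
  (hf.fderivWithin (uniqueDiffOn_closedBox hL) (by norm_cast)).clm_apply contDiffOn_const

theorem update_mem_closedBox {L : Fin 3 → ℝ} {x : Fin 3 → ℝ} (hx : x ∈ closedBox L) {d : Fin 3}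
    {r : ℝ} (hr : r ∈ Set.Icc 0 (L d)) : Function.update x d r ∈ closedBox L := by
  rw [closedBox, ← Set.pi_univ_Icc] at hx ⊢
  intro e _
  by_cases he : e = d
  · subst he; simpa using hr
  · rw [Function.update_of_ne he]; exact hx e trivial

theorem hasDerivWithinAt_line {L : Fin 3 → ℝ} {f : (Fin 3 → ℝ) → ℝ}
    (hf : DifferentiableOn ℝ f (closedBox L)) {x : Fin 3 → ℝ} (hx : x ∈ closedBox L) {d : Fin 3}
    {r : ℝ} (hr : r ∈ Set.Icc 0 (L d)) :
    HasDerivWithinAt (fun s => f (Function.update x d s)) (pd L d f (Function.update x d r))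
      (Set.Icc 0 (L d)) r := by
  have h1 := (hf _ (update_mem_closedBox hx hr)).hasFDerivWithinAt
  exact h1.comp_hasDerivWithinAt r (hasDerivAt_update x d r).hasDerivWithinAt
    fun s hs => update_mem_closedBox hx hs

theorem taylor_zero {ℓ K : ℝ} {g g1 : ℝ → ℝ}
    (h1 : ∀ r ∈ Set.Icc 0 ℓ, HasDerivWithinAt g (g1 r) (Set.Icc 0 ℓ) r)
    (hK : ∀ r ∈ Set.Icc 0 ℓ, |g1 r| ≤ K) {x y : ℝ} (hx : x ∈ Set.Icc 0 ℓ)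
    (hy : y ∈ Set.Icc 0 ℓ) : |g y - g x| ≤ K * |y - x| :=
  (convex_Icc 0 ℓ).norm_image_sub_le_of_norm_hasDerivWithin_le h1 hK hx hy

theorem taylor_one {ℓ K : ℝ} {g g1 g2 : ℝ → ℝ}
    (h1 : ∀ r ∈ Set.Icc 0 ℓ, HasDerivWithinAt g (g1 r) (Set.Icc 0 ℓ) r)
    (h2 : ∀ r ∈ Set.Icc 0 ℓ, HasDerivWithinAt g1 (g2 r) (Set.Icc 0 ℓ) r)
    (hK0 : 0 ≤ K) (hK : ∀ r ∈ Set.Icc 0 ℓ, |g2 r| ≤ K) {x y : ℝ} (hx : x ∈ Set.Icc 0 ℓ)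
    (hy : y ∈ Set.Icc 0 ℓ) : |g y - g x - g1 x * (y - x)| ≤ K * |y - x| ^ 2 := by
  have hsub : Set.uIcc x y ⊆ Set.Icc 0 ℓ := Set.uIcc_subset_Icc hx hy
  have key := (convex_uIcc x y).norm_image_sub_le_of_norm_hasDerivWithin_le
    (f := fun r => g r - g1 x * r) (f' := fun r => g1 r - g1 x) (C := K * |y - x|)
    (fun r hr => by
      have := ((h1 r (hsub hr)).mono hsub).sub (((hasDerivWithinAt_id r _).const_mul (g1 x)))
      exact this.congr_deriv (by simp))
    (fun r hr => (taylor_zero h2 hK hx (hsub hr)).trans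
      (mul_le_mul_of_nonneg_left (Set.abs_sub_left_of_mem_uIcc hr) hK0))
    Set.left_mem_uIcc Set.right_mem_uIcc
  rw [Real.norm_eq_abs, Real.norm_eq_abs] at key
  calc |g y - g x - g1 x * (y - x)| = |g y - g1 x * y - (g x - g1 x * x)| := by ring_nf
    _ ≤ _ := key
    _ = _ := by ring

theorem taylor_two {ℓ K : ℝ} {g g1 g2 g3 : ℝ → ℝ}
    (h1 : ∀ r ∈ Set.Icc 0 ℓ, HasDerivWithinAt g (g1 r) (Set.Icc 0 ℓ) r)
    (h2 : ∀ r ∈ Set.Icc 0 ℓ, HasDerivWithinAt g1 (g2 r) (Set.Icc 0 ℓ) r)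
    (h3 : ∀ r ∈ Set.Icc 0 ℓ, HasDerivWithinAt g2 (g3 r) (Set.Icc 0 ℓ) r)
    (hK0 : 0 ≤ K) (hK : ∀ r ∈ Set.Icc 0 ℓ, |g3 r| ≤ K) {x y : ℝ} (hx : x ∈ Set.Icc 0 ℓ)
    (hy : y ∈ Set.Icc 0 ℓ) :
    |g y - g x - g1 x * (y - x) - g2 x * (y - x) ^ 2 / 2| ≤ K * |y - x| ^ 3 := by
  have hsub : Set.uIcc x y ⊆ Set.Icc 0 ℓ := Set.uIcc_subset_Icc hx hy
  have key := (convex_uIcc x y).norm_image_sub_le_of_norm_hasDerivWithin_le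
    (f := fun r => g r - g1 x * r - g2 x * (r - x) ^ 2 / 2)
    (f' := fun r => g1 r - g1 x - g2 x * (r - x)) (C := K * |y - x| ^ 2)
    (fun r hr => by
      have e1 : HasDerivWithinAt (fun r => g2 x * (r - x) ^ 2 / 2) (g2 x * (r - x))
          (Set.uIcc x y) r := by
        have := ((((hasDerivAt_id r).sub_const x).pow 2).const_mul (g2 x)).div_const 2
        refine (this.congr_deriv ?_).hasDerivWithinAt
        simp
        ring
      have := (((h1 r (hsub hr)).mono hsub).sub
        (((hasDerivWithinAt_id r _).const_mul (g1 x)))).sub e1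
      exact this.congr_deriv (by simp))
    (fun r hr => (taylor_one h2 h3 hK0 hK hx (hsub hr)).trans
      (mul_le_mul_of_nonneg_left
        (pow_le_pow_left₀ (abs_nonneg _) (Set.abs_sub_left_of_mem_uIcc hr) 2) hK0))
    Set.left_mem_uIcc Set.right_mem_uIcc
  rw [Real.norm_eq_abs, Real.norm_eq_abs] at key
  calc |g y - g x - g1 x * (y - x) - g2 x * (y - x) ^ 2 / 2|
      = |g y - g1 x * y - g2 x * (y - x) ^ 2 / 2
          - (g x - g1 x * x - g2 x * (x - x) ^ 2 / 2)| := by ring_nf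
    _ ≤ _ := key
    _ = _ := by ring

/-! ### Finite differences of smooth functions with Neumann boundary conditions -/

/-- The sequence of midpoint values of `g`, extended constantly beyond `1, …, n`. -/
def clampSeq (n : ℕ) (h : ℝ) (g : ℝ → ℝ) (k : ℤ) : ℝ :=
  g ((((max 1 (min k n) : ℤ) : ℝ) - 1 / 2) * h)

theorem clampSeq_of_mem {n : ℕ} {k : ℤ} (hk : 1 ≤ k ∧ k ≤ n) (h : ℝ) (g : ℝ → ℝ) :
    clampSeq n h g k = g (((k : ℝ) - 1 / 2) * h) := by
  rw [clampSeq, min_eq_left hk.2, max_eq_right hk.1]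

theorem midpoint_mem {n : ℕ} {h ℓ : ℝ} (hh : 0 < h) (hn : n * h = ℓ) {k : ℤ}
    (hk : 1 ≤ k ∧ k ≤ n) : ((k : ℝ) - 1 / 2) * h ∈ Set.Icc 0 ℓ := by
  have h1 : (1 : ℝ) ≤ k := by exact_mod_cast hk.1
  have h2 : (k : ℝ) ≤ n := by exact_mod_cast hk.2
  constructor
  · nlinarith
  · rw [← hn]; nlinarith

/-- The second difference at the cell centres, with Neumann ghost values. -/
theorem abs_second_diff_le {n : ℕ} {h ℓ K : ℝ} (hh : 0 < h) (hn : n * h = ℓ) {g g1 g2 : ℝ → ℝ}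
    (h1 : ∀ r ∈ Set.Icc 0 ℓ, HasDerivWithinAt g (g1 r) (Set.Icc 0 ℓ) r)
    (h2 : ∀ r ∈ Set.Icc 0 ℓ, HasDerivWithinAt g1 (g2 r) (Set.Icc 0 ℓ) r)
    (hK0 : 0 ≤ K) (hK : ∀ r ∈ Set.Icc 0 ℓ, |g2 r| ≤ K) (hg0 : g1 0 = 0) (hgℓ : g1 ℓ = 0)
    {j : ℤ} (hj : 1 ≤ j ∧ j ≤ n) :
    |clampSeq n h g (j + 1) - 2 * clampSeq n h g j + clampSeq n h g (j - 1)|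
      ≤ 2 * K * h ^ 2 := by
  set x := ((j : ℝ) - 1 / 2) * h with hx
  have hxm : x ∈ Set.Icc 0 ℓ := midpoint_mem hh hn hj
  have hℓ : 0 ≤ ℓ := hxm.1.trans hxm.2
  rw [clampSeq_of_mem hj, ← hx]
  have hu : |clampSeq n h g (j + 1) - g x - g1 x * h| ≤ K * h ^ 2 := by
    by_cases hjn : j = n
    · have e : clampSeq n h g (j + 1) = g x := by
        rw [clampSeq, min_eq_right (by omega), max_eq_right (by omega), hx, hjn]
      have t := taylor_zero h2 hK ⟨hℓ, le_rfl⟩ hxm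
      have e2 : x - ℓ = -(h / 2) := by
        rw [hx, ← hn, hjn]; push_cast; ring
      rw [hgℓ, sub_zero, e2, abs_neg, abs_of_pos (half_pos hh)] at t
      rw [e, sub_self, zero_sub, abs_neg, abs_mul, abs_of_pos hh]
      nlinarith
    · have hm : 1 ≤ j + 1 ∧ j + 1 ≤ n := by omega
      have t := taylor_one h1 h2 hK0 hK hxm (midpoint_mem hh hn hm)
      have e2 : (((j + 1 : ℤ) : ℝ) - 1 / 2) * h - x = h := by
        rw [hx]; push_cast; ring
      rw [e2, abs_of_pos hh] at t
      rw [clampSeq_of_mem hm]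
      exact t
  have hd : |clampSeq n h g (j - 1) - g x - g1 x * (-h)| ≤ K * h ^ 2 := by
    by_cases hj1 : j = 1
    · have e : clampSeq n h g (j - 1) = g x := by
        rw [clampSeq, min_eq_left (by omega), max_eq_left (by omega), hx, hj1]
      have t := taylor_zero h2 hK ⟨le_rfl, hℓ⟩ hxm
      have e2 : x - 0 = h / 2 := by
        rw [hx, hj1]; push_cast; ring
      rw [hg0, sub_zero, e2, abs_of_pos (half_pos hh)] at t
      rw [e, sub_self, zero_sub, abs_neg, abs_mul, abs_neg, abs_of_pos hh]
      nlinarith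
    · have hm : 1 ≤ j - 1 ∧ j - 1 ≤ n := by omega
      have t := taylor_one h1 h2 hK0 hK hxm (midpoint_mem hh hn hm)
      have e2 : (((j - 1 : ℤ) : ℝ) - 1 / 2) * h - x = -h := by
        rw [hx]; push_cast; ring
      rw [e2, abs_neg, abs_of_pos hh] at t
      rw [clampSeq_of_mem hm]
      exact t
  rw [abs_le] at hu hd ⊢
  constructor <;> nlinarith

/-- The third difference at the interior faces, with Neumann ghost values. All four values are
compared with the quadratic Taylor polynomial at the face; a ghost value deviates from it by `h`
times the boundary derivative of the polynomial, which is small by the Neumann condition. -/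
theorem abs_third_diff_le {n : ℕ} {h ℓ K : ℝ} (hh : 0 < h) (hn : n * h = ℓ)
    {g g1 g2 g3 : ℝ → ℝ}
    (h1 : ∀ r ∈ Set.Icc 0 ℓ, HasDerivWithinAt g (g1 r) (Set.Icc 0 ℓ) r)
    (h2 : ∀ r ∈ Set.Icc 0 ℓ, HasDerivWithinAt g1 (g2 r) (Set.Icc 0 ℓ) r)
    (h3 : ∀ r ∈ Set.Icc 0 ℓ, HasDerivWithinAt g2 (g3 r) (Set.Icc 0 ℓ) r)
    (hK0 : 0 ≤ K) (hK : ∀ r ∈ Set.Icc 0 ℓ, |g3 r| ≤ K) (hg0 : g1 0 = 0) (hgℓ : g1 ℓ = 0)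
    {j : ℤ} (hj : 1 ≤ j ∧ j + 1 ≤ n) :
    |clampSeq n h g (j + 2) - 3 * clampSeq n h g (j + 1) + 3 * clampSeq n h g j
      - clampSeq n h g (j - 1)| ≤ 32 * K * h ^ 3 := by
  have h1j : (1 : ℝ) ≤ j := by exact_mod_cast hj.1
  have hjn' : (j : ℝ) + 1 ≤ n := by exact_mod_cast hj.2
  set x := (j : ℝ) * h with hx
  have hxm : x ∈ Set.Icc 0 ℓ := by
    constructor
    · positivity
    · rw [← hn]; nlinarith
  have hℓ : 0 ≤ ℓ := hxm.1.trans hxm.2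
  have hh3 : 0 < h ^ 3 := by positivity
  have tay : ∀ (k : ℤ) (c : ℝ), 1 ≤ k ∧ k ≤ n → ((k : ℝ) - 1 / 2) * h - x = c * h →
      |c| ^ 3 ≤ 4 → |clampSeq n h g k - g x - g1 x * (c * h) - g2 x * (c * h) ^ 2 / 2|
        ≤ 4 * K * h ^ 3 := by
    intro k c hk hc hc4
    have t := taylor_two h1 h2 h3 hK0 hK hxm (midpoint_mem hh hn hk)
    rw [hc, abs_mul, abs_of_pos hh, mul_pow |c|] at t
    rw [clampSeq_of_mem hk]
    refine t.trans ?_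
    have := mul_le_mul_of_nonneg_right (mul_le_mul_of_nonneg_left hc4 hK0) hh3.le
    nlinarith
  have c1 : |clampSeq n h g (j + 1) - g x - g1 x * (1 / 2 * h) - g2 x * (1 / 2 * h) ^ 2 / 2|
      ≤ 4 * K * h ^ 3 :=
    tay (j + 1) (1 / 2) (by omega) (by rw [hx]; push_cast; ring) (by norm_num [abs_of_pos])
  have c0 : |clampSeq n h g j - g x - g1 x * (-(1 / 2) * h) - g2 x * (-(1 / 2) * h) ^ 2 / 2|
      ≤ 4 * K * h ^ 3 :=
    tay j (-(1 / 2)) (by omega) (by rw [hx]; ring) (by norm_num [abs_of_pos])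
  have c2 : |clampSeq n h g (j + 2) - g x - g1 x * (3 / 2 * h) - g2 x * (3 / 2 * h) ^ 2 / 2|
      ≤ 4 * K * h ^ 3 := by
    by_cases hjn : j + 1 = n
    · have e : clampSeq n h g (j + 2) = clampSeq n h g (j + 1) := by
        rw [clampSeq, clampSeq, min_eq_right (by omega), min_eq_left (by omega), hjn]
      have t := taylor_two h1 h2 h3 hK0 hK hxm
        (midpoint_mem hh hn (k := j + 1) (by omega))
      have e2 : (((j + 1 : ℤ) : ℝ) - 1 / 2) * h - x = 1 / 2 * h := by
        rw [hx]; push_cast; ring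
      rw [e2, abs_of_pos (by positivity : (0 : ℝ) < 1 / 2 * h),
        ← clampSeq_of_mem (n := n) (k := j + 1) (by omega) h g] at t
      have s := taylor_one h2 h3 hK0 hK hxm ⟨hℓ, le_rfl⟩
      have e3 : ℓ - x = h := by
        have : (n : ℝ) = j + 1 := by exact_mod_cast hjn.symm
        rw [hx, ← hn, this]; ring
      rw [e3, abs_of_pos hh, hgℓ] at s
      rw [e]
      rw [abs_le] at t s ⊢
      have s1 := mul_le_mul_of_nonneg_right s.1 hh.le
      have s2 := mul_le_mul_of_nonneg_right s.2 hh.le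
      have : 0 ≤ K * h ^ 3 := by positivity
      constructor <;> nlinarith
    · exact tay (j + 2) (3 / 2) (by omega) (by rw [hx]; push_cast; ring)
        (by norm_num [abs_of_pos])
  have cm : |clampSeq n h g (j - 1) - g x - g1 x * (-(3 / 2) * h)
      - g2 x * (-(3 / 2) * h) ^ 2 / 2| ≤ 4 * K * h ^ 3 := by
    by_cases hj1 : j = 1
    · have e : clampSeq n h g (j - 1) = clampSeq n h g j := by
        rw [clampSeq, clampSeq, min_eq_left (by omega), max_eq_left (by omega),
          min_eq_left (by omega), max_eq_left (by omega)]
      have t := taylor_two h1 h2 h3 hK0 hK hxm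
        (midpoint_mem hh hn (k := j) (by omega))
      have e2 : ((j : ℝ) - 1 / 2) * h - x = -(1 / 2 * h) := by
        rw [hx]; ring
      rw [e2, abs_neg, abs_of_pos (by positivity : (0 : ℝ) < 1 / 2 * h),
        ← clampSeq_of_mem (n := n) (k := j) (by omega) h g] at t
      have s := taylor_one h2 h3 hK0 hK hxm ⟨le_rfl, hℓ⟩
      have e3 : 0 - x = -h := by
        rw [hx, hj1]; push_cast; ring
      rw [e3, abs_neg, abs_of_pos hh, hg0] at s
      rw [e]
      rw [abs_le] at t s ⊢
      have s1 := mul_le_mul_of_nonneg_right s.1 hh.le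
      have s2 := mul_le_mul_of_nonneg_right s.2 hh.le
      have : 0 ≤ K * h ^ 3 := by positivity
      constructor <;> nlinarith
    · exact tay (j - 1) (-(3 / 2)) (by omega) (by rw [hx]; push_cast; ring)
        (by norm_num [abs_of_pos])
  rw [abs_le] at c0 c1 c2 cm ⊢
  constructor <;> nlinarith

/-- `v` is `C⁴` on the closed box, satisfies the Neumann condition, and its derivatives up to order
three are bounded by `K`. -/
structure NeumannBound (L : Fin 3 → ℝ) (K : ℝ) (v : (Fin 3 → ℝ) → ℝ) : Prop where
  smooth : ContDiffOn ℝ 4 v (closedBox L)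
  bound : ∀ w : List (Fin 3), w.length ≤ 3 → ∀ x ∈ closedBox L, |iterPd L w v x| ≤ K
  neumann : ∀ d, ∀ x ∈ closedBox L, (x d = 0 ∨ x d = L d) → pd L d v x = 0

theorem contDiffOn_iterPd {L : Fin 3 → ℝ} (hL : ∀ d, 0 < L d) {v : (Fin 3 → ℝ) → ℝ}
    (w : List (Fin 3)) (k : ℕ) (hv : ContDiffOn ℝ (w.length + k : ℕ) v (closedBox L)) :
    ContDiffOn ℝ k (iterPd L w v) (closedBox L) := by
  induction w generalizing k with
  | nil => simpa [iterPd] using hv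
  | cons d w ih =>
    refine contDiffOn_pd hL d (ih (k + 1) ?_)
    have e : (d :: w).length + k = w.length + (k + 1) := by simp; omega
    rwa [e] at hv

theorem differentiableOn_iterPd {L : Fin 3 → ℝ} (hL : ∀ d, 0 < L d) {v : (Fin 3 → ℝ) → ℝ}
    (hv : ContDiffOn ℝ 4 v (closedBox L)) (w : List (Fin 3)) (hw : w.length ≤ 3) :
    DifferentiableOn ℝ (iterPd L w v) (closedBox L) := by
  refine (contDiffOn_iterPd hL w 1 (hv.of_le ?_)).differentiableOn (by norm_num)
  have : w.length + 1 ≤ 4 := by omega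
  exact_mod_cast this

/-- The centre of the cell `i`. -/
def cellCenter (h : ℝ) (i : Fin 3 → ℤ) : Fin 3 → ℝ := fun d => ((i d : ℝ) - 1 / 2) * h

theorem cellCenter_mem {L : Fin 3 → ℝ} {N : Fin 3 → ℕ} {h : ℝ} (hh0 : 0 < h)
    (hNd : ∀ d, (N d : ℝ) * h = L d) {i : Fin 3 → ℤ} (hi : i ∈ cells N) :
    cellCenter h i ∈ closedBox L := by
  rw [closedBox, ← Set.pi_univ_Icc]
  exact fun d _ => midpoint_mem hh0 (hNd d) (mem_cells.1 hi d)

theorem gridProj_of_mem {N : Fin 3 → ℕ} {i : Fin 3 → ℤ} (hi : i ∈ cells N) (h : ℝ)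
    (v : (Fin 3 → ℝ) → ℝ) : gridProj N h v i = v (cellCenter h i) := by
  simp only [gridProj, nearCell_of_mem hi]
  rfl

/-- Along a grid line through a cell, the grid projection is a clamped sequence of midpoint
values. -/
theorem gridProj_update {N : Fin 3 → ℕ} {i : Fin 3 → ℤ} (hi : i ∈ cells N) (h : ℝ)
    (v : (Fin 3 → ℝ) → ℝ) (e : Fin 3) (k : ℤ) :
    gridProj N h v (Function.update i e k)
      = clampSeq (N e) h (fun r => v (Function.update (cellCenter h i) e r)) k := by
  unfold gridProj clampSeq
  congr 1
  funext d
  by_cases hd : d = e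
  · subst hd; simp [nearCell]
  · have := mem_cells.1 hi d
    rw [Function.update_of_ne hd]
    simp only [nearCell, Function.update_of_ne hd, cellCenter]
    rw [min_eq_left this.2, max_eq_right this.1]

theorem NeumannBound.nonneg {L : Fin 3 → ℝ} (hL : ∀ d, 0 < L d) {K : ℝ} {v : (Fin 3 → ℝ) → ℝ}
    (hv : NeumannBound L K v) : 0 ≤ K :=
  (abs_nonneg _).trans (hv.bound [] (by simp) 0 ⟨le_rfl, fun d => (hL d).le⟩)

theorem NeumannBound.abs_gridProj_le {L : Fin 3 → ℝ} {K : ℝ} {v : (Fin 3 → ℝ) → ℝ}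
    (hv : NeumannBound L K v) {N : Fin 3 → ℕ} {h : ℝ} (hh0 : 0 < h)
    (hNd : ∀ d, (N d : ℝ) * h = L d) {i : Fin 3 → ℤ} (hi : i ∈ cells N) :
    |gridProj N h v i| ≤ K := by
  rw [gridProj_of_mem hi]
  exact hv.bound [] (by simp) _ (cellCenter_mem hh0 hNd hi)

theorem NeumannBound.abs_gradh_gridProj_le {L : Fin 3 → ℝ} (hL : ∀ d, 0 < L d) {K : ℝ}
    {v : (Fin 3 → ℝ) → ℝ}
    (hv : NeumannBound L K v) {N : Fin 3 → ℕ} {h : ℝ} (hh0 : 0 < h)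
    (hNd : ∀ d, (N d : ℝ) * h = L d) {i : Fin 3 → ℤ} (hi : i ∈ cells N) {d : Fin 3}
    (hid : i + eu d ∈ cells N) :
    |gradh h (gridProj N h v) d i| ≤ K := by
  have hc := cellCenter_mem hh0 hNd hi
  have h1 := mem_cells.1 hi d
  have h2 := mem_cells.1 hid d
  rw [add_eu_apply, if_pos rfl] at h2
  have e0 : gridProj N h v i = gridProj N h v (Function.update i d (i d)) := by simp
  rw [gradh, e0, add_eu_eq_update, gridProj_update hi, gridProj_update hi,
    clampSeq_of_mem h1, clampSeq_of_mem h2]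
  have t := taylor_zero (fun r hr => hasDerivWithinAt_line
    (differentiableOn_iterPd hL hv.smooth [] (by simp)) hc (d := d) hr)
    (fun r hr => hv.bound [d] (by simp) _ (update_mem_closedBox hc hr))
    (midpoint_mem hh0 (hNd d) h1) (midpoint_mem hh0 (hNd d) h2)
  have e1 : (((i d + 1 : ℤ) : ℝ) - 1 / 2) * h - ((i d : ℝ) - 1 / 2) * h = h := by
    push_cast; ring
  rw [e1, abs_of_pos hh0] at t
  rw [abs_div, abs_of_pos hh0, div_le_iff₀ hh0]
  exact t

theorem laph_eq_sum (N : Fin 3 → ℕ) {h : ℝ} (hh0 : 0 < h) (ψ : CellFun) {i : Fin 3 → ℤ}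
    (hi : i ∈ cells N) :
    laph N h ψ i = ∑ e, (ψ (i + eu e) - 2 * ψ i + ψ (i - eu e)) / h ^ 2 := by
  rw [laph_of_mem hi, divh]
  refine Finset.sum_congr rfl fun e _ => ?_
  simp only [gradh, sub_add_cancel]
  field_simp
  ring

/-- The gradient of the discrete Laplacian stays bounded up to the boundary. Across a face in
direction `d`, the second differences in direction `d` give a third difference; those in a direction
`e ≠ d` give a second difference of the increment across the face, whose second derivative is at
most `K h`. In both cases the Neumann condition controls the ghost values. -/
theorem NeumannBound.abs_gradh_laph_gridProj_le {L : Fin 3 → ℝ} (hL : ∀ d, 0 < L d) {K : ℝ}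
    {v : (Fin 3 → ℝ) → ℝ}
    (hv : NeumannBound L K v) {N : Fin 3 → ℕ} {h : ℝ} (hh0 : 0 < h)
    (hNd : ∀ d, (N d : ℝ) * h = L d) {i : Fin 3 → ℤ} (hi : i ∈ cells N) {d : Fin 3}
    (hid : i + eu d ∈ cells N) :
    |gradh h (laph N h (gridProj N h v)) d i| ≤ 96 * K := by
  have hK0 := hv.nonneg hL
  have hc := cellCenter_mem hh0 hNd hi
  have hc' := cellCenter_mem hh0 hNd hid
  have h1 := mem_cells.1 hi d
  have h2 := mem_cells.1 hid d
  rw [add_eu_apply, if_pos rfl] at h2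
  set Φ := gridProj N h v with hΦ
  have dif := fun w hw => differentiableOn_iterPd hL hv.smooth w hw
  -- the contribution of the second difference in direction `e`
  have key : ∀ e, |(Φ (i + eu d + eu e) - 2 * Φ (i + eu d) + Φ (i + eu d - eu e))
      - (Φ (i + eu e) - 2 * Φ i + Φ (i - eu e))| ≤ 32 * K * h ^ 3 := by
    intro e
    by_cases hed : e = d
    · subst hed
      have t := abs_third_diff_le hh0 (hNd e)
        (fun r hr => hasDerivWithinAt_line (dif [] (by simp)) hc (d := e) hr)
        (fun r hr => hasDerivWithinAt_line (dif [e] (by simp)) hc (d := e) hr)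
        (fun r hr => hasDerivWithinAt_line (dif [e, e] (by simp)) hc (d := e) hr)
        hK0 (fun r hr => hv.bound [e, e, e] (by simp) _ (update_mem_closedBox hc hr))
        (hv.neumann e _ (update_mem_closedBox hc ⟨le_rfl, (hL e).le⟩) (by simp))
        (hv.neumann e _ (update_mem_closedBox hc ⟨(hL e).le, le_rfl⟩) (by simp))
        ⟨h1.1, h2.2⟩
      simp only [← gridProj_update hi, iterPd, ← hΦ] at t
      have p1 : i + eu e + eu e = Function.update i e (i e + 2) := by
        rw [add_eu_eq_update i, add_eu_eq_update]; simp; ring_nf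
      rw [p1, add_sub_cancel_right, add_eu_eq_update i, sub_eu_eq_update]
      rw [Function.update_eq_self] at t
      refine le_trans (le_of_eq ?_) t
      congr 1
      ring
    · -- for `e ≠ d`, the second difference of the difference in direction `d`
      have hie := mem_cells.1 hi e
      have hie' := mem_cells.1 hid e
      have hede : (i + eu d) e = i e := by rw [add_eu_apply, if_neg hed, add_zero]
      have hcc : ∀ r, Function.update (cellCenter h (i + eu d)) e r
          = Function.update (Function.update (cellCenter h i) e r) d
            (cellCenter h (i + eu d) d) := by
        intro r
        funext f
        by_cases hf : f = d
        · subst hf; rw [Function.update_self, Function.update_of_ne (Ne.symm hed)]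
        · rw [Function.update_of_ne hf]
          by_cases hfe : f = e
          · subst hfe; simp
          · rw [Function.update_of_ne hfe, Function.update_of_ne hfe]
            simp only [cellCenter, add_eu_apply, if_neg hf, add_zero]
      have hlen : ∀ r ∈ Set.Icc 0 (L e),
          |iterPd L [e, e] v (Function.update (cellCenter h (i + eu d)) e r)
            - iterPd L [e, e] v (Function.update (cellCenter h i) e r)| ≤ K * h := by
        intro r hr
        have hcr := update_mem_closedBox hc hr
        have t := taylor_zero (fun s hs => hasDerivWithinAt_line
          (dif [e, e] (by simp)) hcr (d := d) hs)
          (fun s hs => hv.bound [d, e, e] (by simp) _ (update_mem_closedBox hcr hs))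
          (midpoint_mem hh0 (hNd d) h1) (midpoint_mem hh0 (hNd d) h2)
        have e1 : (((i d + 1 : ℤ) : ℝ) - 1 / 2) * h - ((i d : ℝ) - 1 / 2) * h = h := by
          push_cast; ring
        have e2 : Function.update (Function.update (cellCenter h i) e r) d
            (((i d : ℝ) - 1 / 2) * h) = Function.update (cellCenter h i) e r := by
          rw [Function.update_comm hed]
          congr 1
          exact Function.update_eq_self d _
        have e3 : cellCenter h (i + eu d) d = (((i d + 1 : ℤ) : ℝ) - 1 / 2) * h := by
          simp only [cellCenter, add_eu_apply, if_true]
        rw [e1, abs_of_pos hh0, e2, ← e3, ← hcc] at t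
        exact t
      have t := abs_second_diff_le hh0 (hNd e)
        (fun r hr => (hasDerivWithinAt_line (dif [] (by simp)) hc' (d := e) hr).sub
          (hasDerivWithinAt_line (dif [] (by simp)) hc (d := e) hr))
        (fun r hr => (hasDerivWithinAt_line (dif [e] (by simp)) hc' (d := e) hr).sub
          (hasDerivWithinAt_line (dif [e] (by simp)) hc (d := e) hr))
        (by positivity : 0 ≤ K * h) hlen
        (by
          change pd L e v _ - pd L e v _ = 0
          rw [hv.neumann e _ (update_mem_closedBox hc' ⟨le_rfl, (hL e).le⟩) (by simp),
            hv.neumann e _ (update_mem_closedBox hc ⟨le_rfl, (hL e).le⟩) (by simp), sub_zero])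
        (by
          change pd L e v _ - pd L e v _ = 0
          rw [hv.neumann e _ (update_mem_closedBox hc' ⟨(hL e).le, le_rfl⟩) (by simp),
            hv.neumann e _ (update_mem_closedBox hc ⟨(hL e).le, le_rfl⟩) (by simp), sub_zero])
        hie
      have q : ∀ k, clampSeq (N e) h
          ((fun s => iterPd L [] v (Function.update (cellCenter h (i + eu d)) e s))
            - fun s => iterPd L [] v (Function.update (cellCenter h i) e s)) k
          = Φ (Function.update (i + eu d) e k) - Φ (Function.update i e k) := by
        intro k
        rw [hΦ, gridProj_update hid, gridProj_update hi]
        rfl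
      rw [q, q, q] at t
      rw [add_eu_eq_update (i + eu d) e, sub_eu_eq_update (i + eu d) e, hede,
        add_eu_eq_update i e, sub_eu_eq_update i e]
      have e4 : Function.update (i + eu d) e (i e) = i + eu d := by
        rw [← hede]; exact Function.update_eq_self e _
      rw [e4, Function.update_eq_self] at t
      have hp : 0 ≤ K * h ^ 3 := by positivity
      calc _ = |Φ (Function.update (i + eu d) e (i e + 1)) - Φ (Function.update i e (i e + 1))
            - 2 * (Φ (i + eu d) - Φ i) + (Φ (Function.update (i + eu d) e (i e - 1))
            - Φ (Function.update i e (i e - 1)))| := by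
              congr 1; ring
        _ ≤ _ := t
        _ ≤ _ := by nlinarith
  have e : gradh h (laph N h Φ) d i = (∑ e,
      ((Φ (i + eu d + eu e) - 2 * Φ (i + eu d) + Φ (i + eu d - eu e))
      - (Φ (i + eu e) - 2 * Φ i + Φ (i - eu e)))) / h ^ 3 := by
    rw [gradh, laph_eq_sum N hh0 Φ hi, laph_eq_sum N hh0 Φ hid, Finset.sum_sub_distrib,
      ← Finset.sum_div, ← Finset.sum_div]
    field_simp
  rw [e, abs_div, abs_of_pos (pow_pos hh0 3), div_le_iff₀ (pow_pos hh0 3)]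
  refine (Finset.abs_sum_le_sum_abs _ _).trans ((Finset.sum_le_sum fun e _ => key e).trans ?_)
  simp
  linarith

/-! ### The midpoint rule -/

/-- The cell with centre `cellCenter h i`, half open so that the cells are disjoint. -/
def cellBox (h : ℝ) (i : Fin 3 → ℤ) : Set (Fin 3 → ℝ) :=
  Set.pi univ fun d => Set.Ioc (((i d : ℝ) - 1) * h) ((i d : ℝ) * h)

theorem measurableSet_cellBox (h : ℝ) (i : Fin 3 → ℤ) : MeasurableSet (cellBox h i) :=
  MeasurableSet.univ_pi fun _ => measurableSet_Ioc

theorem closedBall_cellCenter {h : ℝ} (hh : 0 < h) (i : Fin 3 → ℤ) :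
    Metric.closedBall (cellCenter h i) (h / 2)
      = Set.Icc (fun d => ((i d : ℝ) - 1) * h) (fun d => (i d : ℝ) * h) := by
  rw [closedBall_pi _ (half_pos hh).le, ← Set.pi_univ_Icc]
  congr 1
  funext d
  rw [Real.closedBall_eq_Icc, cellCenter]
  congr 1 <;> ring

theorem cellBox_ae_eq_closedBall {h : ℝ} (hh : 0 < h) (i : Fin 3 → ℤ) :
    cellBox h i =ᵐ[volume] Metric.closedBall (cellCenter h i) (h / 2) := by
  rw [closedBall_cellCenter hh]
  exact Measure.univ_pi_Ioc_ae_eq_Icc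

theorem biUnion_cellBox {L : Fin 3 → ℝ} {N : Fin 3 → ℕ} {h : ℝ} (hh : 0 < h)
    (hNd : ∀ d, (N d : ℝ) * h = L d) :
    ⋃ i ∈ cells N, cellBox h i = Set.pi univ fun d => Set.Ioc 0 (L d) := by
  ext x
  simp only [Set.mem_iUnion, cellBox, Set.mem_pi, Set.mem_univ, true_implies, exists_prop,
    mem_cells, Set.mem_Ioc]
  constructor
  · rintro ⟨i, hi, hx⟩ d
    have h1 : (1 : ℝ) ≤ i d := by exact_mod_cast (hi d).1
    have h2 : (i d : ℝ) ≤ N d := by exact_mod_cast (hi d).2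
    refine ⟨lt_of_le_of_lt ?_ (hx d).1, (hx d).2.trans ?_⟩
    · exact mul_nonneg (by linarith) hh.le
    · rw [← hNd d]; exact mul_le_mul_of_nonneg_right h2 hh.le
  · intro hx
    refine ⟨fun d => ⌈x d / h⌉, fun d => ⟨?_, ?_⟩, fun d => ⟨?_, ?_⟩⟩
    · exact Int.one_le_ceil_iff.2 (div_pos (hx d).1 hh)
    · rw [Int.ceil_le, div_le_iff₀ hh]
      have := (hx d).2
      rw [← hNd d] at this
      exact_mod_cast this
    · have := Int.ceil_lt_add_one (x d / h)
      rw [← lt_div_iff₀ hh]; linarith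
    · rw [← div_le_iff₀ hh]; exact Int.le_ceil _

theorem pairwiseDisjoint_cellBox {h : ℝ} (hh : 0 < h) (s : Set (Fin 3 → ℤ)) :
    s.PairwiseDisjoint (cellBox h) := by
  intro i _ j _ hij
  rw [Function.onFun, Set.disjoint_left]
  intro x hxi hxj
  refine hij (funext fun d => ?_)
  have h1 := hxi d trivial
  have h2 := hxj d trivial
  rw [Set.mem_Ioc] at h1 h2
  have a1 : ((i d : ℝ) - 1) < j d := lt_of_mul_lt_mul_right (h1.1.trans_le h2.2) hh.le
  have a2 : ((j d : ℝ) - 1) < i d := lt_of_mul_lt_mul_right (h2.1.trans_le h1.2) hh.le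
  have b1 : i d - 1 < j d := by exact_mod_cast a1
  have b2 : j d - 1 < i d := by exact_mod_cast a2
  omega

theorem setIntegral_closedBox_eq_sum {L : Fin 3 → ℝ} {N : Fin 3 → ℕ} {h : ℝ} (hh : 0 < h)
    (hNd : ∀ d, (N d : ℝ) * h = L d) {v : (Fin 3 → ℝ) → ℝ}
    (hv : IntegrableOn v (closedBox L)) :
    ∫ x in closedBox L, v x
      = ∑ i ∈ cells N, ∫ x in Metric.closedBall (cellCenter h i) (h / 2), v x := by
  have e1 : (Set.pi univ fun d => Set.Ioc 0 (L d)) =ᵐ[volume] closedBox L :=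
    Measure.univ_pi_Ioc_ae_eq_Icc
  have hv' : IntegrableOn v (⋃ i ∈ cells N, cellBox h i) := by
    rw [biUnion_cellBox hh hNd]
    exact hv.congr_set_ae e1
  rw [← setIntegral_congr_set e1, ← biUnion_cellBox hh hNd,
    integral_biUnion_finset _ (fun i _ => measurableSet_cellBox h i)
      (pairwiseDisjoint_cellBox hh _)
      (fun i hi => hv'.mono_set (Set.subset_biUnion_of_mem (u := fun i => cellBox h i) hi))]
  exact Finset.sum_congr rfl fun i _ => setIntegral_congr_set (cellBox_ae_eq_closedBall hh i)

theorem opNorm_le_sum (A : (Fin 3 → ℝ) →L[ℝ] ℝ) : ‖A‖ ≤ ∑ d, |A (Pi.single d 1)| := by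
  refine A.opNorm_le_bound (Finset.sum_nonneg fun _ _ => abs_nonneg _) fun y => ?_
  have : A y = ∑ d, y d * A (Pi.single d 1) := by
    conv_lhs => rw [pi_eq_sum_univ' y]
    simp
  rw [this, Finset.sum_mul, Real.norm_eq_abs]
  refine (Finset.abs_sum_le_sum_abs _ _).trans (Finset.sum_le_sum fun d _ => ?_)
  rw [abs_mul, mul_comm]
  exact mul_le_mul_of_nonneg_left (norm_le_pi_norm y d) (abs_nonneg _)

/-- First-order Taylor expansion at a cell centre, uniformly on the cell. -/
theorem NeumannBound.abs_taylor_le {L : Fin 3 → ℝ} (hL : ∀ d, 0 < L d) {K : ℝ}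
    {v : (Fin 3 → ℝ) → ℝ} (hv : NeumannBound L K v) {c x : Fin 3 → ℝ} {r : ℝ}
    (hball : Metric.closedBall c r ⊆ closedBox L) (hx : x ∈ Metric.closedBall c r) :
    |v x - v c - fderivWithin ℝ v (closedBox L) c (x - c)| ≤ 9 * K * r ^ 2 := by
  have hK0 := hv.nonneg hL
  have hr : 0 ≤ r := dist_nonneg.trans hx
  have hc : c ∈ Metric.closedBall c r := Metric.mem_closedBall_self hr
  have dif := fun w hw => differentiableOn_iterPd hL hv.smooth w hw
  have hder : ∀ y ∈ Metric.closedBall c r, ∀ d,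
      |pd L d v y - pd L d v c| ≤ 3 * K * r := by
    intro y hy d
    have t := (convex_closedBall c r).norm_image_sub_le_of_norm_hasFDerivWithin_le
      (f := pd L d v) (f' := fun z => fderivWithin ℝ (pd L d v) (closedBox L) z) (C := 3 * K)
      (fun z hz => ((dif [d] (by simp) z (hball hz)).hasFDerivWithinAt).mono hball)
      (fun z hz => (opNorm_le_sum _).trans
        ((Finset.sum_le_sum fun e _ => hv.bound [e, d] (by simp) z (hball hz)).trans (by simp)))
      hc hy
    refine t.trans (mul_le_mul_of_nonneg_left ?_ (by positivity))
    rw [← dist_eq_norm]; exact hy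
  have t := (convex_closedBall c r).norm_image_sub_le_of_norm_hasFDerivWithin_le'
    (f := v) (f' := fun z => fderivWithin ℝ v (closedBox L) z)
    (φ := fderivWithin ℝ v (closedBox L) c) (C := 9 * K * r)
    (fun z hz => ((dif [] (by simp) z (hball hz)).hasFDerivWithinAt).mono hball)
    (fun z hz => (opNorm_le_sum _).trans
      ((Finset.sum_le_sum fun e _ => hder z hz e).trans (by simp; linarith)))
    hc hx
  refine t.trans ?_
  rw [sq, ← mul_assoc]
  refine mul_le_mul_of_nonneg_left ?_ (by positivity)
  rw [← dist_eq_norm]; exact hx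

/-- The midpoint rule on one cell; the linear part of the Taylor expansion integrates to zero
since the cell is symmetric about its centre. -/
theorem NeumannBound.abs_setIntegral_sub_le {L : Fin 3 → ℝ} (hL : ∀ d, 0 < L d) {K : ℝ}
    {v : (Fin 3 → ℝ) → ℝ} (hv : NeumannBound L K v) {c : Fin 3 → ℝ} {r : ℝ} (hr : 0 ≤ r)
    (hball : Metric.closedBall c r ⊆ closedBox L) :
    |∫ x in Metric.closedBall c r, (v x - v c)|
      ≤ 9 * K * r ^ 2 * (2 * r) ^ 3 := by
  set B := Metric.closedBall c r with hB
  have hcont : ContinuousOn (fun x => v x - v c) B :=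
    (hv.smooth.continuousOn.mono hball).sub continuousOn_const
  have hint : IntegrableOn (fun x => v x - v c) B :=
    hcont.integrableOn_compact (isCompact_closedBall c r)
  have hmp : MeasurePreserving (fun x : Fin 3 → ℝ => (c + c) - x) volume volume :=
    Measure.measurePreserving_sub_left volume (c + c)
  have hemb : MeasurableEmbedding (fun x : Fin 3 → ℝ => (c + c) - x) :=
    (MeasurableEquiv.subLeft (c + c)).measurableEmbedding
  have hpre : (fun x : Fin 3 → ℝ => (c + c) - x) ⁻¹' B = B := by
    ext x
    simp only [hB, Set.mem_preimage, Metric.mem_closedBall, dist_eq_norm]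
    rw [show c + c - x - c = -(x - c) by abel, norm_neg]
  have hrefl : ∫ x in B, (v (c + c - x) - v c) = ∫ x in B, (v x - v c) := by
    have := hmp.setIntegral_preimage_emb hemb (fun x => v x - v c) B
    rwa [hpre] at this
  have hint' : IntegrableOn (fun x => v (c + c - x) - v c) B := by
    have := (hmp.integrableOn_comp_preimage hemb (f := fun x => v x - v c) (s := B)).2 hint
    rwa [hpre] at this
  have h2 : 2 * ∫ x in B, (v x - v c) = ∫ x in B, ((v x - v c) + (v (c + c - x) - v c)) := by
    rw [integral_add hint hint', hrefl]; ring
  have hbd : ∀ x ∈ B, ‖(v x - v c) + (v (c + c - x) - v c)‖ ≤ 18 * K * r ^ 2 := by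
    intro x hx
    have hx' : c + c - x ∈ B := by rw [← hpre] at hx; exact hx
    have t1 := hv.abs_taylor_le hL hball hx
    have t2 := hv.abs_taylor_le hL hball hx'
    rw [show c + c - x - c = -(x - c) by abel, map_neg] at t2
    rw [Real.norm_eq_abs]
    rw [abs_le] at t1 t2 ⊢
    constructor <;> linarith
  have hvol : volume.real B = (2 * r) ^ 3 := by
    rw [Measure.real, hB, Real.volume_pi_closedBall _ hr,
      ENNReal.toReal_ofReal (by positivity)]
    simp
  have hfin : volume B < ⊤ := (isCompact_closedBall c r).measure_lt_top
  have h3 := norm_setIntegral_le_of_norm_le_const hfin hbd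
  rw [hvol, ← h2, Real.norm_eq_abs, abs_mul, abs_of_pos (by norm_num : (0 : ℝ) < 2)] at h3
  linarith

/-- The midpoint rule is second-order accurate. -/
theorem NeumannBound.abs_quadrature_le {L : Fin 3 → ℝ} (hL : ∀ d, 0 < L d) {K : ℝ}
    {v : (Fin 3 → ℝ) → ℝ} (hv : NeumannBound L K v) {N : Fin 3 → ℕ} {h : ℝ} (hh : 0 < h)
    (hNd : ∀ d, (N d : ℝ) * h = L d) :
    |h ^ 3 * ∑ i ∈ cells N, gridProj N h v i - ∫ x in closedBox L, v x|
      ≤ 9 * K * (L 0 * L 1 * L 2) * h ^ 2 := by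
  have hK0 := hv.nonneg hL
  have hvint : IntegrableOn v (closedBox L) := hv.smooth.continuousOn.integrableOn_compact
    (isCompact_Icc)
  rw [setIntegral_closedBox_eq_sum hh hNd hvint, Finset.mul_sum, ← Finset.sum_sub_distrib]
  have hsub : ∀ i ∈ cells N, Metric.closedBall (cellCenter h i) (h / 2) ⊆ closedBox L := by
    intro i hi
    rw [closedBall_cellCenter hh, closedBox]
    have hi' := mem_cells.1 hi
    refine Set.Icc_subset_Icc (fun d => ?_) (fun d => ?_)
    · have : (1 : ℝ) ≤ i d := by exact_mod_cast (hi' d).1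
      exact mul_nonneg (by linarith) hh.le
    · have : (i d : ℝ) ≤ N d := by exact_mod_cast (hi' d).2
      simp only [← hNd d]
      exact mul_le_mul_of_nonneg_right this hh.le
  have hterm : ∀ i ∈ cells N, |h ^ 3 * gridProj N h v i
      - ∫ x in Metric.closedBall (cellCenter h i) (h / 2), v x| ≤ 9 * K * h ^ 5 := by
    intro i hi
    have t := hv.abs_setIntegral_sub_le hL (half_pos hh).le (hsub i hi)
    have hint : IntegrableOn v (Metric.closedBall (cellCenter h i) (h / 2)) :=
      hvint.mono_set (hsub i hi)
    rw [integral_sub hint (integrableOn_const (isCompact_closedBall _ _).measure_lt_top.ne),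
      setIntegral_const, Measure.real, Real.volume_pi_closedBall _ (half_pos hh).le,
      ENNReal.toReal_ofReal (by positivity), Fintype.card_fin, smul_eq_mul,
      show 2 * (h / 2) = h by ring, abs_sub_comm] at t
    rw [gridProj_of_mem hi]
    refine t.trans ?_
    have : 0 ≤ K * h ^ 5 := by positivity
    nlinarith
  refine (Finset.abs_sum_le_sum_abs _ _).trans ((Finset.sum_le_sum hterm).trans (le_of_eq ?_))
  rw [Finset.sum_const, nsmul_eq_mul, ← card_cells_mul_pow hNd]
  ring

/-! ### A function with integrable weak second derivative is Lipschitz -/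

/-- A smooth ramp: it vanishes on the negative axis and has slope one beyond `δ`. -/
def smoothRamp (δ r : ℝ) : ℝ := ∫ x in (0 : ℝ)..r, Real.smoothTransition (x / δ)

/-- The second derivative of `smoothRamp δ`, a mollifier supported in `[0, δ]`. -/
def rampKernel (δ r : ℝ) : ℝ := deriv Real.smoothTransition (r / δ) / δ

theorem contDiff_smoothTransition_div (δ : ℝ) :
    ContDiff ℝ ∞ (fun x => Real.smoothTransition (x / δ)) :=
  Real.smoothTransition.contDiff.comp (contDiff_id.div_const δ)

theorem hasDerivAt_smoothRamp (δ r : ℝ) :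
    HasDerivAt (smoothRamp δ) (Real.smoothTransition (r / δ)) r :=
  ((contDiff_smoothTransition_div δ).continuous.integral_hasStrictDerivAt 0 r).hasDerivAt

theorem hasDerivAt_smoothTransition_div (δ r : ℝ) :
    HasDerivAt (fun x => Real.smoothTransition (x / δ)) (rampKernel δ r) r := by
  have h1 : HasDerivAt Real.smoothTransition (deriv Real.smoothTransition (r / δ)) (r / δ) :=
    ((Real.smoothTransition.contDiff (n := 1)).differentiable (by norm_num) _).hasDerivAt
  have h2 := h1.comp r ((hasDerivAt_id r).div_const δ)
  refine h2.congr_deriv ?_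
  rw [rampKernel]; ring

theorem contDiff_smoothRamp (δ : ℝ) : ContDiff ℝ ∞ (smoothRamp δ) := by
  rw [contDiff_infty_iff_deriv]
  refine ⟨fun r => (hasDerivAt_smoothRamp δ r).differentiableAt, ?_⟩
  rw [show deriv (smoothRamp δ) = fun x => Real.smoothTransition (x / δ) from
    funext fun r => (hasDerivAt_smoothRamp δ r).deriv]
  exact contDiff_smoothTransition_div δ

theorem smoothRamp_of_nonpos {δ r : ℝ} (hδ : 0 < δ) (hr : r ≤ 0) : smoothRamp δ r = 0 := by
  rw [smoothRamp, intervalIntegral.integral_symm, neg_eq_zero]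
  rw [intervalIntegral.integral_congr (g := fun _ => 0)]
  · simp
  · intro x hx
    rw [Set.uIcc_of_le hr] at hx
    exact Real.smoothTransition.zero_of_nonpos (div_nonpos_of_nonpos_of_nonneg hx.2 hδ.le)

theorem smoothRamp_sub_mem (δ : ℝ) {x y : ℝ} (hxy : x ≤ y) :
    smoothRamp δ y - smoothRamp δ x ∈ Set.Icc 0 (y - x) := by
  have hc : ∀ a b, IntervalIntegrable (fun x => Real.smoothTransition (x / δ)) volume a b :=
    fun a b => (contDiff_smoothTransition_div δ).continuous.intervalIntegrable a b
  rw [smoothRamp, smoothRamp, intervalIntegral.integral_interval_sub_left (hc _ _) (hc _ _)]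
  constructor
  · exact intervalIntegral.integral_nonneg hxy fun _ _ => Real.smoothTransition.nonneg _
  · have := intervalIntegral.integral_mono_on hxy (hc x y)
      (intervalIntegrable_const (c := (1 : ℝ))) fun r _ => Real.smoothTransition.le_one (r / δ)
    simpa using this

theorem smoothRamp_sub_eq {δ x y : ℝ} (hδ : 0 < δ) (hx : δ ≤ x) (hxy : x ≤ y) :
    smoothRamp δ y - smoothRamp δ x = y - x := by
  have hc : ∀ a b, IntervalIntegrable (fun x => Real.smoothTransition (x / δ)) volume a b :=
    fun a b => (contDiff_smoothTransition_div δ).continuous.intervalIntegrable a b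
  rw [smoothRamp, smoothRamp, intervalIntegral.integral_interval_sub_left (hc _ _) (hc _ _)]
  rw [intervalIntegral.integral_congr (g := fun _ => 1)]
  · simp
  · intro r hr
    rw [Set.uIcc_of_le hxy] at hr
    exact Real.smoothTransition.one_of_one_le ((one_le_div hδ).2 (hx.trans hr.1))

theorem continuous_rampKernel (δ : ℝ) : Continuous (rampKernel δ) :=
  (((Real.smoothTransition.contDiff (n := 1)).continuous_deriv (by norm_num)).comp
    (continuous_id.div_const δ)).div_const δ

theorem rampKernel_nonneg {δ : ℝ} (hδ : 0 < δ) (r : ℝ) : 0 ≤ rampKernel δ r :=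
  div_nonneg Real.smoothTransition.monotone.deriv_nonneg hδ.le

theorem rampKernel_eq_zero {δ r : ℝ} (hδ : 0 < δ) (hr : r < 0 ∨ δ < r) : rampKernel δ r = 0 := by
  rw [rampKernel, div_eq_zero_iff]
  left
  rcases hr with hr | hr
  · have : Real.smoothTransition =ᶠ[nhds (r / δ)] fun _ => 0 := by
      filter_upwards [Iio_mem_nhds (div_neg_of_neg_of_pos hr hδ)] with x hx
      exact Real.smoothTransition.zero_of_nonpos (le_of_lt hx)
    rw [this.deriv_eq, deriv_const]
  · have : Real.smoothTransition =ᶠ[nhds (r / δ)] fun _ => 1 := by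
      filter_upwards [Ioi_mem_nhds ((one_lt_div hδ).2 hr)] with x hx
      exact Real.smoothTransition.one_of_one_le (le_of_lt hx)
    rw [this.deriv_eq, deriv_const]

/-- Averages against the mollifier are close to point values. -/
theorem abs_setIntegral_rampKernel_sub_le {T : ℝ} {u : ℝ → ℝ}
    (hu : ContinuousOn u (Set.Icc 0 T)) {a δ θ : ℝ} (hδ : 0 < δ) (ha : 0 < a) (haT : a + δ < T)
    (hθ : ∀ r ∈ Set.Icc a (a + δ), |u r - u a| ≤ θ) :
    |(∫ r in Set.Ioo 0 T, rampKernel δ (r - a) * u r) - u a| ≤ θ := by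
  have hsub : Set.Icc a (a + δ) ⊆ Set.Ioo 0 T := fun r hr =>
    ⟨ha.trans_le hr.1, hr.2.trans_lt haT⟩
  have hκ : Continuous fun r => rampKernel δ (r - a) :=
    (continuous_rampKernel δ).comp (continuous_id.sub continuous_const)
  have hu' : ContinuousOn u (Set.Icc a (a + δ)) := hu.mono (hsub.trans Set.Ioo_subset_Icc_self)
  have e1 : ∫ r in Set.Ioo 0 T, rampKernel δ (r - a) * u r
      = ∫ r in Set.Icc a (a + δ), rampKernel δ (r - a) * u r := by
    refine setIntegral_eq_of_subset_of_forall_sdiff_eq_zero measurableSet_Ioo hsub fun r hr => ?_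
    have : r - a < 0 ∨ δ < r - a := by
      by_contra hcon
      push Not at hcon
      exact hr.2 ⟨by linarith, by linarith⟩
    rw [rampKernel_eq_zero hδ this, zero_mul]
  have e2 : ∫ r in Set.Icc a (a + δ), rampKernel δ (r - a) = 1 := by
    rw [integral_Icc_eq_integral_Ioc, ← intervalIntegral.integral_of_le (by linarith),
      intervalIntegral.integral_eq_sub_of_hasDerivAt
        (fun r _ => (hasDerivAt_smoothTransition_div δ (r - a)).comp_sub_const r a)
        (hκ.intervalIntegrable _ _)]
    simp [div_self hδ.ne']
  have i1 : IntegrableOn (fun r => rampKernel δ (r - a)) (Set.Icc a (a + δ)) :=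
    hκ.continuousOn.integrableOn_compact isCompact_Icc
  have i2 : IntegrableOn (fun r => rampKernel δ (r - a) * u r) (Set.Icc a (a + δ)) :=
    (hκ.continuousOn.mul hu').integrableOn_compact isCompact_Icc
  have e3 : (∫ r in Set.Icc a (a + δ), rampKernel δ (r - a) * u r) - u a
      = ∫ r in Set.Icc a (a + δ), rampKernel δ (r - a) * (u r - u a) := by
    simp only [mul_sub]
    rw [integral_sub i2 (i1.mul_const _), integral_mul_const, e2, one_mul]
  rw [e1, e3, ← Real.norm_eq_abs]
  have := norm_integral_le_of_norm_le (i1.mul_const θ)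
    ((ae_restrict_iff' measurableSet_Icc).2 (Filter.Eventually.of_forall fun r hr => by
      rw [norm_mul, Real.norm_of_nonneg (rampKernel_nonneg hδ _)]
      exact mul_le_mul_of_nonneg_left (hθ r hr) (rampKernel_nonneg hδ _)) :
      ∀ᵐ r ∂volume.restrict (Set.Icc a (a + δ)),
        ‖rampKernel δ (r - a) * (u r - u a)‖ ≤ rampKernel δ (r - a) * θ)
  rwa [integral_mul_const, e2, one_mul] at this

/-- A smooth approximation of the hat function with corners `a < b < c`, divided by its height. -/
def smoothHat (δ a b c r : ℝ) : ℝ :=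
  (smoothRamp δ (r - a) - smoothRamp δ (r - b)) / (b - a)
    - (smoothRamp δ (r - b) - smoothRamp δ (r - c)) / (c - b)

theorem contDiff_smoothHat (δ a b c : ℝ) : ContDiff ℝ ∞ (smoothHat δ a b c) := by
  have h : ∀ x, ContDiff ℝ ∞ (fun r => smoothRamp δ (r - x)) :=
    fun x => (contDiff_smoothRamp δ).comp (contDiff_id.sub contDiff_const)
  exact (((h a).sub (h b)).div_const _).sub (((h b).sub (h c)).div_const _)

theorem iteratedDeriv_two_smoothHat (δ a b c : ℝ) :
    iteratedDeriv 2 (smoothHat δ a b c) = fun r =>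
      (rampKernel δ (r - a) - rampKernel δ (r - b)) / (b - a)
        - (rampKernel δ (r - b) - rampKernel δ (r - c)) / (c - b) := by
  have h1 : ∀ x r, HasDerivAt (fun r => smoothRamp δ (r - x))
      (Real.smoothTransition ((r - x) / δ)) r :=
    fun x r => (hasDerivAt_smoothRamp δ (r - x)).comp_sub_const r x
  have h2 : ∀ x r, HasDerivAt (fun r => Real.smoothTransition ((r - x) / δ))
      (rampKernel δ (r - x)) r :=
    fun x r => (hasDerivAt_smoothTransition_div δ (r - x)).comp_sub_const r x
  rw [iteratedDeriv_succ, iteratedDeriv_one]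
  have e1 : deriv (smoothHat δ a b c) = fun r =>
      (Real.smoothTransition ((r - a) / δ) - Real.smoothTransition ((r - b) / δ)) / (b - a)
        - (Real.smoothTransition ((r - b) / δ) - Real.smoothTransition ((r - c) / δ)) / (c - b) :=
    funext fun r => ((((h1 a r).sub (h1 b r)).div_const _).sub
      (((h1 b r).sub (h1 c r)).div_const _)).deriv
  rw [e1]
  exact funext fun r => ((((h2 a r).sub (h2 b r)).div_const _).sub
    (((h2 b r).sub (h2 c r)).div_const _)).deriv

theorem abs_smoothHat_le (δ : ℝ) {a b c : ℝ} (hab : a < b) (hbc : b < c) (r : ℝ) :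
    |smoothHat δ a b c r| ≤ 1 := by
  have h1 := smoothRamp_sub_mem δ (sub_le_sub_left hab.le r)
  have h2 := smoothRamp_sub_mem δ (sub_le_sub_left hbc.le r)
  rw [show r - a - (r - b) = b - a by ring] at h1
  rw [show r - b - (r - c) = c - b by ring] at h2
  have p1 := div_nonneg h1.1 (sub_pos.2 hab).le
  have p2 := div_nonneg h2.1 (sub_pos.2 hbc).le
  have q1 := (div_le_one (sub_pos.2 hab)).2 h1.2
  have q2 := (div_le_one (sub_pos.2 hbc)).2 h2.2
  rw [smoothHat, abs_le]
  constructor <;> linarith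

theorem tsupport_smoothHat_subset {δ a b c : ℝ} (hδ : 0 < δ) (hab : a < b) (hbc : b < c) :
    tsupport (smoothHat δ a b c) ⊆ Set.Icc a (c + δ) := by
  refine closure_minimal (fun r hr => ?_) isClosed_Icc
  by_contra hcon
  refine hr ?_
  rw [Set.mem_Icc, not_and_or, not_le, not_le] at hcon
  rcases hcon with h | h
  · simp only [smoothHat]
    rw [smoothRamp_of_nonpos hδ (by linarith), smoothRamp_of_nonpos hδ (by linarith),
      smoothRamp_of_nonpos hδ (by linarith)]
    simp
  · simp only [smoothHat]
    rw [smoothRamp_sub_eq hδ (by linarith) (by linarith),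
      smoothRamp_sub_eq hδ (by linarith) (by linarith),
      show r - a - (r - b) = b - a by ring, show r - b - (r - c) = c - b by ring,
      div_self (sub_pos.2 hab).ne', div_self (sub_pos.2 hbc).ne', sub_self]

/-- `g` is the weak second derivative of `u` on `(0,T)`. -/
def IsWeakSecondDeriv (T : ℝ) (u g : ℝ → ℝ) : Prop :=
  ∀ ψ : ℝ → ℝ, ContDiff ℝ ∞ ψ → HasCompactSupport ψ → tsupport ψ ⊆ Set.Ioo 0 T →
    ∫ t in Set.Ioo 0 T, iteratedDeriv 2 ψ t * u t = ∫ t in Set.Ioo 0 T, ψ t * g t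

/-- Consecutive slopes of a function differ by at most the `L¹` norm of its weak second
derivative: the second divided difference is the pairing with a hat function. -/
theorem IsWeakSecondDeriv.abs_slope_sub_le {T : ℝ} {u g : ℝ → ℝ}
    (hu : ContinuousOn u (Set.Icc 0 T)) (hg : IntegrableOn g (Set.Ioo 0 T))
    (hw : IsWeakSecondDeriv T u g) {a b c : ℝ} (ha : 0 < a) (hab : a < b) (hbc : b < c)
    (hcT : c < T) :
    |(u b - u a) / (b - a) - (u c - u b) / (c - b)| ≤ ∫ t in Set.Ioo 0 T, |g t| := by
  have hba := sub_pos.2 hab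
  have hcb := sub_pos.2 hbc
  refine le_of_forall_pos_le_add fun ε hε => ?_
  set S := 1 / (b - a) + 1 / (c - b) with hS
  have hS0 : 0 < S := by positivity
  set θ := ε / (2 * S) with hθdef
  have hθ0 : 0 < θ := by positivity
  have near : ∀ x, 0 < x → x < T → ∃ δ > 0, ∀ r, |r - x| < δ → |u r - u x| < θ := by
    intro x hx hxT
    have := Metric.continuousAt_iff.1 (hu.continuousAt (Icc_mem_nhds hx hxT)) θ hθ0
    obtain ⟨δ, hδ, h⟩ := this
    exact ⟨δ, hδ, fun r hr => h hr⟩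
  obtain ⟨δa, hδa, na⟩ := near a ha (by linarith)
  obtain ⟨δb, hδb, nb⟩ := near b (by linarith) (by linarith)
  obtain ⟨δc, hδc, nc⟩ := near c (by linarith) hcT
  set δ := min (min δa δb) (min δc (T - c)) / 2 with hδdef
  have hm : 0 < min (min δa δb) (min δc (T - c)) :=
    lt_min (lt_min hδa hδb) (lt_min hδc (sub_pos.2 hcT))
  have hδ : 0 < δ := half_pos hm
  have hδm : δ < min (min δa δb) (min δc (T - c)) := half_lt_self hm
  have ka : δ < δa := hδm.trans_le ((min_le_left _ _).trans (min_le_left _ _))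
  have kb : δ < δb := hδm.trans_le ((min_le_left _ _).trans (min_le_right _ _))
  have kc : δ < δc := hδm.trans_le ((min_le_right _ _).trans (min_le_left _ _))
  have kT : δ < T - c := hδm.trans_le ((min_le_right _ _).trans (min_le_right _ _))
  have pt : ∀ x δ', 0 < x → x ≤ c → δ < δ' → (∀ r, |r - x| < δ' → |u r - u x| < θ) →
      |(∫ r in Set.Ioo 0 T, rampKernel δ (r - x) * u r) - u x| ≤ θ := by
    intro x δ' hx hxc hk hn
    refine abs_setIntegral_rampKernel_sub_le hu hδ hx (by linarith) fun r hr => (hn r ?_).le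
    rw [abs_of_nonneg (by linarith [hr.1])]
    linarith [hr.2]
  have qa := pt a δa ha (by linarith) ka na
  have qb := pt b δb (by linarith) (by linarith) kb nb
  have qc := pt c δc (by linarith) le_rfl kc nc
  have hsupp : tsupport (smoothHat δ a b c) ⊆ Set.Icc a (c + δ) :=
    tsupport_smoothHat_subset hδ hab hbc
  have hweak := hw (smoothHat δ a b c) (contDiff_smoothHat δ a b c)
    (isCompact_Icc.of_isClosed_subset (isClosed_tsupport _) hsupp)
    (hsupp.trans fun r hr => ⟨ha.trans_le hr.1, hr.2.trans_lt (by linarith)⟩)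
  simp only [iteratedDeriv_two_smoothHat] at hweak
  have int : ∀ x, IntegrableOn (fun r => rampKernel δ (r - x) * u r) (Set.Ioo 0 T) := by
    intro x
    have hκ : Continuous fun r => rampKernel δ (r - x) :=
      (continuous_rampKernel δ).comp (continuous_id.sub continuous_const)
    exact ((hκ.continuousOn.mul hu).integrableOn_compact isCompact_Icc).mono_set
      Set.Ioo_subset_Icc_self
  have int2 : ∀ x y k, IntegrableOn
      (fun r => (rampKernel δ (r - x) * u r - rampKernel δ (r - y) * u r) / k) (Set.Ioo 0 T) :=
    fun x y k => ((int x).sub (int y)).div_const k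
  have elin : ∫ r in Set.Ioo 0 T, ((rampKernel δ (r - a) - rampKernel δ (r - b)) / (b - a)
        - (rampKernel δ (r - b) - rampKernel δ (r - c)) / (c - b)) * u r
      = ((∫ r in Set.Ioo 0 T, rampKernel δ (r - a) * u r)
          - ∫ r in Set.Ioo 0 T, rampKernel δ (r - b) * u r) / (b - a)
        - ((∫ r in Set.Ioo 0 T, rampKernel δ (r - b) * u r)
          - ∫ r in Set.Ioo 0 T, rampKernel δ (r - c) * u r) / (c - b) := by
    rw [← integral_sub (int a) (int b), ← integral_sub (int b) (int c), ← integral_div,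
      ← integral_div, ← integral_sub (int2 a b _) (int2 b c _)]
    congr 1
    funext r
    ring
  rw [elin] at hweak
  have hbound : |∫ t in Set.Ioo 0 T, smoothHat δ a b c t * g t|
      ≤ ∫ t in Set.Ioo 0 T, |g t| := by
    rw [← Real.norm_eq_abs]
    refine norm_integral_le_of_norm_le hg.abs (Filter.Eventually.of_forall fun t => ?_)
    rw [norm_mul, Real.norm_eq_abs, Real.norm_eq_abs]
    exact mul_le_of_le_one_left (abs_nonneg _) (abs_smoothHat_le δ hab hbc t)
  rw [← hweak] at hbound
  set A := ∫ r in Set.Ioo 0 T, rampKernel δ (r - a) * u r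
  set B := ∫ r in Set.Ioo 0 T, rampKernel δ (r - b) * u r
  set C := ∫ r in Set.Ioo 0 T, rampKernel δ (r - c) * u r
  have e : (u b - u a) / (b - a) - (u c - u b) / (c - b)
      = -((A - B) / (b - a) - (B - C) / (c - b))
        + (((A - u a) - (B - u b)) / (b - a) - ((B - u b) - (C - u c)) / (c - b)) := by
    ring
  have b1 : |((A - u a) - (B - u b)) / (b - a)| ≤ 2 * θ * (1 / (b - a)) := by
    rw [abs_div, abs_of_pos hba, mul_one_div]
    exact div_le_div_of_nonneg_right ((abs_sub _ _).trans (by linarith)) hba.le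
  have b2 : |((B - u b) - (C - u c)) / (c - b)| ≤ 2 * θ * (1 / (c - b)) := by
    rw [abs_div, abs_of_pos hcb, mul_one_div]
    exact div_le_div_of_nonneg_right ((abs_sub _ _).trans (by linarith)) hcb.le
  have hε' : 2 * θ * (1 / (b - a)) + 2 * θ * (1 / (c - b)) = ε := by
    rw [← mul_add, ← hS, hθdef]
    field_simp
  rw [e]
  refine (abs_add_le _ _).trans (add_le_add (by rwa [abs_neg]) ?_)
  exact (abs_sub _ _).trans (by linarith)

/-- A bounded function with integrable weak second derivative is Lipschitz. -/
theorem IsWeakSecondDeriv.abs_sub_le {T B : ℝ} (hT : 0 < T) {u g : ℝ → ℝ}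
    (hu : ContinuousOn u (Set.Icc 0 T)) (hB : ∀ t ∈ Set.Icc 0 T, |u t| ≤ B)
    (hg : IntegrableOn g (Set.Ioo 0 T)) (hw : IsWeakSecondDeriv T u g)
    {s t : ℝ} (hs : s ∈ Set.Ioo 0 T) (ht : t ∈ Set.Ioo 0 T) :
    |u t - u s| ≤ ((∫ r in Set.Ioo 0 T, |g r|) + 8 * B / T) * |t - s| := by
  set Λ := (∫ r in Set.Ioo 0 T, |g r|) + 8 * B / T with hΛ
  have hchord : ∀ x y, x ∈ Set.Icc 0 T → y ∈ Set.Icc 0 T → T / 4 ≤ y - x →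
      |(u y - u x) / (y - x)| ≤ 8 * B / T := by
    intro x y hx hy hxy
    have h1 : |u y - u x| ≤ 2 * B := (abs_sub _ _).trans (by linarith [hB x hx, hB y hy])
    have h2 : 0 < y - x := by linarith
    rw [abs_div, abs_of_pos h2, div_le_div_iff₀ h2 hT]
    have h0 : 0 ≤ B := (abs_nonneg _).trans (hB x hx)
    nlinarith
  have left : ∀ x y, 0 < x → x < y → y ≤ T / 2 → |u y - u x| ≤ Λ * (y - x) := by
    intro x y hx hxy hy
    have h1 := hw.abs_slope_sub_le hu hg hx hxy (c := 3 * T / 4) (by linarith) (by linarith)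
    have h2 := hchord y (3 * T / 4) ⟨by linarith, by linarith⟩ ⟨by linarith, by linarith⟩
      (by linarith)
    have h3 : |(u y - u x) / (y - x)| ≤ Λ := by
      rw [abs_le] at h1 h2 ⊢
      constructor <;> linarith
    rwa [abs_div, abs_of_pos (sub_pos.2 hxy), div_le_iff₀ (sub_pos.2 hxy)] at h3
  have right : ∀ x y, T / 2 ≤ x → x < y → y < T → |u y - u x| ≤ Λ * (y - x) := by
    intro x y hx hxy hy
    have h1 := hw.abs_slope_sub_le hu hg (a := T / 4) (by linarith) (b := x) (by linarith) hxy hy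
    have h2 := hchord (T / 4) x ⟨by linarith, by linarith⟩ ⟨by linarith, by linarith⟩
      (by linarith)
    have h3 : |(u y - u x) / (y - x)| ≤ Λ := by
      rw [abs_le] at h1 h2 ⊢
      constructor <;> linarith
    rwa [abs_div, abs_of_pos (sub_pos.2 hxy), div_le_iff₀ (sub_pos.2 hxy)] at h3
  wlog hst : s < t generalizing s t
  · rcases eq_or_lt_of_le (not_lt.1 hst) with h | h
    · simp [h]
    · rw [abs_sub_comm, abs_sub_comm t s]; exact this ht hs h
  rw [abs_of_pos (sub_pos.2 hst)]
  rcases le_or_gt t (T / 2) with h1 | h1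
  · exact left s t hs.1 hst h1
  rcases le_or_gt (T / 2) s with h2 | h2
  · exact right s t h2 hst ht.2
  have h3 := left s (T / 2) hs.1 h2 le_rfl
  have h4 := right (T / 2) t le_rfl h1 ht.2
  rw [abs_le] at h3 h4 ⊢
  constructor <;> linarith

/-! ### Conservation of mass for the exact solution -/

/-- The exact solution is Lipschitz in time, uniformly in space. -/
theorem RegularityClass.exists_lipschitz {L : Fin 3 → ℝ} {T : ℝ} (hT : 0 < T)
    {φ : ℝ → (Fin 3 → ℝ) → ℝ} (hφ : RegularityClass L T φ) :
    ∃ Λ : ℝ, ∀ x ∈ closedBox L, ∀ s ∈ Set.Ioo 0 T, ∀ t ∈ Set.Ioo 0 T,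
      |φ t x - φ s x| ≤ Λ * |t - s| := by
  obtain ⟨B, hB⟩ := (isCompact_Icc.prod isCompact_Icc).exists_bound_of_continuousOn hφ.cont
  obtain ⟨F, hF, hFS⟩ := hφ.memH3C0.2 [] (by simp)
  obtain ⟨G, hG, hweak⟩ := hFS.2 2 (by norm_num)
  have hFi : Integrable F (volume.restrict (Set.Ioo 0 T)) := hFS.1.integrable one_le_two
  have hGi : Integrable G (volume.restrict (Set.Ioo 0 T)) := hG.integrable one_le_two
  refine ⟨(∫ r in Set.Ioo 0 T, ‖G r‖) + 8 * B / T, fun x hx s hs t ht => ?_⟩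
  set E : C(closedBox L, ℝ) →L[ℝ] ℝ := ContinuousMap.evalCLM ℝ ⟨x, hx⟩ with hE
  have hEF : ∀ f : C(closedBox L, ℝ), E f = f ⟨x, hx⟩ := fun _ => rfl
  have hcont : ContinuousOn (fun r => φ r x) (Set.Icc 0 T) :=
    hφ.cont.comp (continuousOn_id.prodMk continuousOn_const) fun r hr => ⟨hr, hx⟩
  have hgi : IntegrableOn (fun r => E (G r)) (Set.Ioo 0 T) := E.integrable_comp hGi
  have hw : IsWeakSecondDeriv T (fun r => φ r x) (fun r => E (G r)) := by
    intro ψ hψ hψc hψs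
    have h1 := congrArg E (hweak ψ hψ hψc hψs)
    have c2 : Continuous (iteratedDeriv 2 ψ) := hψ.continuous_iteratedDeriv 2 (by norm_cast)
    have s2 : HasCompactSupport (iteratedDeriv 2 ψ) := by
      rw [iteratedDeriv_succ, iteratedDeriv_one]
      exact hψc.deriv.deriv
    obtain ⟨C2, hC2⟩ := c2.bounded_above_of_compact_support s2
    obtain ⟨C0, hC0⟩ := hψ.continuous.bounded_above_of_compact_support hψc
    have i2 : Integrable (fun r => iteratedDeriv 2 ψ r • F r) (volume.restrict (Set.Ioo 0 T)) :=
      hFi.bdd_smul C2 c2.aestronglyMeasurable (Filter.Eventually.of_forall hC2)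
    have i0 : Integrable (fun r => ψ r • G r) (volume.restrict (Set.Ioo 0 T)) :=
      hGi.bdd_smul C0 hψ.continuous.aestronglyMeasurable (Filter.Eventually.of_forall hC0)
    rw [map_smul, ← E.integral_comp_comm i2, ← E.integral_comp_comm i0] at h1
    simp only [map_smul, smul_eq_mul] at h1
    rw [show (-1 : ℝ) ^ 2 = 1 by norm_num, one_mul] at h1
    rw [← h1]
    refine integral_congr_ae ?_
    filter_upwards [hF] with r hr
    rw [hEF, hr ⟨x, hx⟩]
    rfl
  have hlip := hw.abs_sub_le hT hcont (B := B) (fun r hr => hB (r, x) ⟨hr, hx⟩) hgi hs ht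
  refine hlip.trans (mul_le_mul_of_nonneg_right ?_ (abs_nonneg _))
  refine add_le_add_left (integral_mono hgi.abs hGi.norm fun r => ?_) _
  exact ContinuousMap.norm_coe_le_norm (G r) ⟨x, hx⟩

/-- The divergence theorem on the box for a field without normal component on the boundary. -/
theorem setIntegral_sum_pd_eq_zero {L : Fin 3 → ℝ} (hL : ∀ d, 0 < L d)
    {V : Fin 3 → (Fin 3 → ℝ) → ℝ} (hV : ∀ d, ContDiffOn ℝ 1 (V d) (closedBox L))
    (hV0 : ∀ d, ∀ x ∈ closedBox L, (x d = 0 ∨ x d = L d) → V d x = 0) :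
    ∫ x in closedBox L, ∑ d, pd L d (V d) x = 0 := by
  have hle : (0 : Fin 3 → ℝ) ≤ L := fun d => (hL d).le
  have hint : IntegrableOn (fun x => ∑ d, pd L d (V d) x) (closedBox L) := by
    refine ContinuousOn.integrableOn_compact isCompact_Icc ?_
    exact continuousOn_finsetSum _ fun d _ =>
      (contDiffOn_pd hL d (n := 0) (by simpa using hV d)).continuousOn
  have hdiv := integral_divergence_of_hasFDerivAt_off_countable' (n := 2) (0 : Fin 3 → ℝ) L hle V
    (fun d x => fderivWithin ℝ (V d) (closedBox L) x) ∅ Set.countable_empty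
    (fun d => (hV d).continuousOn)
    (fun x hx d => by
      refine ((hV d).differentiableOn (by norm_num) x ?_).hasFDerivWithinAt.hasFDerivAt ?_
      · exact ⟨fun e => (hx.1 e trivial).1.le, fun e => (hx.1 e trivial).2.le⟩
      · rw [closedBox, ← Set.pi_univ_Icc]
        exact set_pi_mem_nhds Set.finite_univ fun e _ =>
          Icc_mem_nhds (hx.1 e trivial).1 (hx.1 e trivial).2)
    hint
  refine hdiv.trans (Finset.sum_eq_zero fun d _ => ?_)
  have hface : ∀ c, (c = 0 ∨ c = L d) →
      ∫ x in Set.Icc ((0 : Fin 3 → ℝ) ∘ d.succAbove) (L ∘ d.succAbove), V d (d.insertNth c x)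
        = 0 := by
    intro c hc
    refine setIntegral_eq_zero_of_forall_eq_zero fun x hx => hV0 d _ ?_ (by simpa using hc)
    have hc' : c ∈ Set.Icc 0 (L d) := by
      rcases hc with rfl | rfl
      · exact ⟨le_rfl, (hL d).le⟩
      · exact ⟨(hL d).le, le_rfl⟩
    exact Fin.insertNth_mem_Icc.2 ⟨hc', hx⟩
  rw [hface _ (Or.inr rfl), hface ((0 : Fin 3 → ℝ) d) (Or.inl rfl), sub_zero]

theorem contDiffOn_chemPot {L : Fin 3 → ℝ} (hL : ∀ d, 0 < L d) (ε : ℝ) {f : (Fin 3 → ℝ) → ℝ}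
    (hf : ContDiffOn ℝ 4 f (closedBox L)) : ContDiffOn ℝ 2 (chemPot L ε f) (closedBox L) := by
  have h2 : ContDiffOn ℝ 2 f (closedBox L) := hf.of_le (by norm_cast)
  have hlap : ContDiffOn ℝ 2 (contLap L f) (closedBox L) :=
    ContDiffOn.sum fun d _ => contDiffOn_iterPd hL [d, d] 2 (by simpa using hf)
  exact ((h2.pow 3).sub h2).sub (contDiffOn_const.mul hlap)

/-- The right-hand side of the evolution equation is a divergence of a field without normal
component on the boundary; so it is continuous and has integral zero. -/
theorem IsExactSolution.rate_continuousOn_and_integral {L : Fin 3 → ℝ} (hL : ∀ d, 0 < L d)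
    {T ε γ : ℝ} {φ p : ℝ → (Fin 3 → ℝ) → ℝ} (hsol : IsExactSolution L T ε γ φ p) {t : ℝ}
    (ht : t ∈ Set.Ioo 0 T) :
    ContinuousOn (fun x => contLap L (chemPot L ε (φ t)) x
        - ∑ d, pd L d (fun y => φ t y * darcyVel L ε γ (φ t) (p t) d y) x) (closedBox L)
      ∧ ∫ x in closedBox L, (contLap L (chemPot L ε (φ t)) x
        - ∑ d, pd L d (fun y => φ t y * darcyVel L ε γ (φ t) (p t) d y) x) = 0 := by
  have hφ4 := hsol.smooth_phi t ⟨ht.1.le, ht.2.le⟩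
  have hφ1 : ContDiffOn ℝ 1 (φ t) (closedBox L) := hφ4.of_le (by norm_cast)
  have hp := hsol.smooth_p t ⟨ht.1, ht.2.le⟩
  have hμ := contDiffOn_chemPot hL ε hφ4
  have hdμ : ∀ d, ContDiffOn ℝ 1 (pd L d (chemPot L ε (φ t))) (closedBox L) :=
    fun d => contDiffOn_pd hL d (n := 1) (by simpa using hμ)
  have hdp : ∀ d, ContDiffOn ℝ 1 (pd L d (p t)) (closedBox L) :=
    fun d => contDiffOn_pd hL d (n := 1) (by simpa using hp)
  have hflux : ∀ d, ContDiffOn ℝ 1 (fun y => φ t y * darcyVel L ε γ (φ t) (p t) d y)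
      (closedBox L) := fun d =>
    hφ1.mul ((hdp d).neg.sub ((contDiffOn_const.mul hφ1).mul (hdμ d)))
  set V : Fin 3 → (Fin 3 → ℝ) → ℝ := fun d y =>
    pd L d (chemPot L ε (φ t)) y - φ t y * darcyVel L ε γ (φ t) (p t) d y with hVdef
  have hV : ∀ d, ContDiffOn ℝ 1 (V d) (closedBox L) := fun d => (hdμ d).sub (hflux d)
  have hV0 : ∀ d, ∀ x ∈ closedBox L, (x d = 0 ∨ x d = L d) → V d x = 0 := by
    intro d x hx hxd
    obtain ⟨-, h2, h3⟩ := hsol.boundary t ⟨ht.1, ht.2.le⟩ d x hx hxd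
    simp only [hVdef, darcyVel, h2, h3]
    ring
  have heq : Set.EqOn (fun x => contLap L (chemPot L ε (φ t)) x
      - ∑ d, pd L d (fun y => φ t y * darcyVel L ε γ (φ t) (p t) d y) x)
      (fun x => ∑ d, pd L d (V d) x) (closedBox L) := by
    intro x hx
    simp only [contLap, ← Finset.sum_sub_distrib]
    refine Finset.sum_congr rfl fun d _ => ?_
    have h1 := ((hdμ d).differentiableOn (by norm_num) x hx)
    have h2 := ((hflux d).differentiableOn (by norm_num) x hx)
    have h3 := fderivWithin_sub (uniqueDiffOn_closedBox hL x hx) h1 h2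
    change _ = fderivWithin ℝ (V d) (closedBox L) x (Pi.single d 1)
    have h4 : V d = pd L d (chemPot L ε (φ t))
      - fun y => φ t y * darcyVel L ε γ (φ t) (p t) d y := rfl
    rw [h4, h3]
    rfl
  constructor
  · refine ContinuousOn.congr ?_ heq
    exact continuousOn_finsetSum _ fun d _ =>
      (contDiffOn_pd hL d (n := 0) (by simpa using hV d)).continuousOn
  · rw [setIntegral_congr_fun measurableSet_Icc heq]
    exact setIntegral_sum_pd_eq_zero hL hV hV0

theorem RegularityClass.continuousOn_integral {L : Fin 3 → ℝ} {T : ℝ}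
    {φ : ℝ → (Fin 3 → ℝ) → ℝ} (hφ : RegularityClass L T φ) :
    ContinuousOn (fun t => ∫ x in closedBox L, φ t x) (Set.Icc 0 T) := by
  obtain ⟨B, hB⟩ := (isCompact_Icc.prod isCompact_Icc).exists_bound_of_continuousOn hφ.cont
  have hx : ∀ t ∈ Set.Icc 0 T, ContinuousOn (φ t) (closedBox L) := fun t ht =>
    hφ.cont.comp (continuousOn_const.prodMk continuousOn_id) fun x hx => ⟨ht, hx⟩
  refine continuousOn_of_dominated (bound := fun _ => B)
    (fun t ht => (hx t ht).aestronglyMeasurable measurableSet_Icc)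
    (fun t ht => (ae_restrict_iff' measurableSet_Icc).2
      (Filter.Eventually.of_forall fun x hx => hB (t, x) ⟨ht, hx⟩))
    (integrableOn_const (isCompact_Icc.measure_lt_top.ne))
    ((ae_restrict_iff' measurableSet_Icc).2 (Filter.Eventually.of_forall fun x hx =>
      hφ.cont.comp (continuousOn_id.prodMk continuousOn_const) fun r hr => ⟨hr, hx⟩))

/-- The mass of the exact solution is conserved. -/
theorem IsExactSolution.integral_eq {L : Fin 3 → ℝ} (hL : ∀ d, 0 < L d) {T ε γ : ℝ} (hT : 0 < T)
    {φ p : ℝ → (Fin 3 → ℝ) → ℝ} (hsol : IsExactSolution L T ε γ φ p)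
    (hreg : RegularityClass L T φ) {s t : ℝ} (hs : s ∈ Set.Icc 0 T) (ht : t ∈ Set.Icc 0 T) :
    ∫ x in closedBox L, φ s x = ∫ x in closedBox L, φ t x := by
  obtain ⟨Λ, hΛ⟩ := hreg.exists_lipschitz hT
  have hint : ∀ t ∈ Set.Icc 0 T, ContinuousOn (φ t) (closedBox L) := fun t ht =>
    (hsol.smooth_phi t ht).continuousOn
  have hder : ∀ t ∈ Set.Ioo 0 T, HasDerivAt (fun r => ∫ x in closedBox L, φ r x) 0 t := by
    intro t ht
    obtain ⟨hc, h0⟩ := hsol.rate_continuousOn_and_integral hL ht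
    rw [← h0]
    have hbox : ∀ᵐ x ∂volume.restrict (closedBox L), x ∈ openBox L := by
      have e : (Set.pi univ fun d => Set.Ioo (0 : ℝ) (L d)) =ᵐ[volume] closedBox L :=
        Measure.univ_pi_Ioo_ae_eq_Icc
      rw [← Measure.restrict_congr_set e]
      refine (ae_restrict_iff' (MeasurableSet.univ_pi fun _ => measurableSet_Ioo)).2
        (Filter.Eventually.of_forall fun x hx d => hx d trivial)
    refine (hasDerivAt_integral_of_dominated_loc_of_lip (bound := fun _ => Λ)
      (Ioo_mem_nhds ht.1 ht.2) ?_
      ((hint t ⟨ht.1.le, ht.2.le⟩).integrableOn_compact isCompact_Icc)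
      (hc.aestronglyMeasurable measurableSet_Icc) ?_
      (integrableOn_const (isCompact_Icc.measure_lt_top.ne)) ?_).2
    · filter_upwards [Ioo_mem_nhds ht.1 ht.2] with r hr
      exact (hint r ⟨hr.1.le, hr.2.le⟩).aestronglyMeasurable measurableSet_Icc
    · refine (ae_restrict_iff' measurableSet_Icc).2 (Filter.Eventually.of_forall fun x hx => ?_)
      refine LipschitzOnWith.of_dist_le_mul fun r hr q hq => ?_
      rw [Real.dist_eq, Real.dist_eq, Real.coe_nnabs]
      exact (hΛ x hx q hq r hr).trans (mul_le_mul_of_nonneg_right (le_abs_self _) (abs_nonneg _))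
    · filter_upwards [hbox] with x hx
      exact hsol.evolution t ht x hx
  wlog hst : s < t generalizing s t
  · rcases eq_or_lt_of_le (not_lt.1 hst) with h | h
    · rw [h]
    · exact (this ht hs h).symm
  obtain ⟨c, -, hc⟩ := exists_hasDerivAt_eq_slope (fun r => ∫ x in closedBox L, φ r x)
    (fun _ => 0) hst (hreg.continuousOn_integral.mono (Set.Icc_subset_Icc hs.1 ht.2))
    (fun r hr => hder r ⟨hs.1.trans_lt hr.1, hr.2.trans_le ht.2⟩)
  rw [eq_comm, div_eq_zero_iff, sub_eq_zero] at hc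
  rcases hc with h | h
  · exact h.symm
  · linarith

/-! ### Uniform bounds for the exact solution on the grid -/

/-- An almost everywhere bound on a continuous function of time holds everywhere. -/
theorem le_of_ae_restrict_Ioo {T K : ℝ} (hT : 0 < T) {G : ℝ → ℝ}
    (hG : ContinuousOn G (Set.Icc 0 T)) (h : ∀ᵐ t ∂volume.restrict (Set.Ioo 0 T), G t ≤ K) :
    ∀ t ∈ Set.Icc 0 T, G t ≤ K := by
  have h' : (fun t => max (G t) K) =ᵐ[volume.restrict (Set.Icc 0 T)] fun _ => K := by
    rw [← restrict_Ioo_eq_restrict_Icc]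
    filter_upwards [h] with t ht using max_eq_right ht
  intro t ht
  have := Measure.eqOn_Icc_of_ae_eq volume hT.ne h' (hG.sup continuousOn_const)
    continuousOn_const ht
  exact max_eq_right_iff.1 this

/-- The bounds from `L^∞(0,T;C⁶)` hold at almost every time, with one constant. -/
theorem IsExactSolution.exists_ae_neumannBound {L : Fin 3 → ℝ} {T ε γ : ℝ}
    {φ p : ℝ → (Fin 3 → ℝ) → ℝ} (hsol : IsExactSolution L T ε γ φ p)
    (hreg : RegularityClass L T φ) :
    ∃ K : ℝ, ∀ᵐ t ∂volume.restrict (Set.Ioo 0 T), NeumannBound L K (φ t) := by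
  have h1 : ∀ w : List (Fin 3), ∃ K : ℝ, w.length ≤ 3 →
      ∀ᵐ t ∂volume.restrict (Set.Ioo 0 T), ∀ x ∈ closedBox L, |iterPd L w (φ t) x| ≤ K := by
    intro w
    by_cases hw : w.length ≤ 3
    · obtain ⟨F, hF, hFm⟩ := hreg.memLinftyC6.2 w (by omega)
      have hlt := hFm.2
      rw [eLpNorm_exponent_top] at hlt
      refine ⟨(eLpNormEssSup F (volume.restrict (Set.Ioo 0 T))).toReal, fun _ => ?_⟩
      filter_upwards [hF, enorm_ae_le_eLpNormEssSup F (volume.restrict (Set.Ioo 0 T))]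
        with t ht hle x hx
      rw [← ht ⟨x, hx⟩]
      refine (ContinuousMap.norm_coe_le_norm (F t) ⟨x, hx⟩).trans ?_
      rw [← toReal_enorm]
      exact ENNReal.toReal_mono hlt.ne hle
    · exact ⟨0, fun h => absurd h hw⟩
  choose Kw hKw using h1
  have hfin : {w : List (Fin 3) | w.length ≤ 3}.Finite := List.finite_length_le (Fin 3) 3
  refine ⟨∑ w ∈ hfin.toFinset, |Kw w|, ?_⟩
  have h2 : ∀ᵐ t ∂volume.restrict (Set.Ioo 0 T), ∀ w ∈ {w : List (Fin 3) | w.length ≤ 3},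
      ∀ x ∈ closedBox L, |iterPd L w (φ t) x| ≤ Kw w :=
    (ae_ball_iff hfin.countable).2 fun w hw => hKw w hw
  filter_upwards [h2, ae_restrict_mem measurableSet_Ioo] with t ht htm
  refine ⟨hsol.smooth_phi t ⟨htm.1.le, htm.2.le⟩, fun w hw x hx => ?_, fun d x hx hxd =>
    (hsol.boundary t ⟨htm.1, htm.2.le⟩ d x hx hxd).1⟩
  refine (ht w hw x hx).trans ((le_abs_self _).trans ?_)
  exact Finset.single_le_sum (f := fun w => |Kw w|) (fun _ _ => abs_nonneg _)
    (hfin.mem_toFinset.2 hw)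

/-- The values of a grid function, and its gradient and the gradient of its Laplacian on the
interior faces, are bounded by `K`. -/
structure GridBound (N : Fin 3 → ℕ) (h K : ℝ) (ψ : CellFun) : Prop where
  val : ∀ i ∈ cells N, |ψ i| ≤ K
  grad : ∀ i ∈ cells N, ∀ d, i + eu d ∈ cells N → |gradh h ψ d i| ≤ K
  gradLap : ∀ i ∈ cells N, ∀ d, i + eu d ∈ cells N → |gradh h (laph N h ψ) d i| ≤ K

theorem RegularityClass.continuousOn_gridProj {L : Fin 3 → ℝ} {T : ℝ}
    {φ : ℝ → (Fin 3 → ℝ) → ℝ} (hφ : RegularityClass L T φ) {N : Fin 3 → ℕ} (hN : ∀ d, 0 < N d)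
    {h : ℝ} (hh0 : 0 < h) (hNd : ∀ d, (N d : ℝ) * h = L d) (i : Fin 3 → ℤ) :
    ContinuousOn (fun t => gridProj N h (φ t) i) (Set.Icc 0 T) :=
  hφ.cont.comp (continuousOn_id.prodMk continuousOn_const) fun _ hr =>
    ⟨hr, cellCenter_mem hh0 hNd (nearCell_mem hN i)⟩

/-- Bounds of the exact solution on the grid, and the near conservation of its discrete mass, both
uniform in time and in the mesh. -/
theorem IsExactSolution.exists_gridBound {L : Fin 3 → ℝ} (hL : ∀ d, 0 < L d) {T ε γ : ℝ}
    (hT : 0 < T) {φ p : ℝ → (Fin 3 → ℝ) → ℝ} (hsol : IsExactSolution L T ε γ φ p)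
    (hreg : RegularityClass L T φ) :
    ∃ K : ℝ, 1 ≤ K ∧ ∀ (N : Fin 3 → ℕ) (h : ℝ), (∀ d, 0 < N d) → (∀ d, h = L d / N d) →
      (∀ t ∈ Set.Icc 0 T, GridBound N h K (gridProj N h (φ t))) ∧
      ∀ s ∈ Set.Icc 0 T, ∀ t ∈ Set.Icc 0 T,
        |h ^ 3 * ∑ i ∈ cells N, gridProj N h (φ t) i
          - h ^ 3 * ∑ i ∈ cells N, gridProj N h (φ s) i| ≤ K * h ^ 2 := by
  obtain ⟨K, hK⟩ := hsol.exists_ae_neumannBound hreg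
  have l0 := hL 0
  have l1 := hL 1
  have l2 := hL 2
  set K' := 1 + 96 * |K| + 18 * |K| * (L 0 * L 1 * L 2) with hK'
  have hp : 0 ≤ |K| * (L 0 * L 1 * L 2) := by positivity
  have hKK : 96 * K ≤ K' ∧ K ≤ K' := by
    have := le_abs_self K
    have := abs_nonneg K
    constructor <;> linarith
  refine ⟨K', by linarith [abs_nonneg K], fun N h hN hh => ?_⟩
  have hh0 := mesh_pos hL hN hh
  have hNd := mesh_mul_eq hN hh
  have hc := hreg.continuousOn_gridProj hN hh0 hNd
  have hcl : ∀ i, ContinuousOn (fun t => laph N h (gridProj N h (φ t)) i) (Set.Icc 0 T) := by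
    intro i
    have hg : ∀ d j, ContinuousOn (fun t => gradh h (gridProj N h (φ t)) d j) (Set.Icc 0 T) :=
      fun d j => ((hc _).sub (hc _)).div_const _
    have hs : ContinuousOn (fun t => ∑ d, (gradh h (gridProj N h (φ t)) d (nearCell N i)
        - gradh h (gridProj N h (φ t)) d (nearCell N i - eu d)) / h) (Set.Icc 0 T) :=
      continuousOn_finsetSum _ fun d _ => ((hg d _).sub (hg d _)).div_const _
    exact hs
  refine ⟨fun t ht => ⟨fun i hi => ?_, fun i hi d hid => ?_, fun i hi d hid => ?_⟩, ?_⟩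
  · refine le_of_ae_restrict_Ioo hT (hc i).abs ?_ t ht
    filter_upwards [hK] with r hr
    exact (hr.abs_gridProj_le hh0 hNd hi).trans hKK.2
  · refine le_of_ae_restrict_Ioo hT (G := fun t => |gradh h (gridProj N h (φ t)) d i|)
      (((hc _).sub (hc _)).div_const _).abs ?_ t ht
    filter_upwards [hK] with r hr
    exact (hr.abs_gradh_gridProj_le hL hh0 hNd hi hid).trans hKK.2
  · refine le_of_ae_restrict_Ioo hT (G := fun t => |gradh h (laph N h (gridProj N h (φ t))) d i|)
      (((hcl _).sub (hcl _)).div_const _).abs ?_ t ht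
    filter_upwards [hK] with r hr
    exact (hr.abs_gradh_laph_gridProj_le hL hh0 hNd hi hid).trans hKK.1
  · have hq : ∀ t ∈ Set.Icc 0 T, |h ^ 3 * ∑ i ∈ cells N, gridProj N h (φ t) i
        - ∫ x in closedBox L, φ t x| ≤ 9 * |K| * (L 0 * L 1 * L 2) * h ^ 2 := by
      refine le_of_ae_restrict_Ioo hT
        (((continuousOn_const.mul (continuousOn_finsetSum _ fun i _ => hc i)).sub
          hreg.continuousOn_integral)).abs ?_
      filter_upwards [hK] with r hr
      have := hr.abs_quadrature_le hL hh0 hNd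
      rwa [← abs_of_nonneg (hr.nonneg hL)] at this
    intro s hs t ht
    have q1 := hq s hs
    have q2 := hq t ht
    rw [hsol.integral_eq hL hT hreg hs ht] at q1
    have hp2 : 0 ≤ (1 + 96 * |K|) * h ^ 2 := by positivity
    rw [abs_le] at q1 q2 ⊢
    constructor <;> nlinarith

/-! ### Nonlinear terms -/

theorem abs_mul_mul_le {a b c A B C : ℝ} (ha : |a| ≤ A) (hb : |b| ≤ B) (hc : |c| ≤ C) :
    |a * b * c| ≤ A * B * C := by
  rw [abs_mul, abs_mul]
  have hA := (abs_nonneg a).trans ha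
  have hB := (abs_nonneg b).trans hb
  gcongr

/-- The increment of the error of a triple product, in terms of the errors `P k - p k`, their
increments, and the increments of `P`. Primed variables are the values at the second point. -/
theorem abs_triple_error_diff_le {P P' p p' : Fin 3 → ℝ} {R D s t : ℝ}
    (hP : ∀ k, |P k| ≤ R) (hP' : ∀ k, |P' k| ≤ R) (hp : ∀ k, |p k| ≤ R) (hp' : ∀ k, |p' k| ≤ R)
    (hD : ∀ k, |P' k - P k| ≤ D) (hs : ∀ k, |(P' k - p' k) - (P k - p k)| ≤ s)
    (ht : ∀ k, |P k - p k| ≤ t) (ht' : ∀ k, |P' k - p' k| ≤ t) :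
    |(P' 0 * P' 1 * P' 2 - p' 0 * p' 1 * p' 2) - (P 0 * P 1 * P 2 - p 0 * p 1 * p 2)|
      ≤ 3 * (R ^ 2 * s) + 6 * (R * D * t) := by
  have e : (P' 0 * P' 1 * P' 2 - p' 0 * p' 1 * p' 2) - (P 0 * P 1 * P 2 - p 0 * p 1 * p 2)
      = ((P' 0 - p' 0) - (P 0 - p 0)) * p' 1 * p' 2
        + (P' 0 - P 0) * (P' 1 - p' 1) * P' 2 + (P' 0 - P 0) * (P' 2 - p' 2) * p' 1
        + (((P' 1 - p' 1) - (P 1 - p 1)) * p 0 * p' 2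
        + (P' 1 - P 1) * (P 0 - p 0) * P' 2 + (P' 1 - P 1) * (P' 2 - p' 2) * p 0)
        + (((P' 2 - p' 2) - (P 2 - p 2)) * p 0 * p 1
        + (P' 2 - P 2) * (P 0 - p 0) * P 1 + (P' 2 - P 2) * (P 1 - p 1) * p 0) := by ring
  have b1 := abs_mul_mul_le (hs 0) (hp' 1) (hp' 2)
  have b2 := abs_mul_mul_le (hD 0) (ht' 1) (hP' 2)
  have b3 := abs_mul_mul_le (hD 0) (ht' 2) (hp' 1)
  have b4 := abs_mul_mul_le (hs 1) (hp 0) (hp' 2)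
  have b5 := abs_mul_mul_le (hD 1) (ht 0) (hP' 2)
  have b6 := abs_mul_mul_le (hD 1) (ht' 2) (hp 0)
  have b7 := abs_mul_mul_le (hs 2) (hp 0) (hp 1)
  have b8 := abs_mul_mul_le (hD 2) (ht 0) (hP 1)
  have b9 := abs_mul_mul_le (hD 2) (ht 1) (hp 0)
  rw [e]
  rw [abs_le] at b1 b2 b3 b4 b5 b6 b7 b8 b9 ⊢
  constructor <;> linarith

/-- The increment of the error of `χ`. -/
theorem abs_chi_error_diff_le {Φ₁ Φ₀ φ₁ φ₀ : CellFun} {i j : Fin 3 → ℤ} {R D s t : ℝ}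
    (hR : ∀ k ∈ ({i, j} : Set (Fin 3 → ℤ)), |Φ₁ k| ≤ R ∧ |Φ₀ k| ≤ R ∧ |φ₁ k| ≤ R ∧ |φ₀ k| ≤ R)
    (hD : |Φ₁ j - Φ₁ i| ≤ D ∧ |Φ₀ j - Φ₀ i| ≤ D)
    (hs : |(Φ₁ j - φ₁ j) - (Φ₁ i - φ₁ i)| ≤ s ∧ |(Φ₀ j - φ₀ j) - (Φ₀ i - φ₀ i)| ≤ s)
    (ht : ∀ k ∈ ({i, j} : Set (Fin 3 → ℤ)), |Φ₁ k - φ₁ k| ≤ t ∧ |Φ₀ k - φ₀ k| ≤ t) :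
    |(chi Φ₁ Φ₀ j - chi φ₁ φ₀ j) - (chi Φ₁ Φ₀ i - chi φ₁ φ₀ i)|
      ≤ 3 * (R ^ 2 * s) + 6 * (R * D * t) := by
  obtain ⟨a1, a2, a3, a4⟩ := hR i (by simp)
  obtain ⟨b1, b2, b3, b4⟩ := hR j (by simp)
  obtain ⟨c1, c2⟩ := ht i (by simp)
  obtain ⟨d1, d2⟩ := ht j (by simp)
  have key : ∀ σ : Fin 3 → Bool,
      |((if σ 0 then Φ₁ j else Φ₀ j) * (if σ 1 then Φ₁ j else Φ₀ j) * (if σ 2 then Φ₁ j else Φ₀ j)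
        - (if σ 0 then φ₁ j else φ₀ j) * (if σ 1 then φ₁ j else φ₀ j)
          * (if σ 2 then φ₁ j else φ₀ j))
      - ((if σ 0 then Φ₁ i else Φ₀ i) * (if σ 1 then Φ₁ i else Φ₀ i) * (if σ 2 then Φ₁ i else Φ₀ i)
        - (if σ 0 then φ₁ i else φ₀ i) * (if σ 1 then φ₁ i else φ₀ i)
          * (if σ 2 then φ₁ i else φ₀ i))|
      ≤ 3 * (R ^ 2 * s) + 6 * (R * D * t) := by
    intro σ
    refine abs_triple_error_diff_le (P := fun k => if σ k then Φ₁ i else Φ₀ i)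
      (P' := fun k => if σ k then Φ₁ j else Φ₀ j) (p := fun k => if σ k then φ₁ i else φ₀ i)
      (p' := fun k => if σ k then φ₁ j else φ₀ j) ?_ ?_ ?_ ?_ ?_ ?_ ?_ ?_ <;>
    · intro k
      cases σ k <;> simp [*]
  have k1 := key ![true, true, true]
  have k2 := key ![true, true, false]
  have k3 := key ![true, false, false]
  have k4 := key ![false, false, false]
  simp at k1 k2 k3 k4
  simp only [chi]
  rw [abs_le] at k1 k2 k3 k4 ⊢
  constructor <;> linarith

theorem HomNeumann.sum_shift_le {N : Fin 3 → ℕ} {w : CellFun} (hw : HomNeumann N w)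
    (hw0 : ∀ i ∈ cells N, 0 ≤ w i) (d : Fin 3) :
    ∑ i ∈ cells N, w (i + eu d) ≤ 2 * ∑ i ∈ cells N, w i := by
  rw [← Finset.sum_filter_add_sum_filter_not (cells N) (fun i => i d = (N d : ℤ))
    (fun i => w (i + eu d)), two_mul]
  refine add_le_add ?_ ?_
  · rw [Finset.sum_congr rfl fun i hi => (hw i (Finset.mem_filter.1 hi).1 d).2
      (Finset.mem_filter.1 hi).2]
    exact Finset.sum_le_sum_of_subset_of_nonneg (Finset.filter_subset _ _) fun i hi _ => hw0 i hi
  · rw [← Finset.sum_image (f := w) (g := fun i => i + eu d)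
      (by intro a _ b _ hab; simpa using hab)]
    refine Finset.sum_le_sum_of_subset_of_nonneg (fun j hj => ?_) fun i hi _ => hw0 i hi
    obtain ⟨i, hi, rfl⟩ := Finset.mem_image.1 hj
    exact add_eu_mem_cells (Finset.mem_filter.1 hi).1 (Finset.mem_filter.1 hi).2

/-- The sum over the faces of the squares at both adjacent cells. -/
theorem HomNeumann.sum_faces_sq_le {N : Fin 3 → ℕ} {h : ℝ} (hh : 0 < h) {e : CellFun}
    (he : HomNeumann N e) :
    h ^ 3 * ∑ d, ∑ i ∈ cells N, (e i ^ 2 + e (i + eu d) ^ 2) ≤ 9 * cellInner N h e e := by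
  have hw : HomNeumann N (fun i => e i ^ 2) := fun i hi d =>
    ⟨fun hd => by simp only [(he i hi d).1 hd], fun hd => by simp only [(he i hi d).2 hd]⟩
  have h1 : ∀ d, ∑ i ∈ cells N, (e i ^ 2 + e (i + eu d) ^ 2) ≤ 3 * ∑ i ∈ cells N, e i ^ 2 := by
    intro d
    have := hw.sum_shift_le (fun i _ => sq_nonneg _) d
    rw [Finset.sum_add_distrib]
    linarith
  rw [cellInner_self_eq, mul_left_comm]
  refine mul_le_mul_of_nonneg_left ?_ (by positivity)
  rw [Fin.sum_univ_three]
  linarith [h1 0, h1 1, h1 2]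

theorem NoFlux.faceInner_mul_self_le {N : Fin 3 → ℕ} {h : ℝ} (hh : 0 < h) {f : FaceFun}
    (hf : NoFlux N f) {a : FaceFun} {S : ℝ} (hS0 : 0 ≤ S)
    (ha : ∀ d, ∀ i ∈ cells N, i + eu d ∈ cells N → a d i ^ 2 ≤ S) :
    faceInner N h (fun d i => a d i * f d i) (fun d i => a d i * f d i)
      ≤ S * faceInner N h f f := by
  refine ((hf.mul_left a).faceInner_self_le hh (g := fun d i => S * f d i ^ 2)
    (fun d i _ => by positivity) fun d i hi hid => ?_).trans (le_of_eq ?_)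
  · rw [mul_pow]
    exact mul_le_mul_of_nonneg_right (ha d i hi hid) (sq_nonneg _)
  · rw [hf.faceInner_eq]
    simp only [← Finset.mul_sum, sq]
    ring

/-- A bounded field times the average of a grid function. -/
theorem NoFlux.faceInner_avgh_mul_self_le {N : Fin 3 → ℕ} {h : ℝ} (hh : 0 < h) {f : FaceFun}
    (hf : NoFlux N f) {K : ℝ} (hfK : ∀ i ∈ cells N, ∀ d, i + eu d ∈ cells N → |f d i| ≤ K)
    {e : CellFun} (he : HomNeumann N e) :
    faceInner N h (fun d i => avgh e d i * f d i) (fun d i => avgh e d i * f d i)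
      ≤ 5 * K ^ 2 * cellInner N h e e := by
  refine ((hf.mul_left (avgh e)).faceInner_self_le hh
    (g := fun d i => K ^ 2 / 2 * (e i ^ 2 + e (i + eu d) ^ 2))
    (fun d i _ => by positivity) fun d i hi hid => ?_).trans ?_
  · have h1 : f d i ^ 2 ≤ K ^ 2 := sq_le_sq' (abs_le.1 (hfK i hi d hid)).1
      (abs_le.1 (hfK i hi d hid)).2
    have h2 : avgh e d i ^ 2 ≤ 1 / 2 * (e i ^ 2 + e (i + eu d) ^ 2) := by
      simp only [avgh]; nlinarith [sq_nonneg (e i - e (i + eu d))]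
    rw [mul_pow]
    have := mul_le_mul h2 h1 (sq_nonneg _) (by positivity)
    linarith
  · simp only [← Finset.mul_sum]
    have := mul_le_mul_of_nonneg_left (he.sum_faces_sq_le hh) (by positivity : 0 ≤ K ^ 2 / 2)
    have h0 := mul_nonneg (sq_nonneg K) (cellInner_self_nonneg N hh e)
    nlinarith

theorem abs_sub_le_of_gradh {h K : ℝ} (hh : 0 < h) {ψ : CellFun} {d : Fin 3} {i : Fin 3 → ℤ}
    (hK : |gradh h ψ d i| ≤ K) : |ψ (i + eu d) - ψ i| ≤ h * K := by
  rw [gradh, abs_div, abs_of_pos hh, div_le_iff₀ hh] at hK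
  linarith

/-- The gradient of the error of `χ`. Only the gradients of the exact values enter through `K`;
those of the numerical ones are written as exact minus error. -/
theorem faceInner_gradh_chi_error_le {N : Fin 3 → ℕ} {h : ℝ} (hh : 0 < h) {K R : ℝ}
    {Φ₁ Φ₀ φ₁ φ₀ : CellFun} (hΦ₁ : HomNeumann N Φ₁) (hΦ₀ : HomNeumann N Φ₀)
    (hφ₁ : HomNeumann N φ₁) (hφ₀ : HomNeumann N φ₀)
    (hR : ∀ i ∈ cells N, |Φ₁ i| ≤ R ∧ |Φ₀ i| ≤ R ∧ |φ₁ i| ≤ R ∧ |φ₀ i| ≤ R)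
    (hK₁ : ∀ i ∈ cells N, ∀ d, i + eu d ∈ cells N → |gradh h Φ₁ d i| ≤ K)
    (hK₀ : ∀ i ∈ cells N, ∀ d, i + eu d ∈ cells N → |gradh h Φ₀ d i| ≤ K) :
    faceInner N h (gradh h (chi Φ₁ Φ₀ - chi φ₁ φ₀)) (gradh h (chi Φ₁ Φ₀ - chi φ₁ φ₀))
      ≤ 36 * R ^ 4 * (faceInner N h (gradh h (Φ₁ - φ₁)) (gradh h (Φ₁ - φ₁))
          + faceInner N h (gradh h (Φ₀ - φ₀)) (gradh h (Φ₀ - φ₀)))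
        + 2592 * R ^ 2 * K ^ 2 * (cellInner N h (Φ₁ - φ₁) (Φ₁ - φ₁)
          + cellInner N h (Φ₀ - φ₀) (Φ₀ - φ₀)) := by
  have he₁ := hΦ₁.sub hφ₁
  have he₀ := hΦ₀.sub hφ₀
  set e₁ := Φ₁ - φ₁ with he₁def
  set e₀ := Φ₀ - φ₀ with he₀def
  have hflux := ((hΦ₁.chi hΦ₀).sub (hφ₁.chi hφ₀)).noFlux_gradh h
  refine (hflux.faceInner_self_le hh (g := fun d i =>
    36 * R ^ 4 * (gradh h e₁ d i * gradh h e₁ d i + gradh h e₀ d i * gradh h e₀ d i)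
      + 288 * R ^ 2 * K ^ 2 * ((e₁ i ^ 2 + e₁ (i + eu d) ^ 2) + (e₀ i ^ 2 + e₀ (i + eu d) ^ 2)))
    (fun d i _ => ?_) fun d i hi hid => ?_).trans ?_
  · have := mul_self_nonneg (gradh h e₁ d i)
    have := mul_self_nonneg (gradh h e₀ d i)
    positivity
  · set j := i + eu d with hj
    set x := |gradh h e₁ d i| + |gradh h e₀ d i| with hx
    set y := |e₁ i| + |e₁ j| + |e₀ i| + |e₀ j| with hy
    have p1 := abs_nonneg (gradh h e₁ d i)
    have p2 := abs_nonneg (gradh h e₀ d i)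
    have q1 := abs_nonneg (e₁ i)
    have q2 := abs_nonneg (e₁ j)
    have q3 := abs_nonneg (e₀ i)
    have q4 := abs_nonneg (e₀ j)
    have hRn : 0 ≤ R := (abs_nonneg _).trans (hR i hi).1
    have hKn : 0 ≤ K := (abs_nonneg _).trans (hK₁ i hi d hid)
    have t := abs_chi_error_diff_le (Φ₁ := Φ₁) (Φ₀ := Φ₀) (φ₁ := φ₁) (φ₀ := φ₀) (i := i) (j := j)
      (R := R) (D := h * K) (s := h * x) (t := y)
      (by
        intro k hk
        rcases hk with rfl | hk
        · exact hR _ hi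
        · rw [Set.mem_singleton_iff.1 hk]; exact hR j hid)
      ⟨abs_sub_le_of_gradh hh (hK₁ i hi d hid), abs_sub_le_of_gradh hh (hK₀ i hi d hid)⟩
      ⟨abs_sub_le_of_gradh (ψ := e₁) hh (by linarith),
        abs_sub_le_of_gradh (ψ := e₀) hh (by linarith)⟩
      (by
        intro k hk
        have f1 : ∀ k, Φ₁ k - φ₁ k = e₁ k := fun _ => rfl
        have f0 : ∀ k, Φ₀ k - φ₀ k = e₀ k := fun _ => rfl
        rw [f1, f0]
        rcases hk with rfl | hk
        · constructor <;> linarith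
        · rw [Set.mem_singleton_iff.1 hk]; constructor <;> linarith)
    have hg : |gradh h (chi Φ₁ Φ₀ - chi φ₁ φ₀) d i| ≤ 3 * (R ^ 2 * x) + 6 * (R * K * y) := by
      simp only [gradh, Pi.sub_apply, abs_div, abs_of_pos hh]
      rw [div_le_iff₀ hh]
      refine t.trans (le_of_eq ?_)
      ring
    have hg2 := sq_le_sq' (abs_le.1 hg).1 (abs_le.1 hg).2
    refine hg2.trans ?_
    have hx2 : x ^ 2 ≤ 2 * (gradh h e₁ d i * gradh h e₁ d i + gradh h e₀ d i * gradh h e₀ d i) := by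
      rw [← abs_mul_abs_self (gradh h e₁ d i), ← abs_mul_abs_self (gradh h e₀ d i), hx]
      nlinarith [sq_nonneg (|gradh h e₁ d i| - |gradh h e₀ d i|)]
    have hy2 : y ^ 2 ≤ 4 * ((e₁ i ^ 2 + e₁ j ^ 2) + (e₀ i ^ 2 + e₀ j ^ 2)) := by
      rw [← sq_abs (e₁ i), ← sq_abs (e₁ j), ← sq_abs (e₀ i), ← sq_abs (e₀ j), hy]
      nlinarith [sq_nonneg (|e₁ i| - |e₁ j|), sq_nonneg (|e₁ i| - |e₀ i|),
        sq_nonneg (|e₁ i| - |e₀ j|), sq_nonneg (|e₁ j| - |e₀ i|), sq_nonneg (|e₁ j| - |e₀ j|),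
        sq_nonneg (|e₀ i| - |e₀ j|)]
    have m1 := mul_le_mul_of_nonneg_left hx2 (by positivity : 0 ≤ 18 * R ^ 4)
    have m2 := mul_le_mul_of_nonneg_left hy2 (by positivity : 0 ≤ 72 * R ^ 2 * K ^ 2)
    nlinarith [sq_nonneg (3 * (R ^ 2 * x) - 6 * (R * K * y))]
  · have s1 := he₁.sum_faces_sq_le hh
    have s0 := he₀.sum_faces_sq_le hh
    rw [(he₁.noFlux_gradh h).faceInner_eq, (he₀.noFlux_gradh h).faceInner_eq]
    have m := mul_le_mul_of_nonneg_left (add_le_add s1 s0)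
      (by positivity : 0 ≤ 288 * R ^ 2 * K ^ 2)
    simp only [Finset.sum_add_distrib, ← Finset.mul_sum] at m ⊢
    linarith

/-- The chemical potential of the exact solution on the grid has a bounded gradient. -/
theorem abs_gradh_discPot_le {N : Fin 3 → ℕ} {h ε K : ℝ} (hh : 0 < h) {Φ : ℕ → CellFun} {m : ℕ}
    (h1 : GridBound N h K (Φ (m + 1))) (h0 : GridBound N h K (Φ m))
    (hm : GridBound N h K (Φ (m - 1))) :
    ∀ i ∈ cells N, ∀ d, i + eu d ∈ cells N →
      |gradh h (discPot N h ε Φ m) d i| ≤ 9 * K ^ 3 + 2 * K + ε ^ 2 * K := by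
  intro i hi d hid
  have hK0 : 0 ≤ K := (abs_nonneg _).trans (h1.val i hi)
  have z : |(0 : ℝ)| ≤ K := by simpa using hK0
  have t := abs_chi_error_diff_le (Φ₁ := Φ (m + 1)) (Φ₀ := Φ m) (φ₁ := 0) (φ₀ := 0) (i := i)
    (j := i + eu d) (R := K) (D := h * K) (s := h * K) (t := K)
    (by
      intro k hk
      rcases hk with rfl | hk
      · exact ⟨h1.val _ hi, h0.val _ hi, z, z⟩
      · rw [Set.mem_singleton_iff.1 hk]; exact ⟨h1.val _ hid, h0.val _ hid, z, z⟩)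
    ⟨abs_sub_le_of_gradh hh (h1.grad i hi d hid), abs_sub_le_of_gradh hh (h0.grad i hi d hid)⟩
    (by
      simp only [Pi.zero_apply, sub_zero]
      exact ⟨abs_sub_le_of_gradh hh (h1.grad i hi d hid),
        abs_sub_le_of_gradh hh (h0.grad i hi d hid)⟩)
    (by
      intro k hk
      simp only [Pi.zero_apply, sub_zero]
      rcases hk with rfl | hk
      · exact ⟨h1.val _ hi, h0.val _ hi⟩
      · rw [Set.mem_singleton_iff.1 hk]; exact ⟨h1.val _ hid, h0.val _ hid⟩)
  have hz : ∀ k, chi 0 0 k = 0 := fun k => by simp [chi]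
  rw [hz, hz, sub_zero, sub_zero] at t
  have g1 : |gradh h (chi (Φ (m + 1)) (Φ m)) d i| ≤ 9 * K ^ 3 := by
    rw [gradh, abs_div, abs_of_pos hh, div_le_iff₀ hh]
    refine t.trans (le_of_eq ?_)
    ring
  have e : gradh h (discPot N h ε Φ m) d i = gradh h (chi (Φ (m + 1)) (Φ m)) d i
      - (3 / 2 * gradh h (Φ m) d i - 1 / 2 * gradh h (Φ (m - 1)) d i)
      - ε ^ 2 * (3 / 4 * gradh h (laph N h (Φ (m + 1))) d i
        + 1 / 4 * gradh h (laph N h (Φ (m - 1))) d i) := by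
    have hl : laph N h (fun j => 3 / 4 * Φ (m + 1) j + 1 / 4 * Φ (m - 1) j)
        = (3 / 4 : ℝ) • laph N h (Φ (m + 1)) + (1 / 4 : ℝ) • laph N h (Φ (m - 1)) := by
      rw [← laph_smul, ← laph_smul, ← laph_add]
      rfl
    simp only [gradh, discPot, hl, extrap, Pi.add_apply, Pi.smul_apply, smul_eq_mul]
    ring
  rw [e]
  have a1 := h0.grad i hi d hid
  have a2 := hm.grad i hi d hid
  have a3 : |3 / 4 * gradh h (laph N h (Φ (m + 1))) d i
        + 1 / 4 * gradh h (laph N h (Φ (m - 1))) d i| ≤ K := by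
    have b1 := h1.gradLap i hi d hid
    have b2 := hm.gradLap i hi d hid
    rw [abs_le] at b1 b2 ⊢
    constructor <;> linarith
  have a4 : |ε ^ 2 * (3 / 4 * gradh h (laph N h (Φ (m + 1))) d i
        + 1 / 4 * gradh h (laph N h (Φ (m - 1))) d i)| ≤ ε ^ 2 * K := by
    rw [abs_mul, abs_of_nonneg (sq_nonneg ε)]
    exact mul_le_mul_of_nonneg_left a3 (sq_nonneg ε)
  rw [abs_le] at a1 a2 a4 g1 ⊢
  constructor <;> linarith

/-! ### Mean values and maxima of the error -/

/-- A Neumann grid function with nearly vanishing mean is controlled by its gradient, in `L²`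
and, with a power of the mesh width, pointwise. -/
theorem HomNeumann.exists_le_of_mean {L : Fin 3 → ℝ} (hL : ∀ d, 0 < L d) (K : ℝ) :
    ∃ C, 0 ≤ C ∧ ∀ (N : Fin 3 → ℕ) (h : ℝ), (∀ d, 0 < N d) → (∀ d, h = L d / N d) →
      ∀ e, HomNeumann N e → |h ^ 3 * ∑ i ∈ cells N, e i| ≤ K * h ^ 2 →
        cellInner N h e e ≤ C * (faceInner N h (gradh h e) (gradh h e) + h ^ 4) ∧
        ∀ i ∈ cells N, h ^ 4 * e i ^ 2 ≤ C * (faceInner N h (gradh h e) (gradh h e) + h ^ 4) := by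
  have hL0 := hL 0
  have hL1 := hL 1
  have hL2 := hL 2
  set V := L 0 * L 1 * L 2 with hV
  have hV0 : 0 < V := by positivity
  set P := 3 * (L 0 ^ 2 + L 1 ^ 2 + L 2 ^ 2) with hP
  have hP0 : 0 ≤ P := by positivity
  refine ⟨2 * P + 2 * K ^ 2 / V + 2 * L 0 * P + 2 * L 0 ^ 4 * (K ^ 2 / V ^ 2), by positivity, ?_⟩
  intro N h hN hh e he hmean
  have hpos := mesh_pos hL hN hh
  have hle := mesh_le hL hN hh 0
  set E := faceInner N h (gradh h e) (gradh h e) with hE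
  have hE0 : 0 ≤ E := faceInner_self_nonneg N hpos _
  set S := h ^ 3 * ∑ i ∈ cells N, e i with hS
  have hc : V * (S / V) = S := by field_simp
  set c := S / V with hcdef
  have hpc := he.poincare hL hN hh (c := c) hc
  rw [← hP, ← hE] at hpc
  have hS2 : S ^ 2 ≤ K ^ 2 * h ^ 4 := by
    have := sq_le_sq' (abs_le.1 hmean).1 (abs_le.1 hmean).2
    nlinarith
  have hc2 : c ^ 2 ≤ K ^ 2 / V ^ 2 * h ^ 4 := by
    rw [hcdef, div_pow, div_mul_eq_mul_div]
    gcongr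
  have hVc2 : V * c ^ 2 ≤ K ^ 2 / V * h ^ 4 := by
    have := mul_le_mul_of_nonneg_left hc2 hV0.le
    have e1 : V * (K ^ 2 / V ^ 2 * h ^ 4) = K ^ 2 / V * h ^ 4 := by field_simp
    linarith
  have hcard := card_cells_mul_pow (mesh_mul_eq hN hh)
  rw [← hV] at hcard
  rw [cellInner_self_eq] at hpc
  have hh4 : 0 ≤ h ^ 4 := by positivity
  have q1 : 0 ≤ K ^ 2 / V := by positivity
  have q2 : 0 ≤ K ^ 2 / V ^ 2 := by positivity
  constructor
  · have h1 : cellInner N h e e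
        ≤ 2 * (h ^ 3 * ∑ i ∈ cells N, (e i - c) ^ 2) + 2 * (V * c ^ 2) := by
      have : ∑ i ∈ cells N, e i ^ 2
          ≤ 2 * ∑ i ∈ cells N, (e i - c) ^ 2 + 2 * ((cells N).card * c ^ 2) := by
        rw [← nsmul_eq_mul, ← Finset.sum_const, Finset.mul_sum, Finset.mul_sum,
          ← Finset.sum_add_distrib]
        exact Finset.sum_le_sum fun i _ => by nlinarith [sq_nonneg (e i - 2 * c)]
      rw [cellInner_self_eq, ← hcard]
      have := mul_le_mul_of_nonneg_left this (pow_pos hpos 3).le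
      linarith
    have e1 : 0 ≤ (2 * L 0 * P + 2 * L 0 ^ 4 * (K ^ 2 / V ^ 2)) * (E + h ^ 4) := by positivity
    have e2 : 0 ≤ P * h ^ 4 := by positivity
    have e3 : 0 ≤ K ^ 2 / V * E := by positivity
    have e4 : 2 * K ^ 2 / V = 2 * (K ^ 2 / V) := by ring
    rw [e4]
    linarith
  · intro i hi
    have h1 : h ^ 3 * (e i - c) ^ 2 ≤ P * E := by
      refine le_trans ?_ hpc
      gcongr
      exact Finset.single_le_sum (f := fun i => (e i - c) ^ 2) (fun _ _ => sq_nonneg _) hi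
    have h2 : h ^ 4 * (e i - c) ^ 2 ≤ L 0 * (P * E) := by
      calc h ^ 4 * (e i - c) ^ 2 = h * (h ^ 3 * (e i - c) ^ 2) := by ring
        _ ≤ L 0 * (P * E) := by gcongr
    have h3 : h ^ 4 * c ^ 2 ≤ L 0 ^ 4 * (K ^ 2 / V ^ 2 * h ^ 4) := by gcongr
    have h4 : h ^ 4 * e i ^ 2 ≤ 2 * (h ^ 4 * (e i - c) ^ 2) + 2 * (h ^ 4 * c ^ 2) := by
      nlinarith [mul_nonneg hh4 (sq_nonneg (e i - 2 * c))]
    have e1 : 0 ≤ (2 * P + 2 * K ^ 2 / V) * (E + h ^ 4) := by positivity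
    have e2 : 0 ≤ L 0 * P * h ^ 4 := by positivity
    have e3 : 0 ≤ L 0 ^ 4 * (K ^ 2 / V ^ 2) * E := by positivity
    linarith

theorem abs_le_supNorm {N : Fin 3 → ℕ} (ψ : CellFun) {i : Fin 3 → ℤ} (hi : i ∈ cells N) :
    |ψ i| ≤ supNorm N ψ :=
  le_ciSup (f := fun i : {i // i ∈ cells N} => |ψ i|) (Set.finite_range _).bddAbove ⟨i, hi⟩

theorem exists_abs_eq_supNorm {N : Fin 3 → ℕ} (hN : ∀ d, 0 < N d) (ψ : CellFun) :
    ∃ i ∈ cells N, |ψ i| = supNorm N ψ := by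
  have : Nonempty {i // i ∈ cells N} := ⟨⟨_, nearCell_mem hN 0⟩⟩
  obtain ⟨i, hi⟩ := exists_eq_ciSup_of_finite (f := fun i : {i // i ∈ cells N} => |ψ i|)
  exact ⟨i.1, i.2, hi⟩

theorem supNorm_nonneg (N : Fin 3 → ℕ) (ψ : CellFun) : 0 ≤ supNorm N ψ :=
  Real.iSup_nonneg fun _ => abs_nonneg _

theorem IsSchemeSolution.noFlux_discVel {N : Fin 3 → ℕ} {h s ε γ : ℝ} {M : ℕ}
    {φ μ p : ℕ → CellFun} (H : IsSchemeSolution N h s ε γ M φ μ p) {m : ℕ} (hm : 1 ≤ m)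
    (hmM : m + 1 ≤ M) : NoFlux N (discVel h γ φ μ p m) :=
  ((H.neumann_p m hm hmM).noFlux_gradh h).neg.sub
    (((H.neumann_mu m hm hmM).noFlux_gradh h).mul_left fun d i => γ * avgh (extrap φ m) d i)

/-- The scheme conserves mass. -/
theorem IsSchemeSolution.sum_eq {N : Fin 3 → ℕ} {h s ε γ : ℝ} {M : ℕ} (hs : 0 < s)
    {φ μ p : ℕ → CellFun} (H : IsSchemeSolution N h s ε γ M φ μ p) :
    ∀ k, 1 ≤ k → k ≤ M → ∑ i ∈ cells N, φ k i = ∑ i ∈ cells N, φ 1 i := by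
  intro k hk
  induction k, hk using Nat.le_induction with
  | base => intro _; rfl
  | succ m hm ih =>
    intro hmM
    rw [← ih (by omega), ← sub_eq_zero, ← Finset.sum_sub_distrib]
    have h1 : ∀ i ∈ cells N, φ (m + 1) i - φ m i
        = s * (divh h (gradh h (μ m)) i
          - divh h (fun d j => avgh (extrap φ m) d j * discVel h γ φ μ p m d j) i) := by
      intro i hi
      rw [← laph_of_mem hi, ← H.evolution m hm hmM i hi]
      field_simp
    rw [Finset.sum_congr rfl h1, ← Finset.mul_sum, Finset.sum_sub_distrib,
      ((H.neumann_mu m hm hmM).noFlux_gradh h).sum_divh,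
      ((H.noFlux_discVel hm hmM).mul_left _).sum_divh]
    simp

/-! ### The energy estimate -/

/-- Testing the error equation with `Δ_h ((3/4) e₁ + (1/4) e₀)`. The left-hand side comes from
`2 (a, (3/4) e₁ + (1/4) e₀) = |e₁|² - |e|² + (|a|² - |b|² + |a - b|²) / 4`, where `a = e₁ - e`
and `b = e - e₀`. -/
theorem energy_le {N : Fin 3 → ℕ} {h s : ℝ} (hh : 0 < h) (hs : 0 < s) {e₁ e e₀ Z τ : CellFun}
    {J : FaceFun} (hZ : HomNeumann N Z)
    (hJ : NoFlux N J)
    (heq : ∀ i ∈ cells N, (e₁ i - e i) / s = laph N h Z i - divh h J i + τ i)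
    {ea y : CellFun} (hea : ea = (3 / 4 : ℝ) • e₁ + (1 / 4 : ℝ) • e₀) (hav : HomNeumann N ea)
    (hy : y = laph N h ea) :
    faceInner N h (gradh h e₁) (gradh h e₁) - faceInner N h (gradh h e) (gradh h e)
      + 1 / 4 * (faceInner N h (gradh h (e₁ - e)) (gradh h (e₁ - e))
        - faceInner N h (gradh h (e - e₀)) (gradh h (e - e₀)))
    ≤ s * (2 * faceInner N h (gradh h Z) (gradh h y) - 2 * faceInner N h J (gradh h y)
      - 2 * cellInner N h τ y) := by
  have h1 : cellInner N h (e₁ - e) y = -faceInner N h (gradh h ea) (gradh h (e₁ - e)) := by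
    rw [hy, cellInner_comm, hav.cellInner_laph hh]
  have h2 : cellInner N h (e₁ - e) y
      = s * (cellInner N h (laph N h Z) y - cellInner N h (divh h J) y + cellInner N h τ y) := by
    have : cellInner N h (e₁ - e) y
        = cellInner N h (fun i => s * (laph N h Z i - divh h J i + τ i)) y := by
      refine cellInner_congr (fun i hi => ?_) fun _ _ => rfl
      rw [← heq i hi, Pi.sub_apply]
      field_simp
    rw [this]
    simp only [cellInner, Finset.mul_sum, ← Finset.sum_sub_distrib, ← Finset.sum_add_distrib]
    exact Finset.sum_congr rfl fun i _ => by ring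
  rw [hZ.cellInner_laph hh, show cellInner N h (divh h J) y = -faceInner N h J (gradh h y) by
    rw [hJ.faceInner_gradh hh, neg_neg]] at h2
  have h0 := faceInner_self_nonneg N hh (gradh h e₁ - gradh h e - (gradh h e - gradh h e₀))
  have c1 := faceInner_comm N h (gradh h e) (gradh h e₁)
  have c2 := faceInner_comm N h (gradh h e₀) (gradh h e₁)
  have c3 := faceInner_comm N h (gradh h e₀) (gradh h e)
  rw [hea] at h1
  simp only [gradh_sub, gradh_add, gradh_smul, faceInner_sub_left, faceInner_sub_right,
    faceInner_add_left, faceInner_smul_left] at h0 h1 ⊢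
  linarith

/-- The dissipation at the averaged level dominates that at the new level: the difference of the two
sides is `5/16 |g₁ + (3/5) g₀|²`. -/
theorem faceInner_average_ge (N : Fin 3 → ℕ) {h : ℝ} (hh : 0 < h) (g₁ g₀ : FaceFun) :
    1 / 4 * faceInner N h g₁ g₁ - 1 / 20 * faceInner N h g₀ g₀
      ≤ faceInner N h ((3 / 4 : ℝ) • g₁ + (1 / 4 : ℝ) • g₀)
          ((3 / 4 : ℝ) • g₁ + (1 / 4 : ℝ) • g₀) := by
  have h0 := faceInner_self_nonneg N hh (g₁ + (3 / 5 : ℝ) • g₀)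
  simp only [faceInner_add_left, faceInner_add_right, faceInner_smul_left,
    faceInner_smul_right] at h0 ⊢
  have := faceInner_comm N h g₀ g₁
  linarith

/-- The velocity error `w` is orthogonal to gradients, so that `|w|²` absorbs the velocity term. -/
theorem velocity_error_le {N : Fin 3 → ℕ} {h ε γ : ℝ} (hh : 0 < h) (hε : 0 < ε) (hγ : 0 < γ)
    {w a b : FaceFun} (hw : NoFlux N w) (hdiv : ∀ i ∈ cells N, divh h w i = 0)
    {Γ Z Rr r y : CellFun}
    (hweq : w = (-γ) • ((fun d i => a d i * gradh h Γ d i) + fun d i => b d i * gradh h Z d i)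
      + gradh h r)
    (hZ : ∀ i ∈ cells N, ∀ d, gradh h Z d i = gradh h Rr d i - ε ^ 2 * gradh h y d i
      ∧ gradh h Z d (i - eu d) = gradh h Rr d (i - eu d) - ε ^ 2 * gradh h y d (i - eu d))
    {F : FaceFun}
    (hF : F = (fun d i => a d i * gradh h Γ d i) + fun d i => b d i * gradh h Rr d i) :
    -2 * faceInner N h w (fun d i => b d i * gradh h y d i)
      ≤ γ / (2 * ε ^ 2) * faceInner N h F F := by
  set G : FaceFun := fun d i => b d i * gradh h y d i with hG
  have h1 : faceInner N h w w = -γ * (faceInner N h w F - ε ^ 2 * faceInner N h w G) := by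
    have : faceInner N h w w = faceInner N h w ((-γ) • (F + (-ε ^ 2) • G) + gradh h r) := by
      refine faceInner_congr (fun _ _ _ => ⟨rfl, rfl⟩) fun i hi d => ?_
      obtain ⟨z1, z2⟩ := hZ i hi d
      rw [hF]
      nth_rewrite 1 2 [hweq]
      simp only [Pi.add_apply, Pi.smul_apply, smul_eq_mul, hG, z1, z2]
      constructor <;> ring
    rw [this, faceInner_add_right, hw.faceInner_gradh_eq_zero hh hdiv, faceInner_smul_right,
      faceInner_add_right, faceInner_smul_right]
    ring
  have h2 := two_faceInner_le N hh (by positivity : 0 < 2 / γ) ((-1 : ℝ) • F) w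
  rw [faceInner_smul_left, faceInner_smul_left, faceInner_smul_right, faceInner_comm N h F w] at h2
  have h3 : -2 * faceInner N h w G
      = (1 / ε ^ 2) * (2 * (-1 * faceInner N h w F) - 2 / γ * faceInner N h w w) := by
    rw [h1]; field_simp; ring
  have h4 : 2 * (-1 * faceInner N h w F) - 2 / γ * faceInner N h w w ≤ γ / 2 * faceInner N h F F := by
    rw [inv_div] at h2; linarith
  rw [h3]
  refine (mul_le_mul_of_nonneg_left h4 (by positivity)).trans (le_of_eq ?_)
  field_simp

/-- The energy estimate with the dissipation made explicit. Here `Z = Rr - ε² Δ_h ê` is the error of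
the chemical potential, with `ê = (3/4) e₁ + (1/4) e₀`, and the error of the convective flux is
split into `a U`, the exact velocity transported by the error, and `b w`, the error of the velocity
transported by the numerical solution. -/
theorem energy_le_of_splitting {N : Fin 3 → ℕ} {h s ε γ : ℝ} (hh : 0 < h) (hs : 0 < s)
    (hε : 0 < ε) (hγ : 0 < γ) {e₁ e e₀ Z τ : CellFun} {w a b U : FaceFun}
    (he₁ : HomNeumann N e₁) (he₀ : HomNeumann N e₀) (hZ : HomNeumann N Z)
    (hU : NoFlux N U) (hw : NoFlux N w) (hdiv : ∀ i ∈ cells N, divh h w i = 0)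
    (heq : ∀ i ∈ cells N, (e₁ i - e i) / s = laph N h Z i
      - divh h ((fun d i => a d i * U d i) + fun d i => b d i * w d i) i + τ i)
    {Γ Rr r : CellFun}
    (hweq : w = (-γ) • ((fun d i => a d i * gradh h Γ d i) + fun d i => b d i * gradh h Z d i)
      + gradh h r) (hR : HomNeumann N Rr)
    (hZeq : ∀ i ∈ cells N, Z i
      = Rr i - ε ^ 2 * laph N h ((3 / 4 : ℝ) • e₁ + (1 / 4 : ℝ) • e₀) i)
    {F : FaceFun}
    (hF : F = (fun d i => a d i * gradh h Γ d i) + fun d i => b d i * gradh h Rr d i) :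
    faceInner N h (gradh h e₁) (gradh h e₁) - faceInner N h (gradh h e) (gradh h e)
      + 1 / 4 * (faceInner N h (gradh h (e₁ - e)) (gradh h (e₁ - e))
        - faceInner N h (gradh h (e - e₀)) (gradh h (e - e₀)))
      + 5 / 16 * ε ^ 2 * s * faceInner N h (gradh h (laph N h e₁)) (gradh h (laph N h e₁))
    ≤ s * (1 / 16 * ε ^ 2 * faceInner N h (gradh h (laph N h e₀)) (gradh h (laph N h e₀))
      + 4 / ε ^ 2 * faceInner N h (gradh h Rr) (gradh h Rr)
      + 4 / ε ^ 2 * faceInner N h (fun d i => a d i * U d i) (fun d i => a d i * U d i)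
      + γ / (2 * ε ^ 2) * faceInner N h F F + 2 * cellInner N h τ τ
      + 1 / (2 * ε ^ 2) * (faceInner N h (gradh h e₁) (gradh h e₁)
        + faceInner N h (gradh h e₀) (gradh h e₀))) := by
  set ea := (3 / 4 : ℝ) • e₁ + (1 / 4 : ℝ) • e₀ with hea
  have hav : HomNeumann N ea := (he₁.smul _).add (he₀.smul _)
  set y := laph N h ea with hy
  set f₁ : FaceFun := fun d i => a d i * U d i with hf₁
  set f₂ : FaceFun := fun d i => b d i * w d i with hf₂
  have key := energy_le hh hs hZ ((hU.mul_left a).add (hw.mul_left b)) heq hea hav hy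
  have hfaces := hZ.gradh_congr h (hR.add ((homNeumann_laph N h ea).smul (-ε ^ 2))) (fun i hi => by
    rw [hZeq i hi]; simp only [Pi.add_apply, Pi.smul_apply, smul_eq_mul]; ring)
  have hfaces' : ∀ i ∈ cells N, ∀ d, gradh h Z d i = gradh h Rr d i - ε ^ 2 * gradh h y d i
      ∧ gradh h Z d (i - eu d) = gradh h Rr d (i - eu d) - ε ^ 2 * gradh h y d (i - eu d) := by
    intro i hi d
    obtain ⟨z1, z2⟩ := hfaces i hi d
    rw [z1, z2, gradh_add, gradh_smul]
    simp only [Pi.add_apply, Pi.smul_apply, smul_eq_mul]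
    constructor <;> ring
  set G := faceInner N h (gradh h y) (gradh h y) with hG
  have t1 : faceInner N h (gradh h Z) (gradh h y)
      = faceInner N h (gradh h Rr) (gradh h y) - ε ^ 2 * G := by
    rw [faceInner_congr (g' := gradh h y) hfaces fun _ _ _ => ⟨rfl, rfl⟩, gradh_add, gradh_smul,
      faceInner_add_left, faceInner_smul_left]
    ring
  have t2 : faceInner N h (f₁ + f₂) (gradh h y) = faceInner N h f₁ (gradh h y)
      + faceInner N h w (fun d i => b d i * gradh h y d i) := by
    rw [faceInner_add_left]
    congr 1
    simp only [faceInner, hf₂]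
    refine Finset.sum_congr rfl fun d _ => ?_
    congr 1
    exact Finset.sum_congr rfl fun i _ => by ring
  have t3 := velocity_error_le hh hε hγ hw hdiv hweq hfaces' hF
  have t4 := two_faceInner_le N hh (by positivity : 0 < ε ^ 2 / 4) (gradh h Rr) (gradh h y)
  have t5 := two_faceInner_le N hh (by positivity : 0 < ε ^ 2 / 4) ((-1 : ℝ) • f₁) (gradh h y)
  rw [faceInner_smul_left, faceInner_smul_left, faceInner_smul_right] at t5
  rw [inv_div] at t4 t5
  have t6 := two_cellInner_le N hh (by norm_num : (0 : ℝ) < 1 / 2) ((-1 : ℝ) • τ) y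
  have t6' : cellInner N h ((-1 : ℝ) • τ) y = -cellInner N h τ y := by
    simp [cellInner]
  have t6'' : cellInner N h ((-1 : ℝ) • τ) ((-1 : ℝ) • τ) = cellInner N h τ τ := by
    simp [cellInner]
  rw [t6', t6''] at t6
  have t7 := hav.laph_interpolation hh (by positivity : 0 < ε ^ 2)
  rw [← hy, ← hG] at t7
  have t8 := faceInner_average_ge N hh (gradh h (laph N h e₁)) (gradh h (laph N h e₀))
  have t8' : (3 / 4 : ℝ) • gradh h (laph N h e₁) + (1 / 4 : ℝ) • gradh h (laph N h e₀)
      = gradh h y := by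
    rw [hy, hea, laph_add, laph_smul, laph_smul, gradh_add, gradh_smul, gradh_smul]
  rw [t8', ← hG] at t8
  have t9 : faceInner N h (gradh h ea) (gradh h ea)
      ≤ 2 * (faceInner N h (gradh h e₁) (gradh h e₁)
        + faceInner N h (gradh h e₀) (gradh h e₀)) := by
    rw [hea, gradh_add, gradh_smul, gradh_smul]
    refine (faceInner_add_self_le N hh _ _).trans ?_
    simp only [faceInner_smul_left, faceInner_smul_right]
    have := faceInner_self_nonneg N hh (gradh h e₁)
    have := faceInner_self_nonneg N hh (gradh h e₀)
    linarith
  have t10 := mul_le_mul_of_nonneg_left t9 (by positivity : 0 ≤ (ε ^ 2)⁻¹)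
  have t11 := mul_le_mul_of_nonneg_left t8 (by positivity : 0 ≤ 5 / 4 * ε ^ 2)
  have hi : 1 / (2 * ε ^ 2) = 1 / 2 * (ε ^ 2)⁻¹ := by field_simp
  rw [t1, t2] at key
  rw [hi]
  -- The Young inequalities for `Rr`, for `a U` and for `τ` use `ε² G / 4` each, out of `2 ε² G`.
  have step : 2 * (faceInner N h (gradh h Rr) (gradh h y) - ε ^ 2 * G)
      - 2 * (faceInner N h f₁ (gradh h y) + faceInner N h w (fun d i => b d i * gradh h y d i))
      - 2 * cellInner N h τ y
      ≤ -(5 / 16 * ε ^ 2 * faceInner N h (gradh h (laph N h e₁)) (gradh h (laph N h e₁)))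
      + (1 / 16 * ε ^ 2 * faceInner N h (gradh h (laph N h e₀)) (gradh h (laph N h e₀))
      + 4 / ε ^ 2 * faceInner N h (gradh h Rr) (gradh h Rr)
      + 4 / ε ^ 2 * faceInner N h f₁ f₁
      + γ / (2 * ε ^ 2) * faceInner N h F F + 2 * cellInner N h τ τ
      + 1 / 2 * (ε ^ 2)⁻¹ * (faceInner N h (gradh h e₁) (gradh h e₁)
        + faceInner N h (gradh h e₀) (gradh h e₀))) := by
    norm_num at t6
    linarith
  have := mul_le_mul_of_nonneg_left step hs.le
  linarith

/-! ### The error equation -/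

theorem homNeumann_discPot {N : Fin 3 → ℕ} {Φ : ℕ → CellFun} (hΦ : ∀ k, HomNeumann N (Φ k))
    (h ε : ℝ) (m : ℕ) : HomNeumann N (discPot N h ε Φ m) :=
  (((hΦ _).chi (hΦ _)).sub ((hΦ _).extrap (hΦ _))).sub ((homNeumann_laph N h _).smul (ε ^ 2))

/-- The nonlinear part of the error of the chemical potential. -/
def potErr (Φ φ : ℕ → CellFun) (m : ℕ) : CellFun :=
  chi (Φ (m + 1)) (Φ m) - chi (φ (m + 1)) (φ m) - extrap (Φ - φ) m

/-- The energy estimate for the error of the scheme. -/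
theorem IsSchemeSolution.energy_le {N : Fin 3 → ℕ} {h s ε γ : ℝ} {M : ℕ} (hN : ∀ d, 0 < N d)
    (hh : 0 < h) (hs : 0 < s) (hε : 0 < ε) (hγ : 0 < γ) {Φ φ μ p : ℕ → CellFun}
    (H : IsSchemeSolution N h s ε γ M φ μ p) (hΦ : ∀ k, HomNeumann N (Φ k)) {m : ℕ}
    (hm : 1 ≤ m) (hmM : m + 1 ≤ M) {e₁ e e₀ : CellFun} (he₁ : e₁ = Φ (m + 1) - φ (m + 1))
    (he : e = Φ m - φ m) (he₀ : e₀ = Φ (m - 1) - φ (m - 1)) {f F : FaceFun}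
    (hf : f = fun d i => avgh (extrap (Φ - φ) m) d i * consVel N h ε γ Φ m d i)
    (hF : F = (fun d i => avgh (extrap (Φ - φ) m) d i * gradh h (discPot N h ε Φ m) d i)
      + fun d i => avgh (extrap φ m) d i * gradh h (potErr Φ φ m) d i) :
    faceInner N h (gradh h e₁) (gradh h e₁) - faceInner N h (gradh h e) (gradh h e)
      + 1 / 4 * (faceInner N h (gradh h (e₁ - e)) (gradh h (e₁ - e))
        - faceInner N h (gradh h (e - e₀)) (gradh h (e - e₀)))
      + 5 / 16 * ε ^ 2 * s * faceInner N h (gradh h (laph N h e₁)) (gradh h (laph N h e₁))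
    ≤ s * (1 / 16 * ε ^ 2 * faceInner N h (gradh h (laph N h e₀)) (gradh h (laph N h e₀))
      + 4 / ε ^ 2 * faceInner N h (gradh h (potErr Φ φ m)) (gradh h (potErr Φ φ m))
      + 4 / ε ^ 2 * faceInner N h f f
      + γ / (2 * ε ^ 2) * faceInner N h F F
      + 2 * cellInner N h (truncErr N h s ε γ Φ m) (truncErr N h s ε γ Φ m)
      + 1 / (2 * ε ^ 2) * (faceInner N h (gradh h e₁) (gradh h e₁)
        + faceInner N h (gradh h e₀) (gradh h e₀))) := by
  have n1 := H.neumann_phi (m + 1) hmM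
  have n0 := H.neumann_phi m (by omega)
  have nm := H.neumann_phi (m - 1) (by omega)
  have nμ := H.neumann_mu m hm hmM
  have np := H.neumann_p m hm hmM
  have hE1 : HomNeumann N e₁ := he₁ ▸ (hΦ _).sub n1
  have hE : HomNeumann N e := he ▸ (hΦ _).sub n0
  have hE0 : HomNeumann N e₀ := he₀ ▸ (hΦ _).sub nm
  have hE0' : HomNeumann N ((Φ - φ) (m - 1)) := (hΦ _).sub nm
  have hEm' : HomNeumann N ((Φ - φ) m) := (hΦ _).sub n0
  have hΓ : HomNeumann N (discPot N h ε Φ m) := homNeumann_discPot hΦ h ε m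
  set Γ := discPot N h ε Φ m with hΓdef
  have hflux : NoFlux N (fun d i => γ * avgh (extrap Φ m) d i * gradh h Γ d i) :=
    (hΓ.noFlux_gradh h).mul_left _
  obtain ⟨hq, hUdiv, hUflux⟩ := helmholtzProj_spec hN hh hflux
  set q := helmholtzPotential N h (fun d i => γ * avgh (extrap Φ m) d i * gradh h Γ d i) with hqdef
  set U := consVel N h ε γ Φ m with hUdef
  set u := discVel h γ φ μ p m with hudef
  have hU : NoFlux N U := hUflux.neg
  have hu : NoFlux N u := H.noFlux_discVel hm hmM
  have hUval : ∀ d i, U d i = -(γ * avgh (extrap Φ m) d i * gradh h Γ d i + gradh h q d i) :=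
    fun d i => rfl
  have huval : ∀ d i, u d i
      = -gradh h (p m) d i - γ * avgh (extrap φ m) d i * gradh h (μ m) d i := fun d i => rfl
  have havg : ∀ d i, avgh (extrap (Φ - φ) m) d i
      = avgh (extrap Φ m) d i - avgh (extrap φ m) d i := by
    intro d i
    simp only [avgh, extrap, Pi.sub_apply]
    ring
  have hdiv : ∀ i ∈ cells N, divh h (U - u) i = 0 := by
    intro i hi
    have h1 : divh h U i = 0 := by
      rw [hUdef, consVel, divh_neg, Pi.neg_apply, hUdiv i hi, neg_zero]
    rw [divh_sub, Pi.sub_apply, h1, H.divFree m hm hmM i hi, sub_zero]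
  rw [hf]
  refine energy_le_of_splitting (Z := Γ - μ m) (w := U - u) (r := p m - q) hh hs hε hγ hE1 hE0
    (hΓ.sub nμ) hU (hU.sub hu) hdiv (fun i hi => ?_) ?_
    ((((hΦ _).chi (hΦ _)).sub (n1.chi n0)).sub (hEm'.extrap hE0')) (fun i hi => ?_) hF
  · have hJ : ((fun d i => avgh (extrap (Φ - φ) m) d i * U d i)
        + fun d i => avgh (extrap φ m) d i * (U - u) d i)
        = (fun d j => avgh (extrap Φ m) d j * U d j)
          - fun d j => avgh (extrap φ m) d j * u d j := by
      funext d j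
      simp only [Pi.add_apply, Pi.sub_apply, havg]
      ring
    have hlap : laph N h (Γ - μ m) = laph N h Γ - laph N h (μ m) := by
      rw [sub_eq_add_neg, ← neg_one_smul ℝ, laph_add, laph_smul, neg_one_smul, ← sub_eq_add_neg]
    have hev := H.evolution m hm hmM i hi
    rw [hJ, hlap, divh_sub, truncErr]
    simp only [Pi.sub_apply, he₁, he]
    rw [show (Φ (m + 1) i - φ (m + 1) i - (Φ m i - φ m i)) / s
      = (Φ (m + 1) i - Φ m i) / s - (φ (m + 1) i - φ m i) / s by ring, hev]
    ring
  · funext d i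
    simp only [Pi.add_apply, Pi.sub_apply, Pi.smul_apply, smul_eq_mul, hUval, huval, havg,
      gradh_sub]
    ring
  · rw [Pi.sub_apply, H.potential m hm hmM i hi, hΓdef]
    have hlap : laph N h ((3 / 4 : ℝ) • e₁ + (1 / 4 : ℝ) • e₀) i
        = laph N h (fun j => 3 / 4 * Φ (m + 1) j + 1 / 4 * Φ (m - 1) j) i
          - laph N h (fun j => 3 / 4 * φ (m + 1) j + 1 / 4 * φ (m - 1) j) i := by
      have e1 : (3 / 4 : ℝ) • e₁ + (1 / 4 : ℝ) • e₀
          = (fun j => 3 / 4 * Φ (m + 1) j + 1 / 4 * Φ (m - 1) j)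
            + (-1 : ℝ) • fun j => 3 / 4 * φ (m + 1) j + 1 / 4 * φ (m - 1) j := by
        funext j
        simp only [he₁, he₀, Pi.add_apply, Pi.smul_apply, Pi.sub_apply, smul_eq_mul]
        ring
      rw [e1, laph_add, laph_smul]
      simp only [Pi.add_apply, Pi.smul_apply, smul_eq_mul]
      ring
    rw [hlap]
    simp only [discPot, Pi.sub_apply, extrap]
    ring

/-! ### Bounds for the right-hand side -/

theorem extrap_sq_le (φ : ℕ → CellFun) (m : ℕ) (i : Fin 3 → ℤ) :
    extrap φ m i ^ 2 ≤ 5 / 2 * (φ m i ^ 2 + φ (m - 1) i ^ 2) := by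
  simp only [extrap]
  nlinarith [sq_nonneg (φ m i + 3 * φ (m - 1) i)]

theorem avgh_extrap_sq_le {N : Fin 3 → ℕ} {φ : ℕ → CellFun} {m : ℕ} {B : ℝ}
    (hB : ∀ i ∈ cells N, φ m i ^ 2 + φ (m - 1) i ^ 2 ≤ B) :
    ∀ d, ∀ i ∈ cells N, i + eu d ∈ cells N → avgh (extrap φ m) d i ^ 2 ≤ 5 / 2 * B := by
  intro d i hi hid
  have h1 := extrap_sq_le φ m i
  have h2 := extrap_sq_le φ m (i + eu d)
  have h3 := hB i hi
  have h4 := hB _ hid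
  simp only [avgh]
  nlinarith [sq_nonneg (extrap φ m i - extrap φ m (i + eu d))]

/-- The velocity constructed from the exact solution is bounded in `L²`. -/
theorem faceInner_consVel_le {L : Fin 3 → ℝ} {N : Fin 3 → ℕ} {h ε γ K : ℝ}
    (hN : ∀ d, 0 < N d) (hhL : ∀ d, h = L d / N d) (hh : 0 < h) {Φ : ℕ → CellFun} {m : ℕ}
    (hΦ : ∀ k, HomNeumann N (Φ k)) (h1 : GridBound N h K (Φ (m + 1)))
    (h0 : GridBound N h K (Φ m)) (hm : GridBound N h K (Φ (m - 1))) :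
    faceInner N h (consVel N h ε γ Φ m) (consVel N h ε γ Φ m)
      ≤ 15 * (L 0 * L 1 * L 2) * (γ ^ 2 * K ^ 2 * (9 * K ^ 3 + 2 * K + ε ^ 2 * K) ^ 2) := by
  have hΓ : HomNeumann N (discPot N h ε Φ m) := homNeumann_discPot hΦ h ε m
  have hflux : NoFlux N
      (fun d i => γ * avgh (extrap Φ m) d i * gradh h (discPot N h ε Φ m) d i) :=
    (hΓ.noFlux_gradh h).mul_left _
  have hneg : faceInner N h (consVel N h ε γ Φ m) (consVel N h ε γ Φ m)
      = faceInner N h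
        (helmholtzProj N h fun d i => γ * avgh (extrap Φ m) d i * gradh h (discPot N h ε Φ m) d i)
        (helmholtzProj N h fun d i => γ * avgh (extrap Φ m) d i * gradh h (discPot N h ε Φ m) d i) := by
    simp only [consVel, faceInner, Pi.neg_apply, neg_mul_neg]
  rw [hneg]
  refine (faceInner_helmholtzProj_le hN hh hflux).trans ?_
  set KΓ := 9 * K ^ 3 + 2 * K + ε ^ 2 * K with hKΓ
  refine (hflux.faceInner_self_le hh (g := fun _ _ => 5 * (γ ^ 2 * K ^ 2 * KΓ ^ 2))
    (fun _ _ _ => by positivity) fun d i hi hid => ?_).trans (le_of_eq ?_)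
  · have b1 := avgh_extrap_sq_le (φ := Φ) (m := m) (B := 2 * K ^ 2) (fun i hi => by
      have a1 := sq_le_sq' (abs_le.1 (h0.val i hi)).1 (abs_le.1 (h0.val i hi)).2
      have a2 := sq_le_sq' (abs_le.1 (hm.val i hi)).1 (abs_le.1 (hm.val i hi)).2
      linarith) d i hi hid
    have b2 := abs_gradh_discPot_le (ε := ε) hh h1 h0 hm i hi d hid
    have b3 := sq_le_sq' (abs_le.1 b2).1 (abs_le.1 b2).2
    rw [mul_pow, mul_pow]
    calc γ ^ 2 * avgh (extrap Φ m) d i ^ 2 * gradh h (discPot N h ε Φ m) d i ^ 2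
        ≤ γ ^ 2 * (5 / 2 * (2 * K ^ 2)) * KΓ ^ 2 := by gcongr
      _ = 5 * (γ ^ 2 * K ^ 2 * KΓ ^ 2) := by ring
  · rw [← card_cells_mul_pow (mesh_mul_eq hN hhL)]
    simp only [Finset.sum_const, Finset.card_univ, Fintype.card_fin, nsmul_eq_mul]
    push_cast
    ring

/-- The bound for the nonlinear part of the error of the chemical potential. -/
theorem faceInner_gradh_potErr_le {N : Fin 3 → ℕ} {h K R C X : ℝ} (hh : 0 < h) (hR1 : 1 ≤ R)
    (hC : 0 ≤ C) {Φ φ : ℕ → CellFun} {m : ℕ}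
    (hΦ : ∀ k, HomNeumann N (Φ k)) (hφ₁ : HomNeumann N (φ (m + 1))) (hφ : HomNeumann N (φ m))
    (h1 : GridBound N h K (Φ (m + 1))) (h0 : GridBound N h K (Φ m))
    (hR : ∀ i ∈ cells N, |Φ (m + 1) i| ≤ R ∧ |Φ m i| ≤ R ∧ |φ (m + 1) i| ≤ R ∧ |φ m i| ≤ R)
    {e₁ e e₀ : CellFun} (he₁ : e₁ = Φ (m + 1) - φ (m + 1))
    (he : e = Φ m - φ m) (he₀ : e₀ = Φ (m - 1) - φ (m - 1))
    (hX : X = faceInner N h (gradh h e₁) (gradh h e₁) + faceInner N h (gradh h e) (gradh h e)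
      + faceInner N h (gradh h e₀) (gradh h e₀))
    (hq₁ : cellInner N h e₁ e₁ ≤ C * (faceInner N h (gradh h e₁) (gradh h e₁) + h ^ 4))
    (hq : cellInner N h e e ≤ C * (faceInner N h (gradh h e) (gradh h e) + h ^ 4)) :
    faceInner N h (gradh h (potErr Φ φ m)) (gradh h (potErr Φ φ m))
      ≤ (82 + 10368 * K ^ 2 * C) * (R ^ 4 * X + R ^ 2 * h ^ 4) := by
  have t := faceInner_gradh_chi_error_le hh (hΦ (m + 1)) (hΦ m) hφ₁ hφ hR h1.grad h0.grad
  rw [← he₁, ← he] at t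
  have p1 := faceInner_self_nonneg N hh (gradh h e₁)
  have p := faceInner_self_nonneg N hh (gradh h e)
  have p0 := faceInner_self_nonneg N hh (gradh h e₀)
  have hext : extrap (Φ - φ) m = (3 / 2 : ℝ) • e - (1 / 2 : ℝ) • e₀ := by
    funext i
    simp only [extrap, he, he₀, Pi.sub_apply, Pi.smul_apply, smul_eq_mul]
  have t2 : faceInner N h (gradh h (extrap (Φ - φ) m)) (gradh h (extrap (Φ - φ) m)) ≤ 5 * X := by
    rw [hext, gradh_sub, gradh_smul, gradh_smul]
    refine (faceInner_sub_self_le N hh _ _).trans ?_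
    simp only [faceInner_smul_left, faceInner_smul_right]
    linarith
  have t3 : faceInner N h (gradh h (potErr Φ φ m)) (gradh h (potErr Φ φ m))
      ≤ 2 * faceInner N h (gradh h (chi (Φ (m + 1)) (Φ m) - chi (φ (m + 1)) (φ m)))
          (gradh h (chi (Φ (m + 1)) (Φ m) - chi (φ (m + 1)) (φ m)))
        + 2 * faceInner N h (gradh h (extrap (Φ - φ) m)) (gradh h (extrap (Φ - φ) m)) := by
    rw [potErr, gradh_sub h _ (extrap (Φ - φ) m)]
    exact faceInner_sub_self_le N hh _ _
  have hX0 : 0 ≤ X := by linarith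
  have hR2 : 1 ≤ R ^ 2 := one_le_pow₀ hR1
  have hR4 : 1 ≤ R ^ 4 := one_le_pow₀ hR1
  have hR24 : R ^ 2 ≤ R ^ 4 := by nlinarith
  have m1 : R ^ 4 * (faceInner N h (gradh h e₁) (gradh h e₁)
      + faceInner N h (gradh h e) (gradh h e)) ≤ R ^ 4 * X :=
    mul_le_mul_of_nonneg_left (by linarith) (by positivity)
  have m2 : R ^ 2 * K ^ 2 * (cellInner N h e₁ e₁ + cellInner N h e e)
      ≤ K ^ 2 * C * (R ^ 4 * X) + 2 * (K ^ 2 * C * (R ^ 2 * h ^ 4)) := by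
    calc R ^ 2 * K ^ 2 * (cellInner N h e₁ e₁ + cellInner N h e e)
        ≤ R ^ 2 * K ^ 2 * (C * (X + 2 * h ^ 4)) := by
          refine mul_le_mul_of_nonneg_left ?_ (by positivity)
          have : 0 ≤ C * faceInner N h (gradh h e₀) (gradh h e₀) := by positivity
          rw [hX]; linarith
      _ = K ^ 2 * C * (R ^ 2 * X) + 2 * (K ^ 2 * C * (R ^ 2 * h ^ 4)) := by ring
      _ ≤ _ := by gcongr
  have m3 : X ≤ R ^ 4 * X := by nlinarith
  have m4 : 0 ≤ K ^ 2 * C * (R ^ 4 * X) := by positivity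
  have m5 : 0 ≤ R ^ 2 * h ^ 4 := by positivity
  linarith

/-- The power counting: the fourth powers of the maxima are paid for by the growth factor, and the
squares that come with `h⁴` by the pointwise bound of the error. -/
theorem growth_le {K C : ℝ} (hK : 1 ≤ K) (hC : 0 ≤ C) {a b c H E₁ E E₀ X : ℝ} (ha : 0 ≤ a)
    (hb : 0 ≤ b) (hH : 0 ≤ H) (hE₁ : 0 ≤ E₁) (hE : 0 ≤ E) (hE₀ : 0 ≤ E₀) (hX : X = E₁ + E + E₀)
    (h1 : H * a ^ 2 ≤ C * (E₁ + H)) (h0 : H * b ^ 2 ≤ C * (E + H))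
    (hm : H * c ^ 2 ≤ C * (E₀ + H)) :
    (1 + b ^ 2 + c ^ 2) * ((K + a + b) ^ 4 * X + (K + a + b) ^ 2 * H)
      ≤ (54 * K ^ 4 + 3 * K ^ 2 * (2 * (1 + 2 * C) + (1 + 2 * C) ^ 2))
        * (growthTwo a b c * X + H) := by
  have hX0 : 0 ≤ X := by linarith
  set C' := 1 + 2 * C with hC'
  have hC'0 : 0 ≤ C' := by positivity
  set D := growthTwo a b c with hD
  have hA : 1 + a ^ 2 + b ^ 2 ≤ 2 * (a ^ 4 + b ^ 4 + 1) := by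
    nlinarith [sq_nonneg (a ^ 2 - 1), sq_nonneg (b ^ 2 - 1), sq_nonneg a, sq_nonneg b,
      sq_nonneg (a ^ 2), sq_nonneg (b ^ 2)]
  have hB : 1 + b ^ 2 + c ^ 2 ≤ 2 * (b ^ 4 + c ^ 4 + 1) := by
    nlinarith [sq_nonneg (c ^ 2 - 1), sq_nonneg (b ^ 2 - 1), sq_nonneg c, sq_nonneg b,
      sq_nonneg (c ^ 2), sq_nonneg (b ^ 2)]
  have hbc : 1 ≤ b ^ 4 + c ^ 4 + 1 := by nlinarith [sq_nonneg (b ^ 2), sq_nonneg (c ^ 2)]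
  have hab : 1 ≤ a ^ 4 + b ^ 4 + 1 := by nlinarith [sq_nonneg (b ^ 2), sq_nonneg (a ^ 2)]
  have hD1 : a ^ 4 + b ^ 4 + 1 ≤ D := by
    rw [hD, growthTwo]; nlinarith
  have hR2 : (K + a + b) ^ 2 ≤ 3 * K ^ 2 * (1 + a ^ 2 + b ^ 2) := by
    have : (K + a + b) ^ 2 ≤ (K * (1 + a + b)) ^ 2 := by
      refine pow_le_pow_left₀ (by linarith) ?_ 2
      nlinarith
    refine this.trans ?_
    rw [mul_pow]
    have : (1 + a + b) ^ 2 ≤ 3 * (1 + a ^ 2 + b ^ 2) := by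
      nlinarith [sq_nonneg (a - 1), sq_nonneg (b - 1), sq_nonneg (a - b)]
    nlinarith [sq_nonneg K]
  have hR4 : (K + a + b) ^ 4 ≤ 27 * K ^ 4 * (a ^ 4 + b ^ 4 + 1) := by
    have h2 : ((K + a + b) ^ 2) ^ 2 ≤ (3 * K ^ 2 * (1 + a ^ 2 + b ^ 2)) ^ 2 :=
      pow_le_pow_left₀ (sq_nonneg _) hR2 2
    have h3 : (1 + a ^ 2 + b ^ 2) ^ 2 ≤ 3 * (a ^ 4 + b ^ 4 + 1) := by
      nlinarith [sq_nonneg (a ^ 2 - 1), sq_nonneg (b ^ 2 - 1), sq_nonneg (a ^ 2 - b ^ 2)]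
    calc (K + a + b) ^ 4 = ((K + a + b) ^ 2) ^ 2 := by ring
      _ ≤ (3 * K ^ 2 * (1 + a ^ 2 + b ^ 2)) ^ 2 := h2
      _ = 9 * K ^ 4 * (1 + a ^ 2 + b ^ 2) ^ 2 := by ring
      _ ≤ 9 * K ^ 4 * (3 * (a ^ 4 + b ^ 4 + 1)) := by gcongr
      _ = _ := by ring
  have s1 : (1 + b ^ 2 + c ^ 2) * ((K + a + b) ^ 4 * X) ≤ 54 * K ^ 4 * (D * X) := by
    calc (1 + b ^ 2 + c ^ 2) * ((K + a + b) ^ 4 * X)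
        ≤ (2 * (b ^ 4 + c ^ 4 + 1)) * ((27 * K ^ 4 * (a ^ 4 + b ^ 4 + 1)) * X) := by gcongr
      _ = 54 * K ^ 4 * (D * X) := by rw [hD, growthTwo]; ring
  have k1 : 0 ≤ C * E₁ := mul_nonneg hC hE₁
  have k : 0 ≤ C * E := mul_nonneg hC hE
  have k0 : 0 ≤ C * E₀ := mul_nonneg hC hE₀
  have r1 : H * (1 + b ^ 2 + c ^ 2) ≤ C' * (X + H) := by
    rw [hC', hX]; linarith
  have r2 : H * (1 + a ^ 2 + b ^ 2) ≤ C' * (X + H) := by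
    rw [hC', hX]; linarith
  have s2 : (1 + b ^ 2 + c ^ 2) * ((K + a + b) ^ 2 * H)
      ≤ 3 * K ^ 2 * ((2 * C' + C' ^ 2) * (D * X + H)) := by
    calc (1 + b ^ 2 + c ^ 2) * ((K + a + b) ^ 2 * H)
        ≤ (1 + b ^ 2 + c ^ 2) * ((3 * K ^ 2 * (1 + a ^ 2 + b ^ 2)) * H) := by gcongr
      _ = 3 * K ^ 2 * ((1 + a ^ 2 + b ^ 2) * (H * (1 + b ^ 2 + c ^ 2))) := by ring
      _ ≤ 3 * K ^ 2 * ((1 + a ^ 2 + b ^ 2) * (C' * (X + H))) := by gcongr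
      _ = 3 * K ^ 2 * (C' * (1 + a ^ 2 + b ^ 2) * X + C' * (H * (1 + a ^ 2 + b ^ 2))) := by ring
      _ ≤ 3 * K ^ 2 * (C' * (2 * D) * X + C' * (C' * (X + H))) := by
          have : 1 + a ^ 2 + b ^ 2 ≤ 2 * D := by linarith
          gcongr
      _ ≤ 3 * K ^ 2 * ((2 * C' + C' ^ 2) * (D * X + H)) := by
          have : X ≤ D * X := le_mul_of_one_le_left hX0 (hab.trans hD1)
          have : C' ^ 2 * X ≤ C' ^ 2 * (D * X) := by gcongr
          have : 0 ≤ C' * H := by positivity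
          gcongr
          linarith
  have s3 : 0 ≤ 54 * K ^ 4 * H := by positivity
  linarith

theorem growthOne_nonneg {a b c : ℝ} (ha : 0 ≤ a) (hb : 0 ≤ b) (hc : 0 ≤ c) :
    0 ≤ growthOne a b c := by
  unfold growthOne
  positivity

theorem one_le_growthTwo (a b c : ℝ) : 1 ≤ growthTwo a b c :=
  one_le_mul_of_one_le_of_one_le (le_add_of_nonneg_left (by positivity))
    (le_add_of_nonneg_left (by positivity))

/-! ### The error stability law -/

theorem cellInner_extrap_self_le (N : Fin 3 → ℕ) {h : ℝ} (hh : 0 < h) (ψ : ℕ → CellFun) (m : ℕ) :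
    cellInner N h (extrap ψ m) (extrap ψ m)
      ≤ 5 / 2 * (cellInner N h (ψ m) (ψ m) + cellInner N h (ψ (m - 1)) (ψ (m - 1))) := by
  simp only [cellInner_self_eq]
  have : ∑ i ∈ cells N, extrap ψ m i ^ 2
      ≤ 5 / 2 * (∑ i ∈ cells N, ψ m i ^ 2 + ∑ i ∈ cells N, ψ (m - 1) i ^ 2) := by
    rw [← Finset.sum_add_distrib, Finset.mul_sum]
    exact Finset.sum_le_sum fun i _ => extrap_sq_le ψ m i
  have := mul_le_mul_of_nonneg_left this (pow_pos hh 3).le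
  linarith

/-- The mean of the error is of second order: the scheme conserves mass, and so does the exact
solution up to the quadrature error. -/
theorem IsSchemeSolution.abs_mean_error_le {N : Fin 3 → ℕ} {h s ε γ K : ℝ} {M : ℕ} (hs : 0 < s)
    {Φ φ μ p : ℕ → CellFun} (H : IsSchemeSolution N h s ε γ M φ μ p)
    (h0 : ∀ i ∈ cells N, φ 0 i = Φ 0 i) (h1 : ∀ i ∈ cells N, φ 1 i = Φ 1 i)
    (hK : ∀ k, 1 ≤ k → k ≤ M →
      |h ^ 3 * ∑ i ∈ cells N, Φ k i - h ^ 3 * ∑ i ∈ cells N, Φ 1 i| ≤ K * h ^ 2)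
    (hK0 : 0 ≤ K) {k : ℕ} (hk : k ≤ M) :
    |h ^ 3 * ∑ i ∈ cells N, (Φ k - φ k) i| ≤ K * h ^ 2 := by
  simp only [Pi.sub_apply]
  rcases Nat.eq_zero_or_pos k with rfl | hpos
  · rw [Finset.sum_eq_zero fun i hi => by rw [h0 i hi, sub_self]]
    simp only [mul_zero, abs_zero]
    positivity
  · rw [Finset.sum_sub_distrib, H.sum_eq hs k hpos hk, Finset.sum_congr rfl h1, mul_sub]
    exact hK k hpos hk

/-- The arithmetic that combines the bounds for the terms on the right-hand side of the energy
estimate: `P` belongs to the chemical potential, `f` to the transport by the exact velocity, and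
`F`, `F₁`, `F₂`, `Q'` to the error of the velocity. -/
theorem rhs_le {ε γ B C₁ C₂ δ r k₁ k₂ KΓ b c H E₁ E E₀ G G₀ P D Q Q₀ f F F₁ F₂ Q' τ ρ : ℝ}
    (hε : 0 < ε) (hγ : 0 < γ) (hB : 0 ≤ B) (hC₁ : 0 ≤ C₁) (hC₂ : 0 ≤ C₂)
    (hδ : δ = ε ^ 4 / (640 * (B + 1))) (hk₁ : 0 ≤ k₁) (hr : k₁ * k₂ ≤ r)
    (hH : 0 ≤ H) (hE₁ : 0 ≤ E₁) (hE : 0 ≤ E) (hE₀ : 0 ≤ E₀) (hG : 0 ≤ G) (hG₀ : 0 ≤ G₀)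
    (hP : 0 ≤ P) (hD : 1 ≤ D) (hQ : Q ≤ C₁ * (E + H)) (hQ₀ : Q₀ ≤ C₁ * (E₀ + H))
    (hPρ : P ≤ k₁ * ρ) (hρ : (1 + b ^ 2 + c ^ 2) * ρ ≤ k₂ * (D * (E₁ + E + E₀) + H))
    (hf : f ≤ 5 / 2 * (δ * (G + G₀) + C₂ * (E + Q + (E₀ + Q₀))) * B)
    (hF₁ : F₁ ≤ 5 * KΓ ^ 2 * Q') (hQ' : Q' ≤ 5 / 2 * (Q + Q₀))
    (hF₂ : F₂ ≤ 5 / 2 * (b ^ 2 + c ^ 2) * P) (hF : F ≤ 2 * F₁ + 2 * F₂) :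
    1 / 16 * ε ^ 2 * G₀ + 4 / ε ^ 2 * P + 4 / ε ^ 2 * f + γ / (2 * ε ^ 2) * F + 2 * τ
        + 1 / (2 * ε ^ 2) * (E₁ + E₀)
      ≤ ε ^ 2 / 64 * G + 5 / 64 * ε ^ 2 * G₀ + 2 * τ
        + (4 / ε ^ 2 * r + 10 / ε ^ 2 * (C₂ * (1 + 2 * C₁)) * B
          + γ / (2 * ε ^ 2) * (50 * KΓ ^ 2 * C₁ + 5 * r) + 1 / (2 * ε ^ 2))
          * (D * (E₁ + E + E₀) + H) := by
  set Y := D * (E₁ + E + E₀) + H with hY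
  have hXY : E₁ + E + E₀ + H ≤ Y := by
    have : E₁ + E + E₀ ≤ D * (E₁ + E + E₀) := le_mul_of_one_le_left (by positivity) hD
    linarith
  clear_value Y
  have hY0 : 0 ≤ Y := by linarith
  have hW : (1 + b ^ 2 + c ^ 2) * P ≤ r * Y := by
    calc (1 + b ^ 2 + c ^ 2) * P ≤ (1 + b ^ 2 + c ^ 2) * (k₁ * ρ) := by gcongr
      _ = k₁ * ((1 + b ^ 2 + c ^ 2) * ρ) := by ring
      _ ≤ k₁ * (k₂ * Y) := by gcongr
      _ = k₁ * k₂ * Y := by ring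
      _ ≤ r * Y := by gcongr
  have pW : 0 ≤ (b ^ 2 + c ^ 2) * P := by positivity
  have hPY : P ≤ r * Y := by linarith
  have hQQ : Q + Q₀ ≤ 2 * C₁ * Y := by
    have : C₁ * (E₁ + E + E₀ + H) ≤ C₁ * Y := by gcongr
    have : 0 ≤ C₁ * E₁ := by positivity
    have : 0 ≤ C₁ * E := by positivity
    have : 0 ≤ C₁ * E₀ := by positivity
    linarith
  have hfb : 4 / ε ^ 2 * f
      ≤ ε ^ 2 / 64 * (G + G₀) + 10 / ε ^ 2 * (C₂ * (1 + 2 * C₁)) * B * Y := by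
    have h1 : 10 / ε ^ 2 * δ * B ≤ ε ^ 2 / 64 := by
      have : 10 / ε ^ 2 * δ * B = ε ^ 2 / 64 * (B / (B + 1)) := by
        rw [hδ]; field_simp; ring
      rw [this]
      exact mul_le_of_le_one_right (by positivity)
        (div_le_one_of_le₀ (by linarith) (by positivity))
    calc 4 / ε ^ 2 * f
        ≤ 4 / ε ^ 2 * (5 / 2 * (δ * (G + G₀) + C₂ * ((1 + 2 * C₁) * Y)) * B) := by
          refine mul_le_mul_of_nonneg_left (hf.trans ?_) (by positivity)
          gcongr
          linarith
      _ = 10 / ε ^ 2 * δ * B * (G + G₀) + 10 / ε ^ 2 * (C₂ * (1 + 2 * C₁)) * B * Y := by ring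
      _ ≤ _ := by gcongr
  have hFb : F ≤ (50 * KΓ ^ 2 * C₁ + 5 * r) * Y := by
    have h1 := mul_le_mul_of_nonneg_left (hQ'.trans (mul_le_mul_of_nonneg_left hQQ
      (by norm_num : (0 : ℝ) ≤ 5 / 2))) (by positivity : 0 ≤ 5 * KΓ ^ 2)
    linarith
  have z1 := mul_le_mul_of_nonneg_left hPY (by positivity : 0 ≤ 4 / ε ^ 2)
  have z2 := mul_le_mul_of_nonneg_left hFb (by positivity : 0 ≤ γ / (2 * ε ^ 2))
  have z3 := mul_le_mul_of_nonneg_left (show E₁ + E₀ ≤ Y by linarith)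
    (by positivity : 0 ≤ 1 / (2 * ε ^ 2))
  linarith

/-- One step of the error estimate, in terms of `growthTwo` alone. -/
theorem IsExactSolution.exists_error_step_le {L : Fin 3 → ℝ} (hL : ∀ d, 0 < L d) {T ε γ : ℝ}
    (hT : 0 < T) (hε : 0 < ε) (hγ : 0 < γ) {φe pe : ℝ → (Fin 3 → ℝ) → ℝ}
    (hsol : IsExactSolution L T ε γ φe pe) (hreg : RegularityClass L T φe) :
    ∃ C, 0 ≤ C ∧ ∀ (N : Fin 3 → ℕ) (h : ℝ), (∀ d, 0 < N d) → (∀ d, h = L d / N d) →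
      ∀ (M : ℕ) (s : ℝ), 0 < M → s = T / M →
      ∀ (Φ φ μ p : ℕ → CellFun), (∀ k, Φ k = gridProj N h (φe (k * s))) →
        IsSchemeSolution N h s ε γ M φ μ p →
        (∀ i ∈ cells N, φ 0 i = Φ 0 i) → (∀ i ∈ cells N, φ 1 i = Φ 1 i) →
      ∀ m : ℕ, 1 ≤ m → m + 1 ≤ M → ∀ e₁ e e₀ : CellFun, e₁ = Φ (m + 1) - φ (m + 1) →
        e = Φ m - φ m → e₀ = Φ (m - 1) - φ (m - 1) →
        faceInner N h (gradh h e₁) (gradh h e₁) - faceInner N h (gradh h e) (gradh h e)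
          + 1 / 4 * (faceInner N h (gradh h (e₁ - e)) (gradh h (e₁ - e))
            - faceInner N h (gradh h (e - e₀)) (gradh h (e - e₀)))
          + 5 / 16 * ε ^ 2 * s * faceInner N h (gradh h (laph N h e₁)) (gradh h (laph N h e₁))
        ≤ s * (ε ^ 2 / 64 * faceInner N h (gradh h (laph N h e)) (gradh h (laph N h e))
          + 5 / 64 * ε ^ 2 * faceInner N h (gradh h (laph N h e₀)) (gradh h (laph N h e₀))
          + 2 * cellInner N h (truncErr N h s ε γ Φ m) (truncErr N h s ε γ Φ m)
          + C * (growthTwo (supNorm N (φ (m + 1))) (supNorm N (φ m)) (supNorm N (φ (m - 1)))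
            * (faceInner N h (gradh h e₁) (gradh h e₁) + faceInner N h (gradh h e) (gradh h e)
              + faceInner N h (gradh h e₀) (gradh h e₀)) + h ^ 4)) := by
  obtain ⟨K, hK1, hK⟩ := hsol.exists_gridBound hL hT hreg
  obtain ⟨C₁, hC₁, hmean⟩ := HomNeumann.exists_le_of_mean hL K
  have l0 := hL 0
  have l1 := hL 1
  have l2 := hL 2
  set KΓ := 9 * K ^ 3 + 2 * K + ε ^ 2 * K with hKΓ
  set B := 15 * (L 0 * L 1 * L 2) * (γ ^ 2 * K ^ 2 * KΓ ^ 2) with hB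
  have hB0 : 0 ≤ B := by positivity
  -- The squared maximum of the error multiplies the squared norm of the exact velocity, which is at
  -- most `B`; with this `δ` the coefficient of the top-order norms is at most `ε² / 64`.
  set δ := ε ^ 4 / (640 * (B + 1)) with hδ
  have hδ0 : 0 < δ := by positivity
  obtain ⟨C₂, hC₂, hsup⟩ := HomNeumann.exists_sq_le hL hδ0
  set CP := 2 * K ^ 2 + 2 * C₁ with hCP
  have hCP0 : 0 ≤ CP := by positivity
  set r := (82 + 10368 * K ^ 2 * C₁)
    * (54 * K ^ 4 + 3 * K ^ 2 * (2 * (1 + 2 * CP) + (1 + 2 * CP) ^ 2)) with hr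
  have hr0 : 0 ≤ r := by positivity
  refine ⟨4 / ε ^ 2 * r + 10 / ε ^ 2 * (C₂ * (1 + 2 * C₁)) * B
    + γ / (2 * ε ^ 2) * (50 * KΓ ^ 2 * C₁ + 5 * r) + 1 / (2 * ε ^ 2), by positivity, ?_⟩
  intro N h hN hhL M s hM hsT Φ φ μ p hΦdef H hi0 hi1 m hm hmM e₁ e e₀ he₁ he he₀
  have hh := mesh_pos hL hN hhL
  have hMpos : (0 : ℝ) < M := by exact_mod_cast hM
  have hs : 0 < s := by rw [hsT]; positivity
  have hΦ : ∀ k, HomNeumann N (Φ k) := fun k => hΦdef k ▸ homNeumann_gridProj N h _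
  have htime : ∀ k : ℕ, k ≤ M → (k * s) ∈ Set.Icc 0 T := by
    intro k hk
    have hk' : (k : ℝ) ≤ M := by exact_mod_cast hk
    refine ⟨by positivity, ?_⟩
    calc k * s ≤ M * s := by gcongr
      _ = T := by rw [hsT]; field_simp
  obtain ⟨hgb, hmass⟩ := hK N h hN hhL
  have hg : ∀ k ≤ M, GridBound N h K (Φ k) := fun k hk => hΦdef k ▸ hgb _ (htime k hk)
  have hmeanΦ : ∀ k, 1 ≤ k → k ≤ M →
      |h ^ 3 * ∑ i ∈ cells N, Φ k i - h ^ 3 * ∑ i ∈ cells N, Φ 1 i| ≤ K * h ^ 2 := by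
    intro k hk hkM
    rw [hΦdef k, hΦdef 1]
    exact hmass _ (htime 1 (hk.trans hkM)) _ (htime k hkM)
  have hH4 : 0 ≤ h ^ 4 := by positivity
  -- The bounds at one time level.
  have level : ∀ k ≤ M, ∀ ψ, ψ = Φ k - φ k → HomNeumann N ψ ∧
      cellInner N h ψ ψ ≤ C₁ * (faceInner N h (gradh h ψ) (gradh h ψ) + h ^ 4) ∧
      h ^ 4 * supNorm N (φ k) ^ 2 ≤ CP * (faceInner N h (gradh h ψ) (gradh h ψ) + h ^ 4) := by
    rintro k hk ψ rfl
    have hψ := (hΦ k).sub (H.neumann_phi k hk)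
    obtain ⟨b1, b2⟩ := hmean N h hN hhL _ hψ
      (H.abs_mean_error_le hs hi0 hi1 hmeanΦ (by linarith) hk)
    refine ⟨hψ, b1, ?_⟩
    obtain ⟨i, hi, hsupi⟩ := exists_abs_eq_supNorm hN (φ k)
    have b3 := b2 i hi
    have b4 := (hg k hk).val i hi
    have b5 := sq_le_sq' (abs_le.1 b4).1 (abs_le.1 b4).2
    have b6 : φ k i ^ 2 ≤ 2 * K ^ 2 + 2 * (Φ k - φ k) i ^ 2 := by
      rw [Pi.sub_apply]
      nlinarith [sq_nonneg (2 * Φ k i - φ k i)]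
    have b7 := mul_le_mul_of_nonneg_left b6 hH4
    have b8 : 0 ≤ K ^ 2 * faceInner N h (gradh h (Φ k - φ k)) (gradh h (Φ k - φ k)) :=
      mul_nonneg (sq_nonneg K) (faceInner_self_nonneg N hh _)
    rw [← hsupi, sq_abs]
    rw [hCP]
    linarith
  obtain ⟨n1, q1, s1⟩ := level (m + 1) hmM e₁ he₁
  obtain ⟨n, q, s0⟩ := level m (by omega) e he
  obtain ⟨n0, q0, sm⟩ := level (m - 1) (by omega) e₀ he₀
  have key := H.energy_le hN hh hs hε hγ hΦ hm hmM he₁ he he₀ rfl rfl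
  have g1 := hg (m + 1) hmM
  have g0 := hg m (by omega)
  have gm := hg (m - 1) (by omega)
  have ha0 := supNorm_nonneg N (φ (m + 1))
  have hb0 := supNorm_nonneg N (φ m)
  have pE₁ := faceInner_self_nonneg N hh (gradh h e₁)
  have pE := faceInner_self_nonneg N hh (gradh h e)
  have pE₀ := faceInner_self_nonneg N hh (gradh h e₀)
  have pG := faceInner_self_nonneg N hh (gradh h (laph N h e))
  have pG₀ := faceInner_self_nonneg N hh (gradh h (laph N h e₀))
  have pP := faceInner_self_nonneg N hh (gradh h (potErr Φ φ m))
  -- The nonlinear part of the chemical potential.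
  have hPR := faceInner_gradh_potErr_le (R := K + supNorm N (φ (m + 1)) + supNorm N (φ m)) hh
    (by linarith) hC₁ hΦ (H.neumann_phi _ hmM) (H.neumann_phi m (by omega)) g1 g0 (fun i hi => by
      have := abs_le_supNorm (φ (m + 1)) hi
      have := abs_le_supNorm (φ m) hi
      have := g1.val i hi
      have := g0.val i hi
      refine ⟨?_, ?_, ?_, ?_⟩ <;> linarith) he₁ he he₀ rfl q1 q
  have hgr := growth_le hK1 hCP0 ha0 hb0 hH4 pE₁ pE pE₀ rfl s1 s0 sm
  have hD1 := one_le_growthTwo (supNorm N (φ (m + 1))) (supNorm N (φ m)) (supNorm N (φ (m - 1)))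
  -- The velocity of the exact solution, transported by the error.
  have nE : HomNeumann N (extrap (Φ - φ) m) :=
    ((hΦ _).sub (H.neumann_phi m (by omega))).extrap (φ := Φ - φ)
      ((hΦ _).sub (H.neumann_phi (m - 1) (by omega)))
  have eqm : (Φ - φ) m = e := he.symm
  have eqm0 : (Φ - φ) (m - 1) = e₀ := he₀.symm
  have hΓflux : NoFlux N (gradh h (discPot N h ε Φ m)) :=
    (homNeumann_discPot hΦ h ε m).noFlux_gradh h
  have hUflux : NoFlux N (consVel N h ε γ Φ m) :=
    (helmholtzProj_spec hN hh (hΓflux.mul_left fun d i => γ * avgh (extrap Φ m) d i)).2.2.neg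
  have hUB := faceInner_consVel_le (γ := γ) (ε := ε) hN hhL hh hΦ g1 g0 gm
  rw [← hKΓ, ← hB] at hUB
  have hS : ∀ i ∈ cells N, (Φ - φ) m i ^ 2 + (Φ - φ) (m - 1) i ^ 2
      ≤ δ * (faceInner N h (gradh h (laph N h e)) (gradh h (laph N h e))
        + faceInner N h (gradh h (laph N h e₀)) (gradh h (laph N h e₀)))
      + C₂ * (faceInner N h (gradh h e) (gradh h e) + cellInner N h e e
        + (faceInner N h (gradh h e₀) (gradh h e₀) + cellInner N h e₀ e₀)) := by
    intro i hi
    rw [eqm, eqm0]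
    have a1 := hsup N h hN hhL e n i hi
    have a2 := hsup N h hN hhL e₀ n0 i hi
    linarith
  have hS0 := (add_nonneg (sq_nonneg _) (sq_nonneg _)).trans (hS _ (nearCell_mem hN 0))
  have hfb := (hUflux.faceInner_mul_self_le hh (mul_nonneg (by norm_num) hS0)
    (avgh_extrap_sq_le hS)).trans (mul_le_mul_of_nonneg_left hUB (mul_nonneg (by norm_num) hS0))
  -- The error of the velocity.
  have f1 := hΓflux.faceInner_avgh_mul_self_le hh
    (fun i hi d hid => abs_gradh_discPot_le (ε := ε) hh g1 g0 gm i hi d hid) nE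
  rw [← hKΓ] at f1
  have f2 := cellInner_extrap_self_le N hh (Φ - φ) m
  rw [eqm, eqm0] at f2
  have nR : NoFlux N (gradh h (potErr Φ φ m)) := HomNeumann.noFlux_gradh h
    ((((hΦ _).chi (hΦ _)).sub ((H.neumann_phi _ hmM).chi (H.neumann_phi m (by omega)))).sub nE)
  have f5 := nR.faceInner_mul_self_le hh
    (by positivity : 0 ≤ 5 / 2 * (supNorm N (φ m) ^ 2 + supNorm N (φ (m - 1)) ^ 2))
    (avgh_extrap_sq_le (φ := φ) (m := m) fun i hi => by
      have d1 := abs_le.1 (abs_le_supNorm (φ m) hi)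
      have d2 := abs_le.1 (abs_le_supNorm (φ (m - 1)) hi)
      exact add_le_add (sq_le_sq' d1.1 d1.2) (sq_le_sq' d2.1 d2.2))
  have f6 := faceInner_add_self_le N hh
    (fun d i => avgh (extrap (Φ - φ) m) d i * gradh h (discPot N h ε Φ m) d i)
    (fun d i => avgh (extrap φ m) d i * gradh h (potErr Φ φ m) d i)
  -- From here on only real numbers matter.
  refine key.trans (mul_le_mul_of_nonneg_left ?_ hs.le)
  exact rhs_le hε hγ hB0 hC₁ hC₂ hδ (by positivity) hr.le hH4 pE₁ pE pE₀ pG pG₀ pP hD1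
    q q0 hPR hgr hfb f1 f2 f5 f6


end

theorem mainTheorem4 (L : Fin 3 → ℝ) (hL : ∀ d, 0 < L d) (T ε γ : ℝ)
    (hT : 0 < T) (hε : 0 < ε) (hγ : 0 < γ)
    (φe pe : ℝ → (Fin 3 → ℝ) → ℝ)
    (hsol : IsExactSolution L T ε γ φe pe) (hreg : RegularityClass L T φe) :
    ∃ C28 C29 C30 : ℝ, 0 < C28 ∧ 0 < C29 ∧ 0 < C30 ∧
      ∀ (N : Fin 3 → ℕ) (h : ℝ), (∀ d, 0 < N d) → (∀ d, h = L d / N d) →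
      ∀ (M : ℕ) (s : ℝ), 0 < M → s = T / M →
      ∀ (Φ φ μ p φt : ℕ → CellFun),
        (∀ k, Φ k = gridProj N h (φe (k * s))) →
        IsSchemeSolution N h s ε γ M φ μ p →
        (∀ i ∈ cells N, φ 0 i = Φ 0 i) → (∀ i ∈ cells N, φ 1 i = Φ 1 i) →
        (∀ k, φt k = Φ k - φ k) →
      ∀ m : ℕ, 1 ≤ m → m + 1 ≤ M →
        faceNorm N h (gradh h (φt (m + 1))) ^ 2 - faceNorm N h (gradh h (φt m)) ^ 2
          + 1 / 4 * (faceNorm N h (gradh h (φt (m + 1) - φt m)) ^ 2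
              - faceNorm N h (gradh h (φt m - φt (m - 1))) ^ 2)
          + 11 / 64 * ε ^ 2 * s * faceNorm N h (gradh h (laph N h (φt (m + 1)))) ^ 2
        ≤ ε ^ 2 * s / 16 * faceNorm N h (gradh h (laph N h (φt m))) ^ 2
          + 5 * ε ^ 2 * s / 64 * faceNorm N h (gradh h (laph N h (φt (m - 1)))) ^ 2
          + 2 * s * cellNorm N h (truncErr N h s ε γ Φ m) ^ 2
          + s * C28 * growthThree (supNorm N (φ (m + 1))) (supNorm N (φ m)) * h ^ 4
          + s * (C29 * growthOne (supNorm N (φ (m + 1))) (supNorm N (φ m)) (supNorm N (φ (m - 1)))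
              + C30 * growthTwo (supNorm N (φ (m + 1))) (supNorm N (φ m))
                  (supNorm N (φ (m - 1))))
            * (faceNorm N h (gradh h (φt (m + 1))) ^ 2 + faceNorm N h (gradh h (φt m)) ^ 2
              + faceNorm N h (gradh h (φt (m - 1))) ^ 2) := by
  obtain ⟨C, hC, key⟩ := hsol.exists_error_step_le hL hT hε hγ hreg
  -- The estimate needs no contribution from `growthOne`; the constant in front of it is arbitrary.
  refine ⟨C + 1, 1, C + 1, by linarith, one_pos, by linarith, ?_⟩
  intro N h hN hhL M s hM hsT Φ φ μ p φt hΦ H h0 h1 hφt m hm hmM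
  have hh := mesh_pos hL hN hhL
  have hs : 0 < s := by rw [hsT]; positivity
  have step := key N h hN hhL M s hM hsT Φ φ μ p hΦ H h0 h1 m hm hmM (φt (m + 1)) (φt m)
    (φt (m - 1)) (hφt _) (hφt _) (hφt _)
  simp only [faceNorm_sq N hh, cellNorm_sq N hh]
  have ha := supNorm_nonneg N (φ (m + 1))
  have hb := supNorm_nonneg N (φ m)
  have hc := supNorm_nonneg N (φ (m - 1))
  have d1 := growthOne_nonneg ha hb hc
  have d2 := one_le_growthTwo (supNorm N (φ (m + 1))) (supNorm N (φ m)) (supNorm N (φ (m - 1)))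
  have d3 : 1 ≤ growthThree (supNorm N (φ (m + 1))) (supNorm N (φ m)) := by
    unfold growthThree; linarith
  have g1 := faceInner_self_nonneg N hh (gradh h (laph N h (φt (m + 1))))
  have g0 := faceInner_self_nonneg N hh (gradh h (laph N h (φt m)))
  have e1 := faceInner_self_nonneg N hh (gradh h (φt (m + 1)))
  have e0 := faceInner_self_nonneg N hh (gradh h (φt m))
  have em := faceInner_self_nonneg N hh (gradh h (φt (m - 1)))
  set X := faceInner N h (gradh h (φt (m + 1))) (gradh h (φt (m + 1)))
    + faceInner N h (gradh h (φt m)) (gradh h (φt m))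
    + faceInner N h (gradh h (φt (m - 1))) (gradh h (φt (m - 1))) with hX
  have hX0 : 0 ≤ X := add_nonneg (add_nonneg e1 e0) em
  set D₁ := growthOne (supNorm N (φ (m + 1))) (supNorm N (φ m)) (supNorm N (φ (m - 1)))
  set D₂ := growthTwo (supNorm N (φ (m + 1))) (supNorm N (φ m)) (supNorm N (φ (m - 1)))
  set D₃ := growthThree (supNorm N (φ (m + 1))) (supNorm N (φ m))
  clear_value X D₁ D₂ D₃
  have b1 : 0 ≤ s * (D₁ * X) := by positivity
  have b2 : 0 ≤ s * (D₂ * X) := by positivity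
  have b3 : s * (C * h ^ 4) ≤ s * ((C + 1) * D₃ * h ^ 4) := by
    have : C * 1 ≤ (C + 1) * D₃ := by gcongr; linarith
    rw [mul_one] at this
    gcongr
  have b4 : 0 ≤ ε ^ 2 * s * faceInner N h (gradh h (laph N h (φt (m + 1))))
    (gradh h (laph N h (φt (m + 1)))) := by positivity
  have b5 : 0 ≤ ε ^ 2 * s * faceInner N h (gradh h (laph N h (φt m)))
    (gradh h (laph N h (φt m))) := by positivity
  linarith
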